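/- There are a program of a unit-cost random access machine (instructions: loading constants, addition, truncated subtraction, indirect load and store, zero tests; no multiplication) and absolute constants $C, K$ such that the following holds. Let $G, H$ be finite simple undirected unweighted graphs with $|V(G)|=|V(H)|=n$, $G$ connected, and let $d\ge 1$ be an integer. Write $D_G, D_H$ for the shortest-path distances ($\infty$ between different components). For a bijection $F:V(G)\to V(H)$ let $$e_F=\max_{u\ne v}\frac{D_H(F(u),F(v))}{D_G(u,v)},\qquad c_F=\max_{u\neq v}\frac{D_G(u,v)}{D_H(F(u),F(v))}$$ be its expansion and contraction, and say that $F$ has distortion at most $d$ if $e_F,c_F<\infty$ and $e_F\cdot c_F\le d$ (no non-contraction assumption; empty maxima are $0$). Given $n$, $d$ and the adjacency matrices of $G$ and $H$, the program halts and either outputs a bijection $F:V(G)\to V(H)$ of distortion at most $d$, or correctly reports that no such bijection exists. Moreover, for all integers $\alpha\ge 1$ and $\Delta\ge 1$ such that $H$ has maximum degree at most $\Delta$ and treewidth at most $\alpha$, the number of steps is at most $$C\,\alpha^{2}n^{\alpha+11}\cdot\Delta^{d+1}\cdot\left(\alpha\,\Delta^{d+1}\right)^{\Delta^{K\alpha d^{2}}}.$$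 -/

import Mathlib

open scoped ENNReal

/-! ### Metric embeddings of graphs -/

/-- The expansion `max D_H (F u) (F v) / D_G u v` over pairs of distinct vertices, where the shortest
path distance is `⊤` for vertices in different components. -/
noncomputable def expansion {V W : Type*} (G : SimpleGraph V) (H : SimpleGraph W) (F : V → W) :
    ℝ≥0∞ :=
  ⨆ (u : V) (v : V) (_ : u ≠ v), ((H.edist (F u) (F v) : ℕ∞) : ℝ≥0∞) / ((G.edist u v : ℕ∞) : ℝ≥0∞)

/-- The contraction `max D_G u v / D_H (F u) (F v)` over pairs of distinct vertices. -/
noncomputable def contraction {V W : Type*} (G : SimpleGraph V) (H : SimpleGraph W) (F : V → W) :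
    ℝ≥0∞ :=
  ⨆ (u : V) (v : V) (_ : u ≠ v), ((G.edist u v : ℕ∞) : ℝ≥0∞) / ((H.edist (F u) (F v) : ℕ∞) : ℝ≥0∞)

/-- `F` has (finite) distortion at most `d`: expansion and contraction are finite and their product
is at most `d`. -/
def DistortionAtMost {V W : Type*} (G : SimpleGraph V) (H : SimpleGraph W) (d : ℕ) (F : V → W) :
    Prop :=
  expansion G H F ≠ ⊤ ∧ contraction G H F ≠ ⊤ ∧ expansion G H F * contraction G H F ≤ (d : ℝ≥0∞)

/-! ### Treewidth -/

/-- A tree decomposition of `H`, with the tree on the vertex set `Fin m`. -/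
structure TreeDecomposition {V : Type*} (H : SimpleGraph V) (m : ℕ) where
  tree : SimpleGraph (Fin m)
  isTree : tree.IsTree
  bag : Fin m → Finset V
  vertex_cover : ∀ x : V, ∃ u, x ∈ bag u
  edge_cover : ∀ x y : V, H.Adj x y → ∃ u, x ∈ bag u ∧ y ∈ bag u
  path_closed : ∀ (x : V) (u v : Fin m), x ∈ bag u → x ∈ bag v →
    ∀ p : tree.Walk u v, p.IsPath → ∀ w ∈ p.support, x ∈ bag w

/-- The width: size of the largest bag minus one. (On a nonempty graph the largest bag is
nonempty, so the subtraction does not truncate.) -/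
def TreeDecomposition.width {V : Type*} {H : SimpleGraph V} {m : ℕ} (D : TreeDecomposition H m) :
    ℕ :=
  (Finset.univ.sup fun u => (D.bag u).card) - 1

/-- The treewidth of a finite graph: the minimum width of a tree decomposition. -/
noncomputable def treewidth {V : Type*} (H : SimpleGraph V) : ℕ :=
  sInf {w | ∃ (m : ℕ) (D : TreeDecomposition H m), D.width = w}

/-- The one-bag decomposition; in particular the minimum in `treewidth` is over a nonempty set. -/
def TreeDecomposition.trivial {V : Type*} [Fintype V] (H : SimpleGraph V) :
    TreeDecomposition H 1 where
  tree := ⊥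
  isTree := SimpleGraph.IsTree.of_subsingleton
  bag _ := Finset.univ
  vertex_cover _ := ⟨0, Finset.mem_univ _⟩
  edge_cover _ _ _ := ⟨0, Finset.mem_univ _, Finset.mem_univ _⟩
  path_closed _ _ _ _ _ _ _ _ _ := Finset.mem_univ _

theorem treewidth_le_iff {V : Type*} [Fintype V] (H : SimpleGraph V) (k : ℕ) :
    treewidth H ≤ k ↔ ∃ (m : ℕ) (D : TreeDecomposition H m), D.width ≤ k := by
  constructor
  · intro h
    have hne : {w | ∃ (m : ℕ) (D : TreeDecomposition H m), D.width = w}.Nonempty :=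
      ⟨_, 1, TreeDecomposition.trivial H, rfl⟩
    obtain ⟨m, D, hD⟩ := Nat.sInf_mem hne
    exact ⟨m, D, hD.trans_le h⟩
  · rintro ⟨m, D, hD⟩
    have hmem : D.width ∈ {w | ∃ (m : ℕ) (D : TreeDecomposition H m), D.width = w} := ⟨m, D, rfl⟩
    exact (Nat.sInf_le hmem).trans hD

/-! ### Random access machines

A random access machine with unit cost, whose programs are written in structured form. It has
registers and an addressable memory, both holding natural numbers; its arithmetic consists of
addition and truncated subtraction only. (There is no unit-cost multiplication, so that
running times are polynomially related to those of Turing machines.) -/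

namespace RAM

inductive Prog : Type
  /-- `R[r] := k` for a fixed constant `k` -/
  | const (r k : ℕ) : Prog
  /-- `R[r] := R[a] + R[b]` -/
  | add (r a b : ℕ) : Prog
  /-- `R[r] := max (R[a] - R[b]) 0` -/
  | sub (r a b : ℕ) : Prog
  /-- `R[r] := M[R[a]]` -/
  | load (r a : ℕ) : Prog
  /-- `M[R[a]] := R[r]` -/
  | store (a r : ℕ) : Prog
  /-- first `p`, then `q` -/
  | seq (p q : Prog) : Prog
  /-- `p` if `R[r] ≠ 0`, otherwise `q` -/
  | ifNonzero (r : ℕ) (p q : Prog) : Prog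
  /-- repeat `p` as long as `R[r] ≠ 0` -/
  | whileNonzero (r : ℕ) (p : Prog) : Prog

structure State where
  reg : ℕ → ℕ
  mem : ℕ → ℕ

def State.setReg (s : State) (r x : ℕ) : State := { s with reg := Function.update s.reg r x }

def State.setMem (s : State) (a x : ℕ) : State := { s with mem := Function.update s.mem a x }

/-- `Exec p s s' t`: started in state `s`, the program `p` halts in state `s'` after `t` steps.
Every arithmetic or memory instruction and every test of a register is one step. -/
inductive Exec : Prog → State → State → ℕ → Prop
  | const (s : State) (r k : ℕ) : Exec (.const r k) s (s.setReg r k) 1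
  | add (s : State) (r a b : ℕ) : Exec (.add r a b) s (s.setReg r (s.reg a + s.reg b)) 1
  | sub (s : State) (r a b : ℕ) : Exec (.sub r a b) s (s.setReg r (s.reg a - s.reg b)) 1
  | load (s : State) (r a : ℕ) : Exec (.load r a) s (s.setReg r (s.mem (s.reg a))) 1
  | store (s : State) (a r : ℕ) : Exec (.store a r) s (s.setMem (s.reg a) (s.reg r)) 1
  | seq {p q : Prog} {s₁ s₂ s₃ : State} {t₁ t₂ : ℕ} :
      Exec p s₁ s₂ t₁ → Exec q s₂ s₃ t₂ → Exec (.seq p q) s₁ s₃ (t₁ + t₂)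
  | ifTrue {r : ℕ} {p q : Prog} {s s' : State} {t : ℕ} :
      s.reg r ≠ 0 → Exec p s s' t → Exec (.ifNonzero r p q) s s' (t + 1)
  | ifFalse {r : ℕ} {p q : Prog} {s s' : State} {t : ℕ} :
      s.reg r = 0 → Exec q s s' t → Exec (.ifNonzero r p q) s s' (t + 1)
  | whileStop {r : ℕ} {p : Prog} {s : State} :
      s.reg r = 0 → Exec (.whileNonzero r p) s s 1
  | whileStep {r : ℕ} {p : Prog} {s₁ s₂ s₃ : State} {t₁ t₂ : ℕ} :
      s₁.reg r ≠ 0 → Exec p s₁ s₂ t₁ → Exec (.whileNonzero r p) s₂ s₃ t₂ →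
      Exec (.whileNonzero r p) s₁ s₃ (t₁ + t₂ + 1)

/-- The machine is deterministic: the final state and the number of steps are determined by the
program and the initial state. -/
theorem Exec.deterministic {p : Prog} {s s₁ s₂ : State} {t₁ t₂ : ℕ}
    (h₁ : Exec p s s₁ t₁) (h₂ : Exec p s s₂ t₂) : s₁ = s₂ ∧ t₁ = t₂ := by
  induction h₁ generalizing s₂ t₂ with
  | const | add | sub | load | store => cases h₂; exact ⟨rfl, rfl⟩
  | seq _ _ ih₁ ih₂ =>
    cases h₂ with
    | seq a b =>
      obtain ⟨rfl, rfl⟩ := ih₁ a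
      obtain ⟨rfl, rfl⟩ := ih₂ b
      exact ⟨rfl, rfl⟩
  | ifTrue h _ ih =>
    cases h₂ with
    | ifTrue _ a => obtain ⟨rfl, rfl⟩ := ih a; exact ⟨rfl, rfl⟩
    | ifFalse h' _ => exact absurd h' h
  | ifFalse h _ ih =>
    cases h₂ with
    | ifTrue h' _ => exact absurd h h'
    | ifFalse _ a => obtain ⟨rfl, rfl⟩ := ih a; exact ⟨rfl, rfl⟩
  | whileStop h =>
    cases h₂ with
    | whileStop => exact ⟨rfl, rfl⟩
    | whileStep h' _ _ => exact absurd h h'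
  | whileStep h _ _ ih₁ ih₂ =>
    cases h₂ with
    | whileStop h' => exact absurd h' h
    | whileStep _ a b =>
      obtain ⟨rfl, rfl⟩ := ih₁ a
      obtain ⟨rfl, rfl⟩ := ih₂ b
      exact ⟨rfl, rfl⟩

end RAM

/-! ### Input and output of the embedding problem -/

open Classical in
/-- The entry in row `i` and column `j` of the adjacency matrix (rows and columns from `0`). -/
noncomputable def adjBit {n : ℕ} (G : SimpleGraph (Fin n)) (i j : ℕ) : ℕ :=
  if ∃ (hi : i < n) (hj : j < n), G.Adj ⟨i, hi⟩ ⟨j, hj⟩ then 1 else 0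

/-- The input `(G, H, d)` in memory: `n`, then `d`, then the adjacency matrices of `G` and of `H`
row by row, and zeros everywhere else. -/
noncomputable def inputMemory {n : ℕ} (G H : SimpleGraph (Fin n)) (d : ℕ) (a : ℕ) : ℕ :=
  if a = 0 then n
  else if a = 1 then d
  else if a < 2 + n * n then adjBit G ((a - 2) / n) ((a - 2) % n)
  else if a < 2 + 2 * (n * n) then adjBit H ((a - 2 - n * n) / n) ((a - 2 - n * n) % n)
  else 0

/-- The initial state: all registers are zero and the memory holds the input. -/
noncomputable def initialState {n : ℕ} (G H : SimpleGraph (Fin n)) (d : ℕ) : RAM.State :=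
  ⟨fun _ => 0, inputMemory G H d⟩

/-- The memory contents `M` are a correct answer: either `M[0] = 1` and `M[1], …, M[n]` is the
table of values of a bijection of distortion at most `d`, or `M[0] = 0` and there is none. -/
def IsCorrectAnswer {n : ℕ} (G H : SimpleGraph (Fin n)) (d : ℕ) (M : ℕ → ℕ) : Prop :=
  (M 0 = 1 ∧ ∃ F : Fin n → Fin n, (∀ i : Fin n, M (1 + i) = F i) ∧
      Function.Bijective F ∧ DistortionAtMost G H d F) ∨
  (M 0 = 0 ∧ ¬ ∃ F : Fin n → Fin n, Function.Bijective F ∧ DistortionAtMost G H d F)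

/-! Small distortion is a local condition. As soon as there are two vertices, the quantities that
matter are the largest stretch e of an edge of `G` and the largest stretch c of an edge of `H` under
the inverse. By the triangle inequality they bound expansion and contraction, and since an edge has
length one they are also lower bounds. So a bijection of distortion at most d yields integers e, c
in [1, min n d] with e * c ≤ d that bound the stretch of all edges
(`DistortionAtMost.exists_edges`), and conversely (`distortionAtMost_of_edges`). Finite expansion
forces `H` to be connected. In terms of the inverse ψ from `H` to `G` this reads (`IsLocalInverse`):
neighbours go to distance at most c, and every `G`-neighbour of ψ x is a value of ψ on the e-ball
around x. Bijectivity need not be imposed. Walks of `G` lift step by step, so ψ is onto, hence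
injective by finiteness (`IsLocalInverse.bijective`). The only global constraint has disappeared.

Such a ψ is assembled from views, its restrictions to the balls of radius e in `H`. Views that agree
along the edges of `H` come from one map (`IsLocalInverse.of_views`). Let g be the largest size of
an `H`-ball of radius c * e * e. The image of an e-ball lies in a `G`-ball of radius c * e, and that
ball is covered by the image of an `H`-ball of radius c * e * e. A view is thus a centre in `G` and
at most g digits in base g, which leaves N = n * g ^ g candidates per vertex (`exists_views`). What
remains is a constraint problem on `H` with unary constraints `ViewOk` and binary constraints
`ViewsAgree` on edges.

Bounded treewidth makes that problem tractable. It enters through layerings (`IsLayering`): the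
component of v among the vertices not earlier than v has at most k neighbours, its `upper` set.
Ordering vertices by the depth of their topmost bag turns a tree decomposition into a layering
(`TreeDecomposition.exists_isLayering`). Each nonempty `upper` set has a latest element, the parent
(`IsLayering.exists_parent`), so the vertices form a forest. For every v and each of at most N ^ k
assignments to `upper` there is a table entry that is nonzero exactly if some value of v passes the
constraints and the tables of the children. A solution makes all entries along it nonzero
(`table_ne_zero_of_solution`), and following the entries from the roots produces a solution
(`table_ne_zero_of_extraction`).

The program must find a layering itself. For k = 0, 1, ... it takes every set of at most k vertices
as separator, and for each component it leaves it looks for a vertex whose removal leaves components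
that are already solved. After n rounds all components of any layering of width k have been
recognised (`IsLayering.marked`, `rounds_spec`), and the recorded choices define layers
(`placeLayers_spec`). The first successful k is at most the treewidth.

The algorithm is written in a language of bounded loops and compiled to the machine
(`Stmt.compile_spec`). Its cost is read off the program text as one monomial, a constant times n ^ 9
* f ^ 5 * m, with f bounding radii and view counts and m bounding table sizes (`main_cost`). Since c
* e * e ≤ d ^ 2 and balls of radius r have at most (Δ + 1) ^ r vertices, g ^ g is at most Δ ^ Δ ^ (4
* d ^ 2) when Δ ≥ 2, and the claimed bound follows (`fits_of_treewidth`). Graphs with at most two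
vertices cost a constant, and a disconnected `H` is rejected before the search. -/

/-! ### A language of bounded loops, and its compilation to the random access machine -/

namespace LoopLang

/-- Pure expressions over variables and arrays. `sum x v b` is `∑ x < v, b` and `mul v b` is
`v * b`, where `v` is a variable. -/
inductive Expr : Type
  | var (x : ℕ) : Expr
  | lit (k : ℕ) : Expr
  | add (a b : Expr) : Expr
  | sub (a b : Expr) : Expr
  | read (A : Fin 32) (i : Expr) : Expr
  | ite (c a b : Expr) : Expr
  | sum (x v : ℕ) (b : Expr) : Expr
  | mul (v : ℕ) (b : Expr) : Expr

/-- Statements. `loop x v p` runs `p` for `x = 0, …, v - 1`, and `letv x e p` runs `p` with `x`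
bound to the value of `e`. -/
inductive Stmt : Type
  | write (A : Fin 32) (i e : Expr) : Stmt
  | seq (p q : Stmt) : Stmt
  | ite (c : Expr) (p q : Stmt) : Stmt
  | loop (x v : ℕ) (p : Stmt) : Stmt
  | letv (x : ℕ) (e : Expr) (p : Stmt) : Stmt
  | skip : Stmt

abbrev Env := ℕ → ℕ

/-- The contents of the arrays. Array `0` is the part of the memory that holds the input. -/
abbrev Store := Fin 32 → ℕ → ℕ

def Env.set (ρ : Env) (x a : ℕ) : Env := fun y => if y = x then a else ρ y

def Store.put (s : Store) (A : Fin 32) (i a : ℕ) : Store :=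
  fun B j => if B = A ∧ j = i then a else s B j

/-- The value of an expression; array `0` has length `L`. -/
def Expr.eval (L : ℕ) : Expr → Env → Store → ℕ
  | var x, ρ, _ => ρ x
  | lit k, _, _ => k
  | add a b, ρ, s => a.eval L ρ s + b.eval L ρ s
  | sub a b, ρ, s => a.eval L ρ s - b.eval L ρ s
  | read A i, ρ, s => if A = 0 ∧ L ≤ i.eval L ρ s then 0 else s A (i.eval L ρ s)
  | ite c a b, ρ, s => if c.eval L ρ s = 0 then b.eval L ρ s else a.eval L ρ s
  | sum x v b, ρ, s => ∑ i ∈ Finset.range (ρ v), b.eval L (ρ.set x i) s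
  | mul v b, ρ, s => ρ v * b.eval L ρ s

/-- `iter n f s` applies `f 0`, …, `f (n - 1)` in turn. -/
def iter {σ : Type*} (f : ℕ → σ → σ) : ℕ → σ → σ
  | 0, s => s
  | n + 1, s => f n (iter f n s)

def Stmt.run (L : ℕ) : Stmt → Env → Store → Store
  | write A i e, ρ, s =>
      if A = 0 ∧ L ≤ i.eval L ρ s then s else s.put A (i.eval L ρ s) (e.eval L ρ s)
  | seq p q, ρ, s => q.run L ρ (p.run L ρ s)
  | ite c p q, ρ, s => if c.eval L ρ s = 0 then q.run L ρ s else p.run L ρ s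
  | loop x v p, ρ, s => iter (fun i s => p.run L (ρ.set x i) s) (ρ v) s
  | letv x e p, ρ, s => p.run L (ρ.set x (e.eval L ρ s)) s
  | skip, _, s => s

/-- A bound for the number of machine steps of the evaluation of an expression. -/
def Expr.cost : Expr → Env → ℕ
  | var _, _ => 2
  | lit _, _ => 1
  | add a b, ρ => a.cost ρ + b.cost ρ + 1
  | sub a b, ρ => a.cost ρ + b.cost ρ + 1
  | read _ i, ρ => i.cost ρ + 9
  | ite c a b, ρ => c.cost ρ + a.cost ρ + b.cost ρ + 1
  | sum x v b, ρ => 9 + ∑ i ∈ Finset.range (ρ v), (b.cost (ρ.set x i) + 5)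
  | mul v b, ρ => b.cost ρ + 5 + ρ v * 3

/-- A bound for the number of machine steps of a statement. -/
def Stmt.cost (L : ℕ) : Stmt → Env → Store → ℕ
  | write _ i e, ρ, _ => i.cost ρ + e.cost ρ + 10
  | seq p q, ρ, s => p.cost L ρ s + q.cost L ρ (p.run L ρ s)
  | ite c p q, ρ, s =>
      c.cost ρ + 1 + if c.eval L ρ s = 0 then q.cost L ρ s else p.cost L ρ s
  | loop x v p, ρ, s => 8 + ∑ i ∈ Finset.range (ρ v),
      (p.cost L (ρ.set x i) (iter (fun i s => p.run L (ρ.set x i) s) i s) + 4)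
  | letv x e p, ρ, s => e.cost ρ + 6 + p.cost L (ρ.set x (e.eval L ρ s)) s
  | skip, _, _ => 1

open RAM

/-- The scratch register of level `δ`. Variable `x` lives in register `2 * x`, and register `1`
holds the length of array `0`. -/
def tmp (δ : ℕ) : ℕ := 2 * δ + 3

/-- Replaces the index in `tmp δ` by the address of that entry of array `A`. -/
def addrProg (A δ : ℕ) : Prog :=
  .seq (.add (tmp δ) (tmp δ) (tmp δ)) <| .seq (.add (tmp δ) (tmp δ) (tmp δ)) <|
  .seq (.add (tmp δ) (tmp δ) (tmp δ)) <| .seq (.add (tmp δ) (tmp δ) (tmp δ)) <|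
  .seq (.add (tmp δ) (tmp δ) (tmp δ)) <| .seq (.const (tmp (δ + 1)) A) <|
  .seq (.add (tmp δ) (tmp δ) (tmp (δ + 1))) (.add (tmp δ) (tmp δ) 1)

def copyProg (r a : ℕ) : Prog := .seq (.const r 0) (.add r r a)

def Expr.compile : Expr → ℕ → Prog
  | var x, δ => copyProg (tmp δ) (2 * x)
  | lit k, δ => .const (tmp δ) k
  | add a b, δ =>
      .seq (a.compile δ) (.seq (b.compile (δ + 1)) (.add (tmp δ) (tmp δ) (tmp (δ + 1))))
  | sub a b, δ =>
      .seq (a.compile δ) (.seq (b.compile (δ + 1)) (.sub (tmp δ) (tmp δ) (tmp (δ + 1))))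
  | read A i, δ =>
      if A = 0 then
        .seq (i.compile δ) (.seq (.sub (tmp (δ + 1)) 1 (tmp δ))
          (.ifNonzero (tmp (δ + 1)) (.load (tmp δ) (tmp δ)) (.const (tmp δ) 0)))
      else .seq (i.compile δ) (.seq (addrProg A δ) (.load (tmp δ) (tmp δ)))
  | ite c a b, δ => .seq (c.compile δ) (.ifNonzero (tmp δ) (a.compile δ) (b.compile δ))
  | sum x v b, δ =>
      .seq (.const (tmp δ) 0) <| .seq (copyProg (tmp (δ + 1)) (2 * x)) <|
      .seq (copyProg (tmp (δ + 2)) (2 * v)) <| .seq (.const (2 * x) 0) <|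
      .seq (.whileNonzero (tmp (δ + 2))
        (.seq (b.compile (δ + 3)) <| .seq (.add (tmp δ) (tmp δ) (tmp (δ + 3))) <|
          .seq (.const (tmp (δ + 3)) 1) <| .seq (.add (2 * x) (2 * x) (tmp (δ + 3)))
            (.sub (tmp (δ + 2)) (tmp (δ + 2)) (tmp (δ + 3)))))
        (copyProg (2 * x) (tmp (δ + 1)))
  | mul v b, δ =>
      .seq (b.compile (δ + 1)) <| .seq (.const (tmp δ) 0) <|
      .seq (copyProg (tmp (δ + 2)) (2 * v)) <| .seq (.const (tmp (δ + 3)) 1)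
      (.whileNonzero (tmp (δ + 2))
        (.seq (.add (tmp δ) (tmp δ) (tmp (δ + 1)))
          (.sub (tmp (δ + 2)) (tmp (δ + 2)) (tmp (δ + 3)))))

def Stmt.compile : Stmt → ℕ → Prog
  | write A i e, δ =>
      if A = 0 then
        .seq (i.compile δ) (.seq (e.compile (δ + 1)) (.seq (.sub (tmp (δ + 2)) 1 (tmp δ))
          (.ifNonzero (tmp (δ + 2)) (.store (tmp δ) (tmp (δ + 1))) (.const (tmp δ) 0))))
      else
        .seq (e.compile δ) (.seq (i.compile (δ + 1)) (.seq (addrProg A (δ + 1))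
          (.store (tmp (δ + 1)) (tmp δ))))
  | seq p q, δ => .seq (p.compile δ) (q.compile δ)
  | ite c p q, δ => .seq (c.compile δ) (.ifNonzero (tmp δ) (p.compile δ) (q.compile δ))
  | loop x v p, δ =>
      .seq (copyProg (tmp δ) (2 * x)) <| .seq (copyProg (tmp (δ + 1)) (2 * v)) <|
      .seq (.const (2 * x) 0) <|
      .seq (.whileNonzero (tmp (δ + 1))
        (.seq (p.compile (δ + 2)) <| .seq (.const (tmp (δ + 2)) 1) <|
          .seq (.add (2 * x) (2 * x) (tmp (δ + 2)))
            (.sub (tmp (δ + 1)) (tmp (δ + 1)) (tmp (δ + 2)))))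
        (copyProg (2 * x) (tmp δ))
  | letv x e p, δ =>
      .seq (copyProg (tmp δ) (2 * x)) <| .seq (e.compile (δ + 1)) <|
      .seq (copyProg (2 * x) (tmp (δ + 1))) <| .seq (p.compile (δ + 1))
        (copyProg (2 * x) (tmp δ))
  | skip, δ => .const (tmp δ) 0

/-! ### Timed execution rules of the machine -/

/-- The program halts within `B` steps in a state that satisfies `Q`. -/
def Runs (p : Prog) (σ : State) (B : ℕ) (Q : State → Prop) : Prop :=
  ∃ σ' t, Exec p σ σ' t ∧ t ≤ B ∧ Q σ'

theorem Runs.weaken {p σ B B' Q Q'} (h : Runs p σ B Q) (hB : B ≤ B') (hQ : ∀ σ', Q σ' → Q' σ') :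
    Runs p σ B' Q' := by
  obtain ⟨σ', t, he, ht, hq⟩ := h
  exact ⟨σ', t, he, ht.trans hB, hQ _ hq⟩

theorem Runs.seq {p q σ B B' Q Q'} (h : Runs p σ B Q) (h' : ∀ σ', Q σ' → Runs q σ' B' Q') :
    Runs (.seq p q) σ (B + B') Q' := by
  obtain ⟨σ', t, he, ht, hq⟩ := h
  obtain ⟨σ'', t', he', ht', hq'⟩ := h' σ' hq
  exact ⟨σ'', t + t', .seq he he', by omega, hq'⟩

theorem Runs.const {σ r k Q} (h : Q (σ.setReg r k)) : Runs (.const r k) σ 1 Q :=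
  ⟨_, _, .const .., le_rfl, h⟩

theorem Runs.add {σ r a b Q} (h : Q (σ.setReg r (σ.reg a + σ.reg b))) :
    Runs (.add r a b) σ 1 Q := ⟨_, _, .add .., le_rfl, h⟩

theorem Runs.sub {σ r a b Q} (h : Q (σ.setReg r (σ.reg a - σ.reg b))) :
    Runs (.sub r a b) σ 1 Q := ⟨_, _, .sub .., le_rfl, h⟩

theorem Runs.load {σ r a Q} (h : Q (σ.setReg r (σ.mem (σ.reg a)))) :
    Runs (.load r a) σ 1 Q := ⟨_, _, .load .., le_rfl, h⟩

theorem Runs.store {σ r a Q} (h : Q (σ.setMem (σ.reg a) (σ.reg r))) :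
    Runs (.store a r) σ 1 Q := ⟨_, _, .store .., le_rfl, h⟩

theorem Runs.ifNonzero {r p q σ B B' Q} (h : σ.reg r ≠ 0 → Runs p σ B Q)
    (h' : σ.reg r = 0 → Runs q σ B' Q) :
    Runs (.ifNonzero r p q) σ ((if σ.reg r = 0 then B' else B) + 1) Q := by
  by_cases hr : σ.reg r = 0
  · obtain ⟨σ', t, he, ht, hq⟩ := h' hr
    exact ⟨σ', t + 1, .ifFalse hr he, by simp [hr, ht], hq⟩
  · obtain ⟨σ', t, he, ht, hq⟩ := h hr
    exact ⟨σ', t + 1, .ifTrue hr he, by simp [hr, ht], hq⟩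

/-- The invariant pins the counter register to m - i, so the loop makes exactly m passes. Each pass
pays one step for its test, and the final failing test costs one more. -/
theorem Runs.count {r : ℕ} {p : Prog} (m : ℕ) (c : ℕ → ℕ) (I : ℕ → State → Prop)
    (hr : ∀ i σ, I i σ → σ.reg r = m - i)
    (h : ∀ i < m, ∀ σ, I i σ → Runs p σ (c i) (I (i + 1))) (σ : State) (h0 : I 0 σ) :
    Runs (.whileNonzero r p) σ (∑ i ∈ Finset.range m, (c i + 1) + 1) (I m) := by
  -- The induction is on the number j of passes still to come, because `whileStep` peels a loop from
  -- the front.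
  suffices H : ∀ j ≤ m, ∀ σ, I (m - j) σ →
      Runs (.whileNonzero r p) σ (∑ i ∈ Finset.Ico (m - j) m, (c i + 1) + 1) (I m) by
    have := H m le_rfl σ (by rwa [Nat.sub_self])
    rwa [Nat.sub_self, ← Finset.range_eq_Ico] at this
  intro j
  induction j with
  | zero =>
    intro _ σ hσ
    exact ⟨σ, 1, .whileStop (by simpa using hr _ _ hσ), by simp, hσ⟩
  | succ j ih =>
    intro hj σ hσ
    obtain ⟨σ', t, he, ht, hq⟩ := h (m - (j + 1)) (by omega) σ hσ
    have e1 : m - (j + 1) + 1 = m - j := by omega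
    rw [e1] at hq
    obtain ⟨σ'', t', he', ht', hq'⟩ := ih (by omega) σ' hq
    refine ⟨σ'', t + t' + 1, .whileStep ?_ he he', ?_, hq'⟩
    · have := hr _ _ hσ; omega
    · rw [Finset.sum_eq_sum_Ico_succ_bot (by omega), e1]; omega

/-- Only array 0 is contiguous and of bounded length, because the formats of input and output
prescribe its place. The other 31 arrays are interleaved behind it with stride 32, so that all of
them are unbounded. -/
structure Rel (L : ℕ) (ρ : Env) (s : Store) (σ : State) : Prop where
  var : ∀ x, σ.reg (2 * x) = ρ x
  lim : σ.reg 1 = L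
  low : ∀ i < L, σ.mem i = s 0 i
  arr : ∀ A : Fin 32, A ≠ 0 → ∀ i, σ.mem (L + 32 * i + A) = s A i

/-- Registers below level `δ`, and all variables, agree. -/
def Keeps (δ : ℕ) (σ σ' : State) : Prop :=
  (∀ x, σ'.reg (2 * x) = σ.reg (2 * x)) ∧ σ'.reg 1 = σ.reg 1 ∧
    ∀ ε < δ, σ'.reg (tmp ε) = σ.reg (tmp ε)

theorem Keeps.trans {δ σ σ' σ''} (h : Keeps δ σ σ') (h' : Keeps δ σ' σ'') : Keeps δ σ σ'' :=
  ⟨fun x => (h'.1 x).trans (h.1 x), h'.2.1.trans h.2.1,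
    fun ε hε => (h'.2.2 ε hε).trans (h.2.2 ε hε)⟩

theorem Keeps.mono {δ δ' σ σ'} (h : Keeps δ' σ σ') (hδ : δ ≤ δ') : Keeps δ σ σ' :=
  ⟨h.1, h.2.1, fun ε hε => h.2.2 ε (by omega)⟩

theorem Keeps.refl (δ σ) : Keeps δ σ σ := ⟨fun _ => rfl, rfl, fun _ _ => rfl⟩

theorem Rel.of_keeps {L ρ s σ σ' δ} (h : Rel L ρ s σ) (hk : Keeps δ σ σ')
    (hm : σ'.mem = σ.mem) : Rel L ρ s σ' :=
  ⟨fun x => (hk.1 x).trans (h.var x), hk.2.1.trans h.lim, by rw [hm]; exact h.low,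
    by rw [hm]; exact h.arr⟩

@[simp] theorem setReg_reg (σ : State) (r a r' : ℕ) :
    (σ.setReg r a).reg r' = if r' = r then a else σ.reg r' := by
  simp [State.setReg, Function.update_apply]

@[simp] theorem setReg_mem (σ : State) (r a : ℕ) : (σ.setReg r a).mem = σ.mem := rfl

@[simp] theorem setMem_reg (σ : State) (r a : ℕ) : (σ.setMem r a).reg = σ.reg := rfl

@[simp] theorem setMem_mem (σ : State) (r a r' : ℕ) :
    (σ.setMem r a).mem r' = if r' = r then a else σ.mem r' := by
  simp [State.setMem, Function.update_apply]

@[simp] theorem tmp_inj {a b : ℕ} : tmp a = tmp b ↔ a = b := by simp [tmp]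

@[simp] theorem tmp_ne_var {a x : ℕ} : tmp a ≠ 2 * x := by simp only [tmp]; omega

@[simp] theorem var_ne_tmp {a x : ℕ} : 2 * x ≠ tmp a := by simp only [tmp]; omega

@[simp] theorem one_ne_tmp {a : ℕ} : 1 ≠ tmp a := by simp only [tmp]; omega

@[simp] theorem one_ne_var {x : ℕ} : 1 ≠ 2 * x := by omega

theorem Keeps.setTmp {δ ε σ σ' a} (h : Keeps δ σ σ') (hε : δ ≤ ε) :
    Keeps δ σ (σ'.setReg (tmp ε) a) := by
  refine ⟨fun x => ?_, ?_, fun η hη => ?_⟩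
  · simp [h.1 x]
  · simp [h.2.1]
  · simp [h.2.2 η hη]; omega

theorem runs_copy {σ r a Q} (hra : r ≠ a) (h : Q (σ.setReg r (σ.reg a))) :
    Runs (copyProg r a) σ 2 Q := by
  refine Runs.seq (B := 1) (B' := 1) (Q := fun σ' => σ' = σ.setReg r 0) (Runs.const rfl) ?_
  rintro _ rfl
  apply Runs.add
  have : (σ.setReg r 0).setReg r ((σ.setReg r 0).reg r + (σ.setReg r 0).reg a)
      = σ.setReg r (σ.reg a) := by
    simp [hra.symm, State.setReg]
  rwa [this]

theorem runs_addr {σ : State} {L A δ i} (hi : σ.reg (tmp δ) = i) (hL : σ.reg 1 = L) :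
    Runs (addrProg A δ) σ 8 (fun σ' => σ'.reg (tmp δ) = L + 32 * i + A ∧ σ'.mem = σ.mem ∧
      Keeps δ σ σ') := by
  refine ⟨_, _, .seq (.add ..) (.seq (.add ..) (.seq (.add ..) (.seq (.add ..) (.seq (.add ..)
    (.seq (.const ..) (.seq (.add ..) (.add ..))))))), by norm_num, ?_, rfl, ?_⟩
  · simp [hi, hL]; ring
  · repeat' refine Keeps.setTmp ?_ (by omega)
    exact Keeps.refl _ _

/-! ### Correctness and cost of compiled code -/

theorem Rel.set {L ρ s σ σ'} {x a : ℕ} (h : Rel L ρ s σ) (hm : σ'.mem = σ.mem)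
    (hv : ∀ y, σ'.reg (2 * y) = if y = x then a else σ.reg (2 * y)) (h1 : σ'.reg 1 = σ.reg 1) :
    Rel L (Env.set ρ x a) s σ' :=
  ⟨fun y => by rw [hv, Env.set, h.var], h1.trans h.lim, by rw [hm]; exact h.low,
    by rw [hm]; exact h.arr⟩

/-- Scratch registers form a stack: the result appears at level δ, subexpressions work at levels
from δ upwards, and everything below survives. The cost depends on the environment alone because
loop bounds are variables, never entries of the store. -/
theorem Expr.compile_spec {L : ℕ} {s : Store} (e : Expr) : ∀ (δ : ℕ) (ρ : Env) (σ : State),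
    Rel L ρ s σ → Runs (e.compile δ) σ (e.cost ρ) (fun σ' =>
      σ'.reg (tmp δ) = e.eval L ρ s ∧ σ'.mem = σ.mem ∧ Keeps δ σ σ') := by
  induction e with
  | var x =>
    intro δ ρ σ h
    refine runs_copy (by simp) ⟨?_, rfl, (Keeps.refl _ _).setTmp le_rfl⟩
    simp [Expr.eval, h.var]
  | lit k =>
    intro δ ρ σ h
    exact Runs.const ⟨by simp [Expr.eval], rfl, (Keeps.refl _ _).setTmp le_rfl⟩
  | add a b iha ihb =>
    intro δ ρ σ h
    refine Runs.weaken (B := a.cost ρ + (b.cost ρ + 1)) (Runs.seq (iha δ ρ σ h) ?_)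
      (by simp only [Expr.cost]; omega) (fun _ h => h)
    rintro σ₁ ⟨h1, m1, k1⟩
    refine Runs.seq (ihb (δ + 1) ρ σ₁ (h.of_keeps k1 m1)) ?_
    rintro σ₂ ⟨h2, m2, k2⟩
    refine Runs.add ⟨?_, by simp [m2, m1], (k1.trans (k2.mono (by omega))).setTmp le_rfl⟩
    simp [Expr.eval, h2, k2.2.2 δ (by omega), h1]
  | sub a b iha ihb =>
    intro δ ρ σ h
    refine Runs.weaken (B := a.cost ρ + (b.cost ρ + 1)) (Runs.seq (iha δ ρ σ h) ?_)
      (by simp only [Expr.cost]; omega) (fun _ h => h)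
    rintro σ₁ ⟨h1, m1, k1⟩
    refine Runs.seq (ihb (δ + 1) ρ σ₁ (h.of_keeps k1 m1)) ?_
    rintro σ₂ ⟨h2, m2, k2⟩
    refine Runs.sub ⟨?_, by simp [m2, m1], (k1.trans (k2.mono (by omega))).setTmp le_rfl⟩
    simp [Expr.eval, h2, k2.2.2 δ (by omega), h1]
  | read A i ih =>
    intro δ ρ σ h
    by_cases hA : A = 0
    · subst hA
      simp only [Expr.compile, if_true]
      refine Runs.weaken (B := i.cost ρ + (1 + (1 + 1))) (Runs.seq (ih δ ρ σ h) ?_)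
        (by simp only [Expr.cost]; omega) (fun _ h => h)
      rintro σ₁ ⟨h1, m1, k1⟩
      refine Runs.seq (Q := fun σ' => σ' = σ₁.setReg (tmp (δ + 1)) (σ₁.reg 1 - σ₁.reg (tmp δ)))
        (Runs.sub rfl) ?_
      rintro _ rfl
      have hl := (h.of_keeps k1 m1)
      refine Runs.weaken (Runs.ifNonzero (B := 1) (B' := 1) ?_ ?_) (by split <;> omega)
        (fun _ h => h)
      · intro hne
        refine Runs.load ⟨?_, by simp [m1],
          (Keeps.setTmp k1 (by omega)).setTmp le_rfl⟩
        simp only [setReg_reg, hl.lim, h1, if_true] at hne ⊢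
        have hlt : i.eval L ρ s < L := by omega
        simp [Expr.eval, hl.low _ hlt, hlt.not_ge]
      · intro hz
        refine Runs.const ⟨?_, by simp [m1],
          (Keeps.setTmp k1 (by omega)).setTmp le_rfl⟩
        simp only [setReg_reg, hl.lim, h1, if_true] at hz ⊢
        have hge : L ≤ i.eval L ρ s := by omega
        simp [Expr.eval, hge]
    · simp only [Expr.compile, if_neg hA]
      refine Runs.weaken (B := i.cost ρ + (8 + 1)) (Runs.seq (ih δ ρ σ h) ?_)
        (by simp only [Expr.cost]; omega) (fun _ h => h)
      rintro σ₁ ⟨h1, m1, k1⟩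
      refine Runs.seq (runs_addr h1 (h.of_keeps k1 m1).lim) ?_
      rintro σ₂ ⟨h2, m2, k2⟩
      refine Runs.load ⟨?_, by simp [m2, m1], (k1.trans k2).setTmp le_rfl⟩
      simp [Expr.eval, h2, hA, m2, (h.of_keeps k1 m1).arr A hA]
  | ite c a b ihc iha ihb =>
    intro δ ρ σ h
    refine Runs.weaken (B := c.cost ρ + (max (b.cost ρ) (a.cost ρ) + 1))
      (Runs.seq (ihc δ ρ σ h) ?_)
      (by simp only [Expr.cost]; omega) (fun _ h => h)
    rintro σ₁ ⟨h1, m1, k1⟩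
    refine Runs.weaken (Runs.ifNonzero (B := a.cost ρ) (B' := b.cost ρ)
      (Q := fun σ' => σ'.reg (tmp δ) = (ite c a b).eval L ρ s ∧ σ'.mem = σ.mem ∧ Keeps δ σ σ')
      ?_ ?_) (by split <;> omega) (fun _ h => h)
    · intro hne
      refine (iha δ ρ σ₁ (h.of_keeps k1 m1)).weaken le_rfl ?_
      rintro σ₂ ⟨h2, m2, k2⟩
      rw [h1] at hne
      exact ⟨by simp [Expr.eval, hne, h2], m2.trans m1, k1.trans k2⟩
    · intro hz
      refine (ihb δ ρ σ₁ (h.of_keeps k1 m1)).weaken le_rfl ?_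
      rintro σ₂ ⟨h2, m2, k2⟩
      rw [h1] at hz
      exact ⟨by simp [Expr.eval, hz, h2], m2.trans m1, k1.trans k2⟩
  | sum x v b ih =>
    intro δ ρ σ h
    refine Runs.weaken (B := 1 + (2 + (2 + (1 + ((∑ i ∈ Finset.range (ρ v),
        (b.cost (Env.set ρ x i) + (1 + (1 + (1 + 1))) + 1) + 1) + 2)))))
      (Runs.seq (Runs.const (Q := fun σ' => σ' = σ.setReg (tmp δ) 0) rfl) ?_)
      (by simp only [Expr.cost]; simp only [Finset.sum_add_distrib]; simp; omega) (fun _ h => h)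
    rintro σ₁ hσ₁
    refine Runs.seq (runs_copy (by simp) (Q := fun σ' => σ' = σ₁.setReg _ _) rfl) ?_
    rintro σ₂ hσ₂
    refine Runs.seq (runs_copy (by simp) (Q := fun σ' => σ' = σ₂.setReg _ _) rfl) ?_
    rintro σ₃ hσ₃
    refine Runs.seq (Runs.const (Q := fun σ' => σ' = σ₃.setReg (2 * x) 0) rfl) ?_
    rintro σ₄ hσ₄
    -- Level δ accumulates the partial sum, level δ + 1 keeps the old value of x, and level δ + 2
    -- counts the remaining passes. The bound is copied before x is overwritten, so x = v does no
    -- harm.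
    refine Runs.seq (Runs.count (ρ v) (fun i => b.cost (Env.set ρ x i) + (1 + (1 + (1 + 1))))
      (fun i σ' => σ'.reg (tmp (δ + 2)) = ρ v - i ∧ σ'.mem = σ.mem ∧
        (∀ y, σ'.reg (2 * y) = if y = x then i else σ.reg (2 * y)) ∧ σ'.reg 1 = σ.reg 1 ∧
        σ'.reg (tmp (δ + 1)) = ρ x ∧
        σ'.reg (tmp δ) = ∑ j ∈ Finset.range i, b.eval L (Env.set ρ x j) s ∧
        ∀ ε < δ, σ'.reg (tmp ε) = σ.reg (tmp ε)) (fun i σ' h' => h'.1) ?_ σ₄ ?_) ?_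
    · rintro i hi τ ⟨a1, a2, a3, a4, a5, a6, a7⟩
      refine Runs.seq (ih (δ + 3) (Env.set ρ x i) τ (h.set a2 a3 a4)) ?_
      rintro τ₁ ⟨b1, b2, b3⟩
      refine ⟨_, _, .seq (.add ..) (.seq (.const ..) (.seq (.add ..) (.sub ..))), le_rfl, ?_⟩
      refine ⟨?_, ?_, ?_, ?_, ?_, ?_, ?_⟩
      · simp [b3.2.2 (δ + 2) (by omega), a1]; omega
      · simp [b2, a2]
      · intro y
        have := b3.1 y
        have hx := b3.1 x
        rw [a3] at this hx
        by_cases hy : y = x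
        · subst hy; simp [hx]
        · simp [hy, this]
      · simp [b3.2.1, a4]
      · simp [b3.2.2 (δ + 1) (by omega), a5]
      · simp [b3.2.2 δ (by omega), a6, b1, Finset.sum_range_succ]
      · intro ε hε
        have : ε ≠ δ ∧ ε ≠ δ + 1 ∧ ε ≠ δ + 2 ∧ ε ≠ δ + 3 := by omega
        simp [this, b3.2.2 ε (by omega), a7 ε hε]
    · subst hσ₄ hσ₃ hσ₂ hσ₁
      refine ⟨by simp [h.var], rfl, ?_, by simp, by simp [h.var], by simp, ?_⟩
      · intro y; simp
      · intro ε hε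
        have : ε ≠ δ ∧ ε ≠ δ + 1 ∧ ε ≠ δ + 2 ∧ ε ≠ δ + 3 := by omega
        simp [this]
    · rintro τ ⟨a1, a2, a3, a4, a5, a6, a7⟩
      refine runs_copy (by simp) ⟨by simp [a6, Expr.eval], by simp [a2], ?_, by simp [a4], ?_⟩
      · intro y
        by_cases hy : y = x
        · subst hy; simp [a5, h.var]
        · simp [hy, a3]
      · intro ε hε
        simp [a7 ε hε]
  | mul v b ih =>
    intro δ ρ σ h
    refine Runs.weaken (B := b.cost ρ + (1 + (2 + (1 + (∑ i ∈ Finset.range (ρ v), (2 + 1) + 1)))))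
      (Runs.seq (ih (δ + 1) ρ σ h) ?_)
      (by simp only [Expr.cost]; simp; omega) (fun _ h => h)
    rintro σ₀ ⟨h0, m0, k0⟩
    refine Runs.seq (Runs.const (Q := fun σ' => σ' = σ₀.setReg (tmp δ) 0) rfl) ?_
    rintro σ₁ hσ₁
    refine Runs.seq (runs_copy (by simp) (Q := fun σ' => σ' = σ₁.setReg _ _) rfl) ?_
    rintro σ₂ hσ₂
    refine Runs.seq (Runs.const (Q := fun σ' => σ' = σ₂.setReg (tmp (δ + 3)) 1) rfl) ?_
    rintro σ₃ hσ₃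
    refine (Runs.count (ρ v) (fun i => 2)
      (fun i σ' => σ'.reg (tmp (δ + 2)) = ρ v - i ∧ σ'.mem = σ.mem ∧
        σ'.reg (tmp (δ + 1)) = b.eval L ρ s ∧ σ'.reg (tmp (δ + 3)) = 1 ∧
        σ'.reg (tmp δ) = i * b.eval L ρ s ∧
        Keeps δ σ σ') (fun i σ' h' => h'.1) ?_ σ₃ ?_).weaken le_rfl ?_
    · rintro i hi τ ⟨a1, a2, a3, a4, a5, a6⟩
      refine ⟨_, _, .seq (.add ..) (.sub ..), le_rfl, ?_⟩
      refine ⟨?_, ?_, ?_, ?_, ?_, ?_⟩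
      · simp [a1, a4]; omega
      · simp [a2]
      · simp [a3]
      · simp [a4]
      · simp [a5, a3]; ring
      · exact (a6.setTmp le_rfl).setTmp (by omega)
    · subst hσ₃ hσ₂ hσ₁
      refine ⟨by simp [k0.1, h.var], by simp [m0], by simp [h0], by simp, by simp, ?_⟩
      exact ((k0.mono (by omega) |>.setTmp le_rfl).setTmp (by omega)).setTmp (by omega)
    · rintro τ ⟨a1, a2, a3, a4, a5, a6⟩
      exact ⟨by simp [a5, Expr.eval], a2, a6⟩

/-- Variables bound by `loop` and `letv` are saved at level δ and restored afterwards, which is why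
`Rel` holds again for the same environment. -/
theorem Stmt.compile_spec {L : ℕ} (p : Stmt) : ∀ (δ : ℕ) (ρ : Env) (s : Store) (σ : State),
    Rel L ρ s σ → Runs (p.compile δ) σ (p.cost L ρ s) (fun σ' =>
      Rel L ρ (p.run L ρ s) σ' ∧ ∀ ε < δ, σ'.reg (tmp ε) = σ.reg (tmp ε)) := by
  induction p with
  | skip =>
    intro δ ρ s σ h
    have := (Keeps.refl δ σ).setTmp (a := 0) le_rfl
    exact Runs.const ⟨h.of_keeps this rfl, this.2.2⟩
  | write A i e =>
    intro δ ρ s σ h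
    by_cases hA : A = 0
    · subst hA
      simp only [Stmt.compile, if_true]
      refine Runs.weaken (B := i.cost ρ + (e.cost ρ + (1 + (1 + 1))))
        (Runs.seq (i.compile_spec δ ρ σ h) ?_)
        (by simp only [Stmt.cost]; omega) (fun _ h => h)
      rintro σ₁ ⟨h1, m1, k1⟩
      have hr1 := h.of_keeps k1 m1
      refine Runs.seq (e.compile_spec (δ + 1) ρ σ₁ hr1) ?_
      rintro σ₂ ⟨h2, m2, k2⟩
      have hr2 := hr1.of_keeps k2 m2
      have h12 := k2.2.2 δ (by omega)
      rw [h1] at h12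
      refine Runs.seq (Q := fun σ' => σ' = σ₂.setReg (tmp (δ + 2)) (σ₂.reg 1 - σ₂.reg (tmp δ)))
        (Runs.sub rfl) ?_
      rintro σ₃ hσ₃
      have k3 : Keeps δ σ σ₃ := by
        subst hσ₃; exact (k1.trans (k2.mono (by omega))).setTmp (by omega)
      have m3 : σ₃.mem = σ.mem := by subst hσ₃; simp [m2, m1]
      have hr3 := h.of_keeps k3 m3
      have ht : σ₃.reg (tmp (δ + 2)) = L - i.eval L ρ s := by
        subst hσ₃; simp [hr2.lim, h12]
      refine Runs.weaken (Runs.ifNonzero (B := 1) (B' := 1)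
        (Q := fun σ' => Rel L ρ ((write 0 i e).run L ρ s) σ' ∧
          ∀ ε < δ, σ'.reg (tmp ε) = σ.reg (tmp ε)) ?_ ?_) (by split <;> omega)
        (fun _ h => h)
      · intro hne
        rw [ht] at hne
        have hlt : i.eval L ρ s < L := by omega
        have e1 : σ₃.reg (tmp δ) = i.eval L ρ s := by subst hσ₃; simp [h12]
        have e2 : σ₃.reg (tmp (δ + 1)) = e.eval L ρ s := by subst hσ₃; simp [h2]
        refine Runs.store ⟨⟨hr3.var, hr3.lim, ?_, ?_⟩, k3.2.2⟩
        · intro j hj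
          simp [Stmt.run, hlt.not_ge, Store.put, e1, e2, hr3.low j hj]
        · intro B hB j
          have : ¬ (L + 32 * j + B = i.eval L ρ s) := by omega
          simp [Stmt.run, hlt.not_ge, Store.put, e1, e2, hr3.arr B hB j, this, hB]
      · intro hz
        rw [ht] at hz
        have hge : L ≤ i.eval L ρ s := by omega
        have := k3.setTmp (ε := δ) (a := 0) le_rfl
        refine Runs.const ⟨?_, this.2.2⟩
        simp only [Stmt.run, hge, and_self, if_true]
        exact h.of_keeps this m3
    · simp only [Stmt.compile, if_neg hA]
      refine Runs.weaken (B := e.cost ρ + (i.cost ρ + (8 + 1)))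
        (Runs.seq (e.compile_spec δ ρ σ h) ?_)
        (by simp only [Stmt.cost]; omega) (fun _ h => h)
      rintro σ₁ ⟨h1, m1, k1⟩
      have hr1 := h.of_keeps k1 m1
      refine Runs.seq (i.compile_spec (δ + 1) ρ σ₁ hr1) ?_
      rintro σ₂ ⟨h2, m2, k2⟩
      have hr2 := hr1.of_keeps k2 m2
      refine Runs.seq (runs_addr h2 hr2.lim) ?_
      rintro σ₃ ⟨h3, m3, k3⟩
      have hr3 := hr2.of_keeps k3 m3
      have e1 := k3.2.2 δ (by omega)
      rw [k2.2.2 δ (by omega), h1] at e1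
      refine Runs.store ⟨⟨hr3.var, hr3.lim, ?_, ?_⟩, ?_⟩
      · intro j hj
        have : ¬ j = L + 32 * i.eval L ρ s + A := by omega
        simp [Stmt.run, hA, h3, this, Store.put, hr3.low j hj, Ne.symm hA]
      · intro B hB j
        -- Array numbers are below the stride 32, so different cells have different addresses.
        have : L + 32 * j + (B : ℕ) = L + 32 * i.eval L ρ s + A ↔
            B = A ∧ j = i.eval L ρ s := by
          have := B.2; have := A.2; rw [Fin.ext_iff]; omega
        simp [Stmt.run, hA, h3, this, Store.put, hr3.arr B hB j, e1]
      · intro ε hε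
        rw [setMem_reg, k3.2.2 ε (by omega), k2.2.2 ε (by omega), k1.2.2 ε hε]
  | seq p q ihp ihq =>
    intro δ ρ s σ h
    refine Runs.seq (ihp δ ρ s σ h) ?_
    rintro σ₁ ⟨h1, k1⟩
    refine (ihq δ ρ _ σ₁ h1).weaken le_rfl ?_
    rintro σ₂ ⟨h2, k2⟩
    exact ⟨h2, fun ε hε => (k2 ε hε).trans (k1 ε hε)⟩
  | ite c p q ihp ihq =>
    intro δ ρ s σ h
    refine Runs.weaken (Runs.seq (c.compile_spec δ ρ σ h)
      (B' := (if c.eval L ρ s = 0 then q.cost L ρ s else p.cost L ρ s) + 1) ?_)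
      (by simp only [Stmt.cost]; omega) (fun _ h => h)
    rintro σ₁ ⟨h1, m1, k1⟩
    have hr1 := h.of_keeps k1 m1
    refine Runs.weaken (Runs.ifNonzero
      (Q := fun σ' => Rel L ρ ((ite c p q).run L ρ s) σ' ∧
          ∀ ε < δ, σ'.reg (tmp ε) = σ.reg (tmp ε)) ?_ ?_) (by rw [h1]) (fun _ h => h)
    · intro hne
      rw [h1] at hne
      refine (ihp δ ρ s σ₁ hr1).weaken le_rfl ?_
      rintro σ₂ ⟨h2, k2⟩
      exact ⟨by simpa [Stmt.run, hne] using h2, fun ε hε => (k2 ε hε).trans (k1.2.2 ε hε)⟩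
    · intro hz
      rw [h1] at hz
      refine (ihq δ ρ s σ₁ hr1).weaken le_rfl ?_
      rintro σ₂ ⟨h2, k2⟩
      exact ⟨by simpa [Stmt.run, hz] using h2, fun ε hε => (k2 ε hε).trans (k1.2.2 ε hε)⟩
  | loop x v p ih =>
    intro δ ρ s σ h
    set f : ℕ → Store → Store := fun i s => p.run L (Env.set ρ x i) s with hf
    refine Runs.weaken (B := 2 + (2 + (1 + ((∑ i ∈ Finset.range (ρ v),
        (p.cost L (Env.set ρ x i) (iter f i s) + 3 + 1) + 1) + 2))))
      (Runs.seq (runs_copy (by simp) (Q := fun σ' => σ' = σ.setReg _ _) rfl) ?_)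
      (by simp only [Stmt.cost, ← hf]; simp only [add_assoc, Nat.reduceAdd]; omega) (fun _ h => h)
    rintro σ₂ hσ₂
    refine Runs.seq (runs_copy (by simp) (Q := fun σ' => σ' = σ₂.setReg _ _) rfl) ?_
    rintro σ₃ hσ₃
    refine Runs.seq (Runs.const (Q := fun σ' => σ' = σ₃.setReg (2 * x) 0) rfl) ?_
    rintro σ₄ hσ₄
    refine Runs.seq (Runs.count (ρ v) (fun i => p.cost L (Env.set ρ x i) (iter f i s) + 3)
      (fun i σ' => σ'.reg (tmp (δ + 1)) = ρ v - i ∧ Rel L (Env.set ρ x i) (iter f i s) σ' ∧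
        σ'.reg (tmp δ) = ρ x ∧ ∀ ε < δ, σ'.reg (tmp ε) = σ.reg (tmp ε))
      (fun i σ' h' => h'.1) ?_ σ₄ ?_) ?_
    · rintro i hi τ ⟨a1, a2, a3, a4⟩
      refine Runs.seq (ih (δ + 2) (Env.set ρ x i) _ τ a2) ?_
      rintro τ₁ ⟨b1, b2⟩
      refine ⟨_, _, .seq (.const ..) (.seq (.add ..) (.sub ..)), le_rfl, ?_⟩
      refine ⟨?_, ⟨?_, ?_, ?_, ?_⟩, ?_, ?_⟩
      · simp [b2 (δ + 1) (by omega), a1]; omega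
      · intro y
        have := b1.var y
        have hx := b1.var x
        by_cases hy : y = x
        · subst hy; simpa [Env.set] using hx
        · simpa [hy, Env.set] using this
      · simp [b1.lim]
      · exact b1.low
      · exact b1.arr
      · simp [b2 δ (by omega), a3]
      · intro ε hε
        have : ε ≠ δ ∧ ε ≠ δ + 1 ∧ ε ≠ δ + 2 := by omega
        simp [this, b2 ε (by omega), a4 ε hε]
    · subst hσ₄ hσ₃ hσ₂
      refine ⟨by simp [h.var], ⟨?_, by simp [h.lim], h.low, h.arr⟩, by simp [h.var], ?_⟩
      · intro y; simp [Env.set, h.var]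
      · intro ε hε
        have : ε ≠ δ ∧ ε ≠ δ + 1 := by omega
        simp [this]
    · rintro τ ⟨a1, a2, a3, a4⟩
      refine runs_copy (by simp) ⟨⟨?_, by simp [a2.lim], a2.low, a2.arr⟩, ?_⟩
      · intro y
        have := a2.var y
        by_cases hy : y = x
        · subst hy; simp [a3]
        · simpa [hy, Env.set] using this
      · intro ε hε
        simp [a4 ε hε]
  | letv x e p ih =>
    intro δ ρ s σ h
    refine Runs.weaken (B := 2 + (e.cost ρ + (2 + (p.cost L (Env.set ρ x (e.eval L ρ s)) s + 2))))
      (Runs.seq (runs_copy (by simp) (Q := fun σ' => σ' = σ.setReg _ _) rfl) ?_)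
      (by simp only [Stmt.cost]; omega) (fun _ h => h)
    rintro σ₁ hσ₁
    have k1 : Keeps δ σ σ₁ := by subst hσ₁; exact (Keeps.refl _ _).setTmp le_rfl
    have m1 : σ₁.mem = σ.mem := by subst hσ₁; rfl
    have hr1 := h.of_keeps k1 m1
    refine Runs.seq (e.compile_spec (δ + 1) ρ σ₁ hr1) ?_
    rintro σ₂ ⟨h2, m2, k2⟩
    have hr2 := hr1.of_keeps k2 m2
    refine Runs.seq (runs_copy (by simp) (Q := fun σ' => σ' = σ₂.setReg _ _) rfl) ?_
    rintro σ₃ hσ₃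
    have hr3 : Rel L (Env.set ρ x (e.eval L ρ s)) s σ₃ := by
      subst hσ₃
      exact hr2.set rfl (fun y => by simp [h2]) (by simp)
    refine Runs.seq (ih (δ + 1) _ s σ₃ hr3) ?_
    rintro σ₄ ⟨h4, k4⟩
    have e4 : σ₄.reg (tmp δ) = ρ x := by
      rw [k4 δ (by omega)]; subst hσ₃
      simp [k2.2.2 δ]; subst hσ₁; simp [h.var]
    refine runs_copy (by simp) ⟨⟨?_, by simp [h4.lim], h4.low, h4.arr⟩, ?_⟩
    · intro y
      have := h4.var y
      by_cases hy : y = x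
      · subst hy; simp [e4]
      · simpa [hy, Env.set] using this
    · intro ε hε
      have h4 := k4 ε (by omega)
      have : σ₃.reg (tmp ε) = σ₂.reg (tmp ε) := by subst hσ₃; simp
      simp [h4, this, k2.2.2 ε (by omega), k1.2.2 ε hε]

end LoopLang

namespace LoopLang

/-! ### Static cost bounds -/

/-- The monomial `c * n ^ i * f ^ j * m ^ l`. -/
structure Bd where
  c : ℕ
  i : ℕ
  j : ℕ
  l : ℕ

namespace Bd

def val (n f m : ℕ) (b : Bd) : ℕ := b.c * (n ^ b.i * (f ^ b.j * m ^ b.l))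

def lit (k : ℕ) : Bd := ⟨k, 0, 0, 0⟩

/-- An upper bound for the sum, valid once n, f and m are positive. Taking maxima of the exponents
keeps every bound a single monomial that can be computed from the program text. -/
def add (a b : Bd) : Bd := ⟨a.c + b.c, max a.i b.i, max a.j b.j, max a.l b.l⟩

def mul (a b : Bd) : Bd := ⟨a.c * b.c, a.i + b.i, a.j + b.j, a.l + b.l⟩

variable {n f m : ℕ}

@[simp] theorem val_lit (k : ℕ) : (lit k).val n f m = k := by simp [val, lit]

theorem val_mul (a b : Bd) : (a.mul b).val n f m = a.val n f m * b.val n f m := by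
  simp only [val, mul, pow_add]; ring

theorem le_val_add (hn : 1 ≤ n) (hf : 1 ≤ f) (hm : 1 ≤ m) (a b : Bd) :
    a.val n f m + b.val n f m ≤ (a.add b).val n f m := by
  simp only [val, add, add_mul]
  gcongr <;> simp

end Bd

/-- Weights of the variables. -/
abbrev Wt := ℕ → Bd

def Wt.set (w : Wt) (x : ℕ) (b : Bd) : Wt := fun y => if y = x then b else w y

/-- A loop variable inherits the weight of its bound, since its values stay below that bound. -/
def Expr.bd : Expr → Wt → Bd
  | var _, _ => .lit 2
  | lit _, _ => .lit 1
  | add a b, w => ((a.bd w).add (b.bd w)).add (.lit 1)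
  | sub a b, w => ((a.bd w).add (b.bd w)).add (.lit 1)
  | read _ i, w => (i.bd w).add (.lit 9)
  | ite c a b, w => (((c.bd w).add (a.bd w)).add (b.bd w)).add (.lit 1)
  | sum x v b, w => .add (.lit 9) ((w v).mul ((b.bd (Wt.set w x (w v))).add (.lit 5)))
  | mul v b, w => ((b.bd w).add (.lit 5)).add ((w v).mul (.lit 3))

def Stmt.bd : Stmt → Wt → Bd
  | write _ i e, w => ((i.bd w).add (e.bd w)).add (.lit 10)
  | seq p q, w => (p.bd w).add (q.bd w)
  | ite c p q, w => ((c.bd w).add (.lit 1)).add ((p.bd w).add (q.bd w))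
  | loop x v p, w => .add (.lit 8) ((w v).mul ((p.bd (Wt.set w x (w v))).add (.lit 4)))
  | letv _ e p, w => ((e.bd w).add (.lit 6)).add (p.bd w)
  | skip, _ => .lit 1

/-- Only `letv` binds values that depend on the store. A statement without it creates no obligation
in `Stmt.Bounded`. -/
def Stmt.letFree : Stmt → Bool
  | write _ _ _ => true
  | seq p q => p.letFree && q.letFree
  | ite _ p q => p.letFree && q.letFree
  | loop _ _ p => p.letFree
  | letv _ _ _ => false
  | skip => true

variable {n f m : ℕ} (hn : 1 ≤ n) (hf : 1 ≤ f) (hm : 1 ≤ m)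

def Wt.Bounds (w : Wt) (n f m : ℕ) (ρ : Env) : Prop := ∀ x, ρ x ≤ (w x).val n f m

theorem Wt.Bounds.set {w : Wt} {ρ : Env} (h : w.Bounds n f m ρ) {x i : ℕ} {b : Bd}
    (hi : i ≤ b.val n f m) : (w.set x b).Bounds n f m (Env.set ρ x i) := by
  intro y
  simp only [Wt.set, Env.set]
  split
  · exact hi
  · exact h y

include hn hf hm in
theorem Expr.cost_le (e : Expr) : ∀ (w : Wt) (ρ : Env), w.Bounds n f m ρ →
    e.cost ρ ≤ (e.bd w).val n f m := by
  have hadd := fun a b => Bd.le_val_add hn hf hm a b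
  induction e with
  | var | lit => intros; simp [Expr.cost, Expr.bd]
  | add a b iha ihb =>
    intro w ρ h
    have := iha w ρ h; have := ihb w ρ h
    have := hadd (a.bd w) (b.bd w)
    refine le_trans ?_ (hadd _ _)
    simp only [Expr.cost, Bd.val_lit]; omega
  | sub a b iha ihb =>
    intro w ρ h
    have := iha w ρ h; have := ihb w ρ h
    have := hadd (a.bd w) (b.bd w)
    refine le_trans ?_ (hadd _ _)
    simp only [Expr.cost, Bd.val_lit]; omega
  | read A i ih =>
    intro w ρ h
    have := ih w ρ h
    refine le_trans ?_ (hadd _ _)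
    simp only [Expr.cost, Bd.val_lit]; omega
  | ite c a b ihc iha ihb =>
    intro w ρ h
    have := ihc w ρ h; have := iha w ρ h; have := ihb w ρ h
    have := hadd (c.bd w) (a.bd w)
    have := hadd ((c.bd w).add (a.bd w)) (b.bd w)
    refine le_trans ?_ (hadd _ _)
    simp only [Expr.cost, Bd.val_lit]; omega
  | sum x v b ih =>
    intro w ρ h
    refine le_trans ?_ (hadd _ _)
    rw [Expr.cost, Bd.val_lit, Bd.val_mul]
    gcongr
    refine (Finset.sum_le_card_nsmul _ _ ((b.bd (w.set x (w v))).val n f m + 5) ?_).trans ?_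
    · intro i hi
      have := ih (w.set x (w v)) (Env.set ρ x i)
        (h.set ((Finset.mem_range.1 hi).le.trans (h v)))
      omega
    · rw [Finset.card_range, smul_eq_mul]
      have h5 := hadd (b.bd (w.set x (w v))) (.lit 5)
      rw [Bd.val_lit] at h5
      exact Nat.mul_le_mul (h v) h5
  | mul v b ih =>
    intro w ρ h
    refine le_trans ?_ (hadd _ _)
    have := hadd (b.bd w) (.lit 5)
    have := ih w ρ h
    have := h v
    simp only [Expr.cost, Bd.val_mul, Bd.val_lit] at *
    omega

/-- The values bound in a run respect the weights of their variables. -/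
def Stmt.Bounded (L n f m : ℕ) : Stmt → Wt → Env → Store → Prop
  | write _ _ _, _, _, _ => True
  | seq p q, w, ρ, s => p.Bounded L n f m w ρ s ∧ q.Bounded L n f m w ρ (p.run L ρ s)
  | ite c p q, w, ρ, s =>
    if c.eval L ρ s = 0 then q.Bounded L n f m w ρ s else p.Bounded L n f m w ρ s
  | loop x v p, w, ρ, s => ∀ i < ρ v, p.Bounded L n f m (Wt.set w x (w v)) (Env.set ρ x i)
      (iter (fun i s => p.run L (Env.set ρ x i) s) i s)
  | letv x e p, w, ρ, s => e.eval L ρ s ≤ (w x).val n f m ∧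
      p.Bounded L n f m w (Env.set ρ x (e.eval L ρ s)) s
  | skip, _, _, _ => True

theorem Stmt.bounded_of_letFree {L : ℕ} (p : Stmt) : ∀ (w : Wt) (ρ : Env) (s : Store),
    p.letFree = true → p.Bounded L n f m w ρ s := by
  induction p with
  | skip | write => intros; trivial
  | seq p q ihp ihq =>
    intro w ρ s hl
    simp only [Stmt.letFree, Bool.and_eq_true] at hl
    exact ⟨ihp _ _ _ hl.1, ihq _ _ _ hl.2⟩
  | ite c p q ihp ihq =>
    intro w ρ s hl
    simp only [Stmt.letFree, Bool.and_eq_true] at hl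
    simp only [Stmt.Bounded]
    split
    · exact ihq _ _ _ hl.2
    · exact ihp _ _ _ hl.1
  | loop x v p ih => intro w ρ s hl i _; exact ih _ _ _ hl
  | letv x e p ih => intro w ρ s hl; simp [Stmt.letFree] at hl

include hn hf hm in
theorem Stmt.cost_le {L : ℕ} (p : Stmt) : ∀ (w : Wt) (ρ : Env) (s : Store),
    p.Bounded L n f m w ρ s → w.Bounds n f m ρ → p.cost L ρ s ≤ (p.bd w).val n f m := by
  have hadd := fun a b => Bd.le_val_add hn hf hm a b
  have hexp := fun (e : Expr) w ρ h => e.cost_le hn hf hm w ρ h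
  induction p with
  | skip => intros; simp [Stmt.cost, Stmt.bd]
  | write A i e =>
    intro w ρ s _ h
    have := hexp i w ρ h; have := hexp e w ρ h
    have := hadd (i.bd w) (e.bd w)
    refine le_trans ?_ (hadd _ _)
    simp only [Stmt.cost, Bd.val_lit]; omega
  | seq p q ihp ihq =>
    intro w ρ s hl h
    exact (add_le_add (ihp w ρ s hl.1 h) (ihq w ρ _ hl.2 h)).trans (hadd _ _)
  | ite c p q ihp ihq =>
    intro w ρ s hl h
    have := hexp c w ρ h
    have := hadd (c.bd w) (.lit 1)
    have := hadd (p.bd w) (q.bd w)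
    refine le_trans ?_ (hadd _ _)
    simp only [Stmt.cost, Stmt.Bounded, Bd.val_lit] at *
    split at hl
    case isTrue hc =>
      have := ihq w ρ s hl h
      simp only [hc, if_true]; omega
    case isFalse hc =>
      have := ihp w ρ s hl h
      simp only [hc, if_false]; omega
  | loop x v p ih =>
    intro w ρ s hl h
    refine le_trans ?_ (hadd _ _)
    rw [Stmt.cost, Bd.val_lit, Bd.val_mul]
    gcongr
    refine (Finset.sum_le_card_nsmul _ _ ((p.bd (w.set x (w v))).val n f m + 4) ?_).trans ?_
    · intro i hi
      have := ih (w.set x (w v)) (Env.set ρ x i)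
        (iter (fun i s => p.run L (Env.set ρ x i) s) i s) (hl i (Finset.mem_range.1 hi))
        (h.set ((Finset.mem_range.1 hi).le.trans (h v)))
      omega
    · rw [Finset.card_range, smul_eq_mul]
      have h5 := hadd (p.bd (w.set x (w v))) (.lit 4)
      rw [Bd.val_lit] at h5
      exact Nat.mul_le_mul (h v) h5
  | letv x e p ih =>
    intro w ρ s hl h
    -- The weight of a let-bound variable is fixed in advance, so binding it changes the environment
    -- but not the weights.
    have hw : Wt.set w x (w x) = w := by
      funext y
      simp only [Wt.set]
      split
      · next hy => rw [hy]
      · rfl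
    have h1 := h.set (x := x) hl.1
    rw [hw] at h1
    have := ih w _ s hl.2 h1
    have := hexp e w ρ h
    have := hadd (e.bd w) (.lit 6)
    refine le_trans ?_ (hadd _ _)
    simp only [Stmt.cost, Bd.val_lit] at *
    omega

/-! ### Running a loop program on the input -/

open RAM

/-- Puts the length `2 + 2 * n ^ 2` of the input into register `1`. -/
def prologue : Prog :=
  .seq (.const 3 0) <| .seq (.load 3 3) <| .seq (.const 1 2) <| .seq (.const 5 0) <|
  .seq (.add 5 5 3) <| .seq (.const 7 1) <|
  .whileNonzero 5 (.seq (.add 1 1 3) <| .seq (.add 1 1 3) (.sub 5 5 7))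

noncomputable def inputStore {n : ℕ} (G H : SimpleGraph (Fin n)) (d : ℕ) : Store :=
  fun A i => if A = 0 then inputMemory G H d i else 0

/-- In place of a multiplication, n passes each add n twice; with the test of the counter a pass
takes four steps. -/
theorem prologue_spec {n : ℕ} (G H : SimpleGraph (Fin n)) (d : ℕ) :
    Runs prologue (initialState G H d) (7 + 4 * n)
      (Rel (2 + 2 * (n * n)) (fun _ => 0) (inputStore G H d)) := by
  have h0 : inputMemory G H d 0 = n := by simp [inputMemory]
  refine Runs.weaken (B := 1 + (1 + (1 + (1 + (1 + (1 +
    (∑ i ∈ Finset.range n, (3 + 1) + 1)))))))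
    (Runs.seq (Runs.const (Q := fun σ => σ = (initialState G H d).setReg 3 0) rfl) ?_)
    (by simp; omega) (fun _ h => h)
  rintro σ₁ h₁
  refine Runs.seq (Runs.load (Q := fun σ => σ = σ₁.setReg 3 _) rfl) ?_
  rintro σ₂ h₂
  refine Runs.seq (Runs.const (Q := fun σ => σ = σ₂.setReg 1 2) rfl) ?_
  rintro σ₃ h₃
  refine Runs.seq (Runs.const (Q := fun σ => σ = σ₃.setReg 5 0) rfl) ?_
  rintro σ₄ h₄
  refine Runs.seq (Runs.add (Q := fun σ => σ = σ₄.setReg 5 _) rfl) ?_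
  rintro σ₅ h₅
  refine Runs.seq (Runs.const (Q := fun σ => σ = σ₅.setReg 7 1) rfl) ?_
  rintro σ₆ h₆
  refine (Runs.count n (fun _ => 3) (fun i σ => σ.reg 5 = n - i ∧ σ.reg 3 = n ∧ σ.reg 7 = 1 ∧
    σ.reg 1 = 2 + 2 * (i * n) ∧ (∀ x, σ.reg (2 * x) = 0) ∧ σ.mem = inputMemory G H d)
    (fun _ _ h => h.1) ?_ σ₆ ?_).weaken le_rfl ?_
  · rintro i hi σ ⟨a1, a2, a3, a4, a5, a6⟩
    refine ⟨_, _, .seq (.add ..) (.seq (.add ..) (.sub ..)), le_rfl, ?_⟩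
    refine ⟨by simp [a1, a3]; omega, by simp [a2], by simp [a3], ?_, ?_,
      by simp [a6]⟩
    · have e : 2 + 2 * (i * n) + n + n = 2 + 2 * ((i + 1) * n) := by ring
      simpa [a4, a2] using e
    intro x
    have : ¬ 2 * x = 5 := by omega
    simp [a5, this]
  · subst h₆ h₅ h₄ h₃ h₂ h₁
    simp [initialState, h0]
    intro x
    have : ¬ 2 * x = 5 ∧ ¬ 2 * x = 7 ∧ ¬ 2 * x = 3 := by omega
    simp [this]
  · rintro σ ⟨a1, a2, a3, a4, a5, a6⟩
    refine ⟨a5, a4, fun i _ => by rw [a6, inputStore, if_pos rfl], fun A hA i => ?_⟩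
    simp only [a6, inputStore, hA, if_false]
    have h1 : 0 < (A : ℕ) := Nat.pos_of_ne_zero fun h => hA (Fin.ext h)
    -- Every cell of a work array lies beyond the input, where the memory is zero. Hence all work
    -- arrays start out as zero.
    unfold inputMemory
    have h2 : n * n ≤ 2 * (n * n) := by omega
    rw [if_neg (by omega), if_neg (by omega), if_neg (by omega), if_neg (by omega)]

theorem runs_program {n : ℕ} (G H : SimpleGraph (Fin n)) (d : ℕ) (p : Stmt) :
    Runs (.seq prologue (p.compile 0)) (initialState G H d)
      (7 + 4 * n + p.cost (2 + 2 * (n * n)) (fun _ => 0) (inputStore G H d))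
      (fun σ => ∀ i < 2 + 2 * (n * n),
        σ.mem i = p.run (2 + 2 * (n * n)) (fun _ => 0) (inputStore G H d) 0 i) := by
  refine Runs.seq (prologue_spec G H d) fun σ h => ?_
  exact (p.compile_spec 0 _ _ σ h).weaken le_rfl fun σ' h' => h'.1.low

end LoopLang

namespace LoopLang

/-! ### Reasoning about loop programs -/

@[simp] theorem Env.set_apply (ρ : Env) (x a y : ℕ) :
    Env.set ρ x a y = if y = x then a else ρ y := rfl

@[simp] theorem Store.put_apply (s : Store) (A : Fin 32) (i a : ℕ) (B : Fin 32) (j : ℕ) :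
    s.put A i a B j = if B = A ∧ j = i then a else s B j := rfl

theorem Store.put_of_ne (s : Store) {A B : Fin 32} (i a : ℕ) (h : B ≠ A) : s.put A i a B = s B := by
  funext j; simp [h]

namespace Expr

/-- Nonzero values count as true. -/
def Holds (L : ℕ) (e : Expr) (ρ : Env) (s : Store) : Prop := e.eval L ρ s ≠ 0

protected def not (a : Expr) : Expr := ite a (lit 0) (lit 1)
protected def and (a b : Expr) : Expr := ite a b (lit 0)
protected def or (a b : Expr) : Expr := add a b
protected def le (a b : Expr) : Expr := (sub a b).not
protected def lt (a b : Expr) : Expr := sub b a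
protected def eq (a b : Expr) : Expr := (add (sub a b) (sub b a)).not
protected def ex (x v : ℕ) (a : Expr) : Expr := sum x v a
protected def all (x v : ℕ) (a : Expr) : Expr := (sum x v a.not).not
protected def bit (a : Expr) : Expr := ite a (lit 1) (lit 0)

variable {L : ℕ} {ρ : Env} {s : Store}

@[simp] theorem eval_var (x : ℕ) : (var x).eval L ρ s = ρ x := rfl
@[simp] theorem eval_lit (k : ℕ) : (lit k).eval L ρ s = k := rfl
@[simp] theorem eval_add (a b : Expr) :
    (add a b).eval L ρ s = a.eval L ρ s + b.eval L ρ s := rfl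
@[simp] theorem eval_sub (a b : Expr) :
    (sub a b).eval L ρ s = a.eval L ρ s - b.eval L ρ s := rfl
@[simp] theorem eval_mul (v : ℕ) (b : Expr) : (mul v b).eval L ρ s = ρ v * b.eval L ρ s := rfl
@[simp] theorem eval_sum (x v : ℕ) (b : Expr) :
    (sum x v b).eval L ρ s = ∑ i ∈ Finset.range (ρ v), b.eval L (Env.set ρ x i) s := rfl
@[simp] theorem eval_read {A : Fin 32} (i : Expr) :
    (read A i).eval L ρ s = if A = 0 ∧ L ≤ i.eval L ρ s then 0 else s A (i.eval L ρ s) := rfl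
open Classical in
@[simp] theorem eval_ite (c a b : Expr) : (ite c a b).eval L ρ s =
    if c.Holds L ρ s then a.eval L ρ s else b.eval L ρ s := by
  simp only [eval, Holds]; split <;> simp_all

@[simp] theorem holds_not (a : Expr) : a.not.Holds L ρ s ↔ ¬ a.Holds L ρ s := by
  unfold Expr.not; rw [Holds, eval_ite]; split <;> simp_all
@[simp] theorem holds_and (a b : Expr) :
    (a.and b).Holds L ρ s ↔ a.Holds L ρ s ∧ b.Holds L ρ s := by
  unfold Expr.and; rw [Holds, eval_ite]; split <;> simp_all [Holds]
@[simp] theorem holds_or (a b : Expr) :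
    (a.or b).Holds L ρ s ↔ a.Holds L ρ s ∨ b.Holds L ρ s := by
  unfold Expr.or; simp only [Holds, eval_add]; omega
@[simp] theorem holds_le (a b : Expr) :
    (a.le b).Holds L ρ s ↔ a.eval L ρ s ≤ b.eval L ρ s := by
  unfold Expr.le; rw [holds_not]; simp only [Holds, eval_sub]; omega
@[simp] theorem holds_lt (a b : Expr) :
    (a.lt b).Holds L ρ s ↔ a.eval L ρ s < b.eval L ρ s := by
  unfold Expr.lt; simp only [Holds, eval_sub]; omega
@[simp] theorem holds_eq (a b : Expr) :
    (a.eq b).Holds L ρ s ↔ a.eval L ρ s = b.eval L ρ s := by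
  unfold Expr.eq; rw [holds_not]; simp only [Holds, eval_sub, eval_add]; omega
@[simp] theorem holds_ex (x v : ℕ) (a : Expr) :
    (Expr.ex x v a).Holds L ρ s ↔ ∃ i < ρ v, a.Holds L (Env.set ρ x i) s := by
  unfold Expr.ex; simp [Holds]
@[simp] theorem holds_all (x v : ℕ) (a : Expr) :
    (Expr.all x v a).Holds L ρ s ↔ ∀ i < ρ v, a.Holds L (Env.set ρ x i) s := by
  unfold Expr.all; rw [holds_not]
  have := holds_ex (L := L) (ρ := ρ) (s := s) x v a.not
  unfold Expr.ex at this
  rw [this]; simp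
open Classical in
@[simp] theorem eval_bit (a : Expr) :
    a.bit.eval L ρ s = if a.Holds L ρ s then 1 else 0 := by
  unfold Expr.bit; simp
theorem holds_read {A : Fin 32} (i : Expr) (hA : A ≠ 0) :
    (read A i).Holds L ρ s ↔ s A (i.eval L ρ s) ≠ 0 := by simp [Holds, hA]

end Expr

namespace Stmt

/-- Whether a statement writes to an array. -/
def writes (A : Fin 32) : Stmt → Bool
  | write B _ _ => B == A
  | seq p q => p.writes A || q.writes A
  | ite _ p q => p.writes A || q.writes A
  | loop _ _ p => p.writes A
  | letv _ _ p => p.writes A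
  | skip => false

end Stmt

theorem iter_induction {σ : Type*} {f : ℕ → σ → σ} {n : ℕ} {s : σ} (P : ℕ → σ → Prop)
    (h0 : P 0 s) (hs : ∀ i < n, ∀ s, P i s → P (i + 1) (f i s)) : P n (iter f n s) := by
  induction n with
  | zero => exact h0
  | succ n ih => exact hs n (by omega) _ (ih fun i hi => hs i (by omega))

namespace Stmt

variable {L : ℕ}

/-- A frame rule with a Boolean premise. For concrete programs and array numbers it is settled by
evaluation. -/
theorem run_of_not_writes {A : Fin 32} (p : Stmt) : ∀ (ρ : Env) (s : Store),
    p.writes A = false → p.run L ρ s A = s A := by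
  induction p with
  | skip => intros; rfl
  | write B i e =>
    intro ρ s h
    simp only [writes, beq_eq_false_iff_ne] at h
    simp only [run]
    split
    · rfl
    · exact Store.put_of_ne _ _ _ (Ne.symm h)
  | seq p q ihp ihq =>
    intro ρ s h
    simp only [writes, Bool.or_eq_false_iff] at h
    simp only [run, ihq _ _ h.2, ihp _ _ h.1]
  | ite c p q ihp ihq =>
    intro ρ s h
    simp only [writes, Bool.or_eq_false_iff] at h
    simp only [run]
    split
    · exact ihq _ _ h.2
    · exact ihp _ _ h.1
  | loop x v p ih =>
    intro ρ s h
    exact iter_induction (fun _ (s' : Store) => s' A = s A) rfl fun i _ s' h' => (ih _ _ h).trans h'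
  | letv x e p ih => intro ρ s h; exact ih _ _ h

@[simp] theorem run_seq (p q : Stmt) (ρ : Env) (s : Store) :
    (seq p q).run L ρ s = q.run L ρ (p.run L ρ s) := rfl

@[simp] theorem run_skip (ρ : Env) (s : Store) : skip.run L ρ s = s := rfl

@[simp] theorem run_letv (x : ℕ) (e : Expr) (p : Stmt) (ρ : Env) (s : Store) :
    (letv x e p).run L ρ s = p.run L (Env.set ρ x (e.eval L ρ s)) s := rfl

open Classical in
@[simp] theorem run_ite (c : Expr) (p q : Stmt) (ρ : Env) (s : Store) :
    (ite c p q).run L ρ s = if c.Holds L ρ s then p.run L ρ s else q.run L ρ s := by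
  simp only [run, Expr.Holds]; split <;> simp_all

theorem run_loop (x v : ℕ) (p : Stmt) (ρ : Env) (s : Store) :
    (loop x v p).run L ρ s = iter (fun i s => p.run L (Env.set ρ x i) s) (ρ v) s := rfl

theorem run_write {A : Fin 32} (hA : A ≠ 0) (i e : Expr) (ρ : Env) (s : Store) :
    (write A i e).run L ρ s = s.put A (i.eval L ρ s) (e.eval L ρ s) := by
  simp [run, hA]

/-- Started in a store that agrees with `s₀` outside array `A` and on the cells in `D`, the
statement sets the cells in `C` of array `A` to the values `V` and changes nothing else. -/
def Fills (L : ℕ) (p : Stmt) (ρ : Env) (A : Fin 32) (s₀ : Store) (D C : Set ℕ) (V : ℕ → ℕ) :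
    Prop :=
  ∀ s : Store, (∀ B ≠ A, s B = s₀ B) → (∀ k ∈ D, s A k = s₀ A k) →
    (∀ B ≠ A, p.run L ρ s B = s B) ∧ (∀ k ∈ C, p.run L ρ s A k = V k) ∧
      ∀ k ∉ C, p.run L ρ s A k = s A k

theorem Fills.write {ρ : Env} {A : Fin 32} (hA : A ≠ 0) {s₀ : Store} {D : Set ℕ} {V : ℕ → ℕ}
    {ie e : Expr} {i : ℕ}
    (h : ∀ s : Store, (∀ B ≠ A, s B = s₀ B) → (∀ k ∈ D, s A k = s₀ A k) →
      ie.eval L ρ s = i ∧ e.eval L ρ s = V i) :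
    Fills L (write A ie e) ρ A s₀ D {i} V := by
  intro s h1 h2
  obtain ⟨h3, h4⟩ := h s h1 h2
  rw [run_write hA, h3, h4]
  refine ⟨fun B hB => Store.put_of_ne _ _ _ hB, ?_, ?_⟩
  · rintro k rfl; simp
  · intro k hk; simp at hk; simp [hk]

/-- The body may read the cells in D of the very array that is being filled, and disjointness
protects them. Passes may overlap, since all of them write values of the same V. -/
theorem Fills.loop {ρ : Env} {A : Fin 32} {s₀ : Store} {D : Set ℕ} {V : ℕ → ℕ} {x v : ℕ}
    {p : Stmt} {C : ℕ → Set ℕ} (hD : ∀ i < ρ v, Disjoint D (C i))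
    (h : ∀ i < ρ v, Fills L p (Env.set ρ x i) A s₀ D (C i) V) :
    Fills L (loop x v p) ρ A s₀ D {k | ∃ i < ρ v, k ∈ C i} V := by
  intro s h1 h2
  rw [run_loop]
  have := iter_induction (f := fun i s => p.run L (Env.set ρ x i) s) (n := ρ v) (s := s)
    (fun i (s' : Store) => (∀ B ≠ A, s' B = s B) ∧ (∀ k, (∃ j < i, k ∈ C j) → s' A k = V k) ∧
      ∀ k, (¬ ∃ j < i, k ∈ C j) → s' A k = s A k) ⟨fun _ _ => rfl, by simp, fun _ _ => rfl⟩ ?_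
  · exact this
  · rintro i hi s' ⟨a1, a2, a3⟩
    obtain ⟨b1, b2, b3⟩ := h i hi s' (fun B hB => (a1 B hB).trans (h1 B hB)) (fun k hk => by
      rw [a3 k, h2 k hk]
      rintro ⟨j, hj, hk'⟩
      exact Set.disjoint_left.1 (hD j (by omega)) hk hk')
    refine ⟨fun B hB => (b1 B hB).trans (a1 B hB), ?_, ?_⟩
    · rintro k ⟨j, hj, hk⟩
      by_cases hki : k ∈ C i
      · exact b2 k hki
      · rw [b3 k hki]
        refine a2 k ⟨j, ?_, hk⟩
        rcases Nat.lt_succ_iff_lt_or_eq.1 hj with h | rfl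
        · exact h
        · exact absurd hk hki
    · intro k hk
      rw [b3 k fun h => hk ⟨i, by omega, h⟩, a3 k]
      rintro ⟨j, hj, hk'⟩
      exact hk ⟨j, by omega, hk'⟩

/-- A doubly indexed table fill. -/
theorem run_fill₂ {ρ : Env} {A : Fin 32} (hA : A ≠ 0) {s : Store} {D : Set ℕ} {V : ℕ → ℕ}
    {x v y w : ℕ} {ie e : Expr} (I : ℕ → ℕ → ℕ) (hwx : w ≠ x)
    (hD : ∀ i < ρ v, ∀ j < ρ w, I i j ∉ D)
    (h : ∀ s' : Store, (∀ B ≠ A, s' B = s B) → (∀ k ∈ D, s' A k = s A k) →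
      ∀ i < ρ v, ∀ j < ρ w, ie.eval L (Env.set (Env.set ρ x i) y j) s' = I i j ∧
        e.eval L (Env.set (Env.set ρ x i) y j) s' = V (I i j)) :
    (∀ i < ρ v, ∀ j < ρ w,
      (Stmt.loop x v (Stmt.loop y w (.write A ie e))).run L ρ s A (I i j) = V (I i j)) ∧
    ∀ k, (∀ i < ρ v, ∀ j < ρ w, k ≠ I i j) →
      (Stmt.loop x v (Stmt.loop y w (.write A ie e))).run L ρ s A k = s A k := by
  have hw : ∀ i, Env.set ρ x i w = ρ w := fun i => by simp [hwx]
  have h1 : ∀ i < ρ v, Fills L (Stmt.loop y w (.write A ie e)) (Env.set ρ x i) A s D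
      {k | ∃ j < ρ w, k ∈ ({I i j} : Set ℕ)} V := by
    intro i hi
    have := Fills.loop (L := L) (ρ := Env.set ρ x i) (A := A) (s₀ := s) (D := D) (V := V) (x := y)
      (v := w) (p := .write A ie e) (C := fun j => {I i j})
      (fun j hj => by
        rw [hw] at hj
        exact Set.disjoint_singleton_right.2 (hD i hi j hj))
      (fun j hj => Fills.write hA fun s' h1 h2 => h s' h1 h2 i hi j (by rwa [hw] at hj))
    simpa only [hw] using this
  have h2 := Fills.loop (x := x) (v := v) (fun i hi => Set.disjoint_left.2 fun k hk hk' => by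
    obtain ⟨j, hj, rfl⟩ := hk'
    exact hD i hi j hj hk) h1 s (fun _ _ => rfl) (fun _ _ => rfl)
  refine ⟨fun i hi j hj => h2.2.1 _ ⟨i, hi, j, hj, rfl⟩, fun k hk => h2.2.2 k ?_⟩
  rintro ⟨i, hi, j, hj, hkk⟩
  exact hk i hi j hj hkk

/-- A singly indexed table fill. -/
theorem run_fill {ρ : Env} {A : Fin 32} (hA : A ≠ 0) {s : Store} {D : Set ℕ} {V : ℕ → ℕ}
    {x v : ℕ} {ie e : Expr} (I : ℕ → ℕ) (hD : ∀ i < ρ v, I i ∉ D)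
    (h : ∀ s' : Store, (∀ B ≠ A, s' B = s B) → (∀ k ∈ D, s' A k = s A k) →
      ∀ i < ρ v, ie.eval L (Env.set ρ x i) s' = I i ∧ e.eval L (Env.set ρ x i) s' = V (I i)) :
    (∀ i < ρ v, (Stmt.loop x v (.write A ie e)).run L ρ s A (I i) = V (I i)) ∧
    ∀ k, (∀ i < ρ v, k ≠ I i) → (Stmt.loop x v (.write A ie e)).run L ρ s A k = s A k := by
  have h2 := Fills.loop (L := L) (ρ := ρ) (A := A) (s₀ := s) (D := D) (V := V) (x := x) (v := v)
    (p := .write A ie e) (C := fun j => {I j})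
    (fun i hi => Set.disjoint_singleton_right.2 (hD i hi))
    (fun i hi => Fills.write hA fun s' h1 h2 => h s' h1 h2 i hi) s (fun _ _ => rfl) (fun _ _ => rfl)
  refine ⟨fun i hi => h2.2.1 _ ⟨i, hi, rfl⟩, fun k hk => h2.2.2 k ?_⟩
  rintro ⟨i, hi, hkk⟩
  exact hk i hi hkk

end Stmt

theorem mul_add_div_of_lt {n y : ℕ} (x : ℕ) (h : y < n) : (x * n + y) / n = x := by
  rw [Nat.add_comm, Nat.add_mul_div_right _ _ (by omega), Nat.div_eq_of_lt h, zero_add]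

theorem mul_add_mod_of_lt {n y : ℕ} (x : ℕ) (h : y < n) : (x * n + y) % n = y := by
  rw [Nat.add_comm, Nat.add_mul_mod_self_right, Nat.mod_eq_of_lt h]

theorem mul_add_inj {n x y x' y' : ℕ} (h : y < n) (h' : y' < n) :
    x * n + y = x' * n + y' ↔ x = x' ∧ y = y' := by
  refine ⟨fun e => ⟨?_, ?_⟩, fun ⟨a, b⟩ => by rw [a, b]⟩
  · rw [← mul_add_div_of_lt x h, e, mul_add_div_of_lt x' h']
  · rw [← mul_add_mod_of_lt x h, e, mul_add_mod_of_lt x' h']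

theorem mul_add_lt {m n x y : ℕ} (hx : x < m) (hy : y < n) : x * n + y < m * n := by
  calc x * n + y < x * n + n := by omega
    _ = (x + 1) * n := by ring
    _ ≤ m * n := Nat.mul_le_mul_right _ hx

end LoopLang

/-! ### Layered elimination orders and treewidth -/

namespace SimpleGraph

variable {V : Type*} (H : SimpleGraph V)

/-- The edges of `H` inside `U`. -/
def within (U : Set V) : SimpleGraph V where
  Adj a b := H.Adj a b ∧ a ∈ U ∧ b ∈ U
  symm := ⟨fun _ _ h => ⟨h.1.symm, h.2.2, h.2.1⟩⟩
  loopless := ⟨fun _ h => H.irrefl h.1⟩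

/-- The component of `x` in the subgraph induced on `U`. -/
def compIn (U : Set V) (x : V) : Set V := {y | (H.within U).Reachable x y}

/-- The neighbours of a set. -/
def border (C : Set V) : Set V := {w | w ∉ C ∧ ∃ y ∈ C, H.Adj y w}

variable {H} {U W C : Set V} {x y z : V}

theorem self_mem_compIn : x ∈ H.compIn U x := Reachable.refl _

theorem compIn_subset_of_closed (hx : x ∈ C)
    (h : ∀ y ∈ C, ∀ z ∈ U, y ∈ U → H.Adj y z → z ∈ C) : H.compIn U x ⊆ C := by
  intro y hy
  have := (reachable_iff_reflTransGen x y).1 hy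
  induction this with
  | refl => exact hx
  | tail hab hbc ih =>
    exact h _ (ih ((reachable_iff_reflTransGen _ _).2 hab)) _ hbc.2.2 hbc.2.1 hbc.1

theorem compIn_subset (hx : x ∈ U) : H.compIn U x ⊆ U :=
  compIn_subset_of_closed hx fun _ _ _ hz _ _ => hz

theorem compIn_eq_of_mem (h : y ∈ H.compIn U x) : H.compIn U y = H.compIn U x := by
  ext z
  exact ⟨fun hz => Reachable.trans h hz, fun hz => Reachable.trans (Reachable.symm h) hz⟩

theorem compIn_mono (h : W ⊆ U) : H.compIn W x ⊆ H.compIn U x := fun _ hy =>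
  Reachable.mono (show H.within W ≤ H.within U from
    fun _ _ hab => ⟨hab.1, h hab.2.1, h hab.2.2⟩) hy

theorem mem_compIn_of_adj (hy : y ∈ H.compIn U x) (hyU : y ∈ U) (hz : z ∈ U) (h : H.Adj y z) :
    z ∈ H.compIn U x :=
  Reachable.trans hy (Adj.reachable ⟨h, hyU, hz⟩)

/-- All edges that connect the component in U have both ends in W, so it remains connected there. -/
theorem compIn_eq_of_subset (hWU : W ⊆ U) (h : H.compIn U x ⊆ W) :
    H.compIn W x = H.compIn U x := by
  refine (compIn_mono hWU).antisymm (compIn_subset_of_closed self_mem_compIn ?_)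
  intro y hy z hz _ hyz
  have hy' := compIn_mono hWU hy
  exact mem_compIn_of_adj hy (h hy')
    (h (mem_compIn_of_adj hy' (hWU (h hy')) hz hyz)) hyz

/-- Deleting the neighbours of C cuts it off, and C is connected in itself. A component is therefore
recovered from its border and one of its points, so the search may enumerate small borders instead
of components. -/
theorem compIn_compl_border (hC : C = H.compIn U x) (hx : x ∈ U) :
    H.compIn (H.border C)ᶜ x = C := by
  refine subset_antisymm (compIn_subset_of_closed (hC ▸ self_mem_compIn) ?_) ?_
  · intro y hy z hz _ hyz
    by_contra hzC
    exact hz ⟨hzC, y, hy, hyz⟩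
  · have h1 : H.compIn C x = C :=
      (compIn_eq_of_subset (hC ▸ compIn_subset hx) hC.ge).trans hC.symm
    calc C = H.compIn C x := h1.symm
      _ ⊆ _ := compIn_mono (W := C) (U := (H.border C)ᶜ) fun y hy h => h.1 hy

variable (H) in
/-- A function to the naturals whose layers eliminate the graph with width at most `k`: a vertex
is the only one of its layer in its component of the rest, and that component has at most `k`
neighbours. -/
def IsLayering (k : ℕ) (pos : V → ℕ) : Prop :=
  (∀ v, (H.border (H.compIn {u | pos v ≤ pos u} v)).ncard ≤ k) ∧
    ∀ u v, pos u = pos v → u ∈ H.compIn {w | pos v ≤ pos w} v → u = v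

variable (H) in
/-- The earlier vertices on which `v` depends. -/
def upper (pos : V → ℕ) (v : V) : Set V := H.border (H.compIn {u | pos v ≤ pos u} v)

/-! ### The elimination forest of a layering -/

namespace IsLayering

variable {k : ℕ} {pos : V → ℕ} {u v w : V}

/-- A neighbour of the component that is not earlier than v would have been absorbed into the
component. -/
theorem lt_of_mem (h : w ∈ H.upper pos v) : pos w < pos v := by
  obtain ⟨h1, y, hy, hyw⟩ := h
  by_contra hlt
  have hyU := compIn_subset (U := {u | pos v ≤ pos u}) (by simp) hy
  exact h1 (mem_compIn_of_adj hy hyU (by simpa using hlt) hyw)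

theorem mem_upper_of_adj (h : H.Adj v w) (hlt : pos w < pos v) : w ∈ H.upper pos v := by
  refine ⟨fun hw => ?_, v, self_mem_compIn, h⟩
  have := compIn_subset (U := {u | pos v ≤ pos u}) (by simp) hw
  simp at this; omega

/-- Adjacent vertices of one layer would share a component, which the uniqueness clause of a
layering forbids. -/
theorem ne_of_adj (hl : H.IsLayering k pos) (h : H.Adj v w) : pos v ≠ pos w := by
  intro e
  refine h.ne' (hl.2 w v e.symm (mem_compIn_of_adj self_mem_compIn ?_ ?_ h)) <;> simp [e]

/-- The parent is the latest element v of `upper`. The component of u is contained in the component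
of v, so every neighbour that is earlier than v is also a neighbour of the latter. A neighbour in
the layer of v lies in the component of v and is v by uniqueness. -/
theorem exists_parent [Finite V] (hl : H.IsLayering k pos) (h : (H.upper pos u).Nonempty) :
    ∃ v ∈ H.upper pos u, ∀ w ∈ H.upper pos u, w = v ∨ w ∈ H.upper pos v := by
  obtain ⟨v, hv, hmax⟩ := Set.exists_max_image _ pos (Set.toFinite _) h
  refine ⟨v, hv, fun w hw => ?_⟩
  have hvu := lt_of_mem hv
  obtain ⟨-, y, hy, hyv⟩ := hv
  have hsub : ({x | pos u ≤ pos x} : Set V) ⊆ {x | pos v ≤ pos x} := fun x hx => by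
    simp at hx ⊢; omega
  have hyU := hsub (compIn_subset (U := {x | pos u ≤ pos x}) (by simp) hy)
  have hyC : y ∈ H.compIn {x | pos v ≤ pos x} v :=
    mem_compIn_of_adj self_mem_compIn (by simp) hyU hyv.symm
  have hCC : H.compIn {x | pos u ≤ pos x} u ⊆ H.compIn {x | pos v ≤ pos x} v := by
    rw [← compIn_eq_of_mem hy, ← compIn_eq_of_mem hyC]
    exact compIn_mono hsub
  have hwmax := hmax w hw
  obtain ⟨hw1, z, hz, hzw⟩ := hw
  rcases Nat.lt_or_ge (pos w) (pos v) with hlt | hge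
  · right
    refine ⟨fun hwC => ?_, z, hCC hz, hzw⟩
    have := compIn_subset (U := {u | pos v ≤ pos u}) (by simp) hwC
    simp at this; omega
  · left
    have he : pos w = pos v := le_antisymm hwmax hge
    have hzU := hsub (compIn_subset (U := {x | pos u ≤ pos x}) (by simp) hz)
    exact hl.2 w v he (mem_compIn_of_adj (hCC hz) hzU (by simp [he]) hzw)

/-- The dynamic program over components finds all components of the layering. -/
theorem marked [Finite V] (hl : H.IsLayering k pos) (M : ℕ → Set V → Prop)
    (h : ∀ r (C : Set V), ∀ v ∈ C, (∀ x ∈ C, H.compIn (H.border C)ᶜ x = C) →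
      (H.border C).ncard ≤ k → (∀ y ∈ C, y ≠ v → M r (H.compIn (C \ {v}) y)) → M (r + 1) C)
    (r m : ℕ) : ∀ x, m ≤ pos x → (H.compIn {u | m ≤ pos u} x).ncard ≤ r →
      M r (H.compIn {u | m ≤ pos u} x) := by
  induction r generalizing m with
  | zero =>
    intro x _ hr
    have := (Set.ncard_eq_zero (Set.toFinite _)).1 (Nat.le_zero.1 hr)
    exact absurd (self_mem_compIn (H := H) (U := {u | m ≤ pos u}) (x := x)) (by simp [this])
  | succ r ih =>
    intro x hx hr
    set C := H.compIn {u | m ≤ pos u} x with hC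
    have hCU : C ⊆ {u | m ≤ pos u} := compIn_subset hx
    obtain ⟨v, hv, hmin⟩ := Set.exists_min_image C pos (Set.toFinite _) ⟨x, self_mem_compIn⟩
    -- As v is earliest in C, its own component among the vertices not earlier than v is all of C.
    -- So the layering bounds the border of C.
    have hCv : H.compIn {u | pos v ≤ pos u} v = C := by
      rw [hC, ← compIn_eq_of_mem hv]
      refine compIn_eq_of_subset (fun u (hu : pos v ≤ pos u) =>
        show m ≤ pos u from le_trans (hCU hv) hu) ?_
      rw [compIn_eq_of_mem hv]
      exact hmin
    refine h r C v hv (fun y hy => ?_) (hCv ▸ hl.1 v) fun y hy hyv => ?_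
    · exact compIn_compl_border (hC.trans (compIn_eq_of_mem hy).symm) (hCU hy)
    · have hlt : ∀ z ∈ C, z ≠ v → pos v + 1 ≤ pos z := fun z hz hzv => by
        rcases (hmin z hz).eq_or_lt with e | e
        · exact absurd (hl.2 z v e.symm (hCv ▸ hz)) hzv
        · exact e
      -- No other vertex of C shares the layer of v. Hence the components of C without v are again
      -- components of the layering, for the threshold pos v + 1, and they are smaller.
      have hsub : C \ {v} ⊆ {u | pos v + 1 ≤ pos u} := fun z hz => hlt z hz.1 hz.2
      have hin : H.compIn {u | pos v + 1 ≤ pos u} y ⊆ C \ {v} := by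
        intro z hz
        have hzU := compIn_subset (U := {u | pos v + 1 ≤ pos u}) (hlt y hy hyv) hz
        refine ⟨?_, fun e => ?_⟩
        · rw [← hCv] at hy ⊢
          rw [← compIn_eq_of_mem hy]
          exact compIn_mono (fun u hu => by simp at hu ⊢; omega) hz
        · rw [Set.mem_singleton_iff] at e
          subst e; simp at hzU
      have he := compIn_eq_of_subset hsub hin
      rw [he]
      refine ih _ y (hlt y hy hyv) ?_
      have : (H.compIn {u | pos v + 1 ≤ pos u} y).ncard < C.ncard :=
        (Set.ncard_le_ncard hin (Set.toFinite _)).trans_lt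
          (Set.ncard_sdiff_singleton_lt_of_mem hv (Set.toFinite _))
      omega

end IsLayering

variable (H) in
/-- A choice function that splits components: every chosen vertex leaves components for which a
choice exists again. -/
def IsSplitting (k : ℕ) (ch : Set V → V → Prop) : Prop :=
  (∀ C u v, ch C u → ch C v → u = v) ∧
  ∀ C v, ch C v → v ∈ C ∧ (H.border C).ncard ≤ k ∧
    ∀ y ∈ C, y ≠ v → ∃ w, ch (H.compIn (C \ {v}) y) w

/-! ### From splitting choices to layers -/

namespace IsSplitting

variable {k : ℕ} {ch : Set V → V → Prop}

/-- Removing all chosen vertices at once deletes exactly one vertex from each component of U. What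
remains around x is a component of C without its choice, and such components have choices again. -/
theorem step (h : H.IsSplitting k ch) (hU : ∀ x ∈ U, ∃ w, ch (H.compIn U x) w) :
    ∀ x ∈ U, ¬ ch (H.compIn U x) x →
      ∃ w, ch (H.compIn {v | v ∈ U ∧ ¬ ch (H.compIn U v) v} x) w := by
  intro x hx hxn
  obtain ⟨v, hv⟩ := hU x hx
  obtain ⟨hvC, -, hnext⟩ := h.2 _ v hv
  have hxv : x ≠ v := fun e => hxn (by rw [← e] at hv; exact hv)
  have hsub : H.compIn U x \ {v} ⊆ {v | v ∈ U ∧ ¬ ch (H.compIn U v) v} := fun y hy =>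
    ⟨compIn_subset hx hy.1, fun hc => hy.2 (h.1 _ _ _ (compIn_eq_of_mem hy.1 ▸ hc) hv)⟩
  have hin : H.compIn {v | v ∈ U ∧ ¬ ch (H.compIn U v) v} x ⊆ H.compIn U x \ {v} := by
    intro y hy
    refine ⟨compIn_mono (fun _ h => h.1) hy, fun e => ?_⟩
    rw [Set.mem_singleton_iff] at e
    subst e
    have := (compIn_subset (U := {v | v ∈ U ∧ ¬ ch (H.compIn U v) v}) ⟨hx, hxn⟩ hy).2
    rw [compIn_eq_of_mem hvC] at this
    exact this hv
  rw [← compIn_eq_of_subset hsub hin]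
  exact hnext x self_mem_compIn hxv

theorem isLayering (h : H.IsSplitting k ch) {pos : V → ℕ}
    (hpos : ∀ v, ch (H.compIn {u | pos v ≤ pos u} v) v) : H.IsLayering k pos := by
  refine ⟨fun v => (h.2 _ v (hpos v)).2.1, fun u v huv hu => ?_⟩
  have := hpos u
  rw [huv, compIn_eq_of_mem hu] at this
  exact h.1 _ _ _ this (hpos v)

end IsSplitting

end SimpleGraph

/-! ### Layerings from tree decompositions -/

namespace TreeDecomposition

open SimpleGraph

variable {m : ℕ}

theorem length_eq_dist {T : SimpleGraph (Fin m)} (hT : T.IsTree) {r u : Fin m} {p : T.Walk r u}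
    (hp : p.IsPath) : p.length = T.dist r u := by
  obtain ⟨q, hq, hl⟩ := hT.connected.exists_path_of_dist r u
  rw [← hl, (hT.existsUnique_path r u).unique hp hq]

/-- `u` lies below `t`, in the tree rooted at `r`. -/
def Below (T : SimpleGraph (Fin m)) (r t u : Fin m) : Prop :=
  ∃ p : T.Walk r u, p.IsPath ∧ t ∈ p.support

/-- The only edge that leaves the subtree below t joins t to its parent, and the last hypothesis
excludes it. Either the root path of u' extends that of u, or u' is the parent of u and the root
path of u is that of u' with u appended. -/
theorem Below.step {T : SimpleGraph (Fin m)} (hT : T.IsTree) {r t u u' : Fin m}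
    (h : Below T r t u) (hadj : T.Adj u u') (h' : u ≠ t ∨ T.dist r t ≤ T.dist r u') :
    Below T r t u' := by
  obtain ⟨p, hp, ht⟩ := h
  obtain ⟨q, hq, -⟩ := hT.existsUnique_path r u'
  refine ⟨q, hq, ?_⟩
  by_cases hu : u ∈ q.support
  · rw [hT.isAcyclic.path_concat hp hq hadj hu]
    exact Walk.support_subset_support_concat _ _ ht
  · have e : p = q.concat hadj.symm :=
      (hT.existsUnique_path r u).unique hp (hq.concat hu hadj.symm)
    rw [e, Walk.support_concat, List.mem_append, List.mem_singleton] at ht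
    rcases ht with ht | rfl
    · exact ht
    · rcases h' with h' | h'
      · exact absurd rfl h'
      · have h1 := length_eq_dist hT hp
        have h2 := length_eq_dist hT hq
        rw [e, Walk.length_concat] at h1
        omega

theorem Below.walk {T : SimpleGraph (Fin m)} (hT : T.IsTree) {r t u u' : Fin m}
    (h : Below T r t u) (p : T.Walk u u')
    (h' : ∀ w ∈ p.support, T.dist r t ≤ T.dist r w) : Below T r t u' := by
  induction p with
  | nil => exact h
  | cons hadj p ih =>
    refine ih (h.step hT hadj (.inr (h' _ ?_))) fun w hw => h' w ?_
    · simp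
    · simp [hw]

theorem Below.eq_of_dist_le {T : SimpleGraph (Fin m)} (hT : T.IsTree) {r t u : Fin m}
    (h : Below T r t u) (hd : T.dist r u ≤ T.dist r t) : u = t := by
  classical
  obtain ⟨p, hp, ht⟩ := h
  have h1 := length_eq_dist hT hp
  have h2 := length_eq_dist hT (hp.takeUntil ht)
  have h3 := congrArg Walk.length (p.take_spec ht)
  rw [Walk.length_append] at h3
  exact (Walk.eq_of_length_eq_zero (p := p.dropUntil t ht) (by omega)).symm

/-- The subtree below t can be left only through t, and t is its only vertex of depth at most that
of t. -/
theorem Below.mem_support {T : SimpleGraph (Fin m)} (hT : T.IsTree) {r t u u' : Fin m}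
    (h : Below T r t u) (p : T.Walk u u') (hd : T.dist r u' ≤ T.dist r t) : t ∈ p.support := by
  induction p with
  | nil => simp [h.eq_of_dist_le hT hd]
  | @cons u v w hadj p ih =>
    by_cases hu : u = t
    · simp [hu]
    · simp [ih (h.step hT hadj (.inl hu)) hd]

/-- Vertices are ordered by the depth of their topmost bag. The component of v among the vertices
not earlier than v lives in bags below the topmost bag of v. A vertex w of its border shares a bag
with that component, while its own topmost bag is no deeper than that of v. The bags containing w
are connected, so w lies in the topmost bag of v. Without v itself, that bag has at most as many
elements as the width. -/
theorem exists_isLayering {n k : ℕ} {H : SimpleGraph (Fin n)} (D : TreeDecomposition H m)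
    (hk : D.width ≤ k) : ∃ pos, H.IsLayering k pos := by
  classical
  have hT := D.isTree
  obtain ⟨r⟩ := hT.connected.nonempty
  have hex : ∀ x, ∃ t, x ∈ D.bag t ∧ ∀ u, x ∈ D.bag u → D.tree.dist r t ≤ D.tree.dist r u := by
    intro x
    obtain ⟨u, hu⟩ := D.vertex_cover x
    obtain ⟨t, ht, hmin⟩ := Finset.exists_min_image {u | x ∈ D.bag u} (D.tree.dist r)
      ⟨u, by simpa using hu⟩
    exact ⟨t, by simpa using ht, fun u hu => hmin u (by simpa using hu)⟩
  choose top htop hmin using hex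
  -- The summand x < n breaks ties, so pos is injective and the uniqueness clause is immediate.
  set pos : Fin n → ℕ := fun x => D.tree.dist r (top x) * n + x with hpos
  have hle : ∀ x y, pos x ≤ pos y → D.tree.dist r (top x) ≤ D.tree.dist r (top y) := by
    intro x y h
    rw [← LoopLang.mul_add_div_of_lt (D.tree.dist r (top x)) x.2,
      ← LoopLang.mul_add_div_of_lt (D.tree.dist r (top y)) y.2]
    exact Nat.div_le_div_right h
  have hpath : ∀ {x u v}, x ∈ D.bag u → x ∈ D.bag v →
      ∃ p : D.tree.Walk u v, ∀ w ∈ p.support, x ∈ D.bag w := by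
    intro x u v hu hv
    obtain ⟨p, hp, -⟩ := hT.existsUnique_path u v
    exact ⟨p, D.path_closed x u v hu hv p hp⟩
  refine ⟨pos, fun v => ?_, fun u v huv _ =>
    Fin.ext ((LoopLang.mul_add_inj u.2 v.2).1 huv).2⟩
  have hbelow : H.compIn {u | pos v ≤ pos u} v ⊆
      {y | pos v ≤ pos y ∧ ∀ u, y ∈ D.bag u → Below D.tree r (top v) u} := by
    have key : ∀ y, pos v ≤ pos y → ∀ u, y ∈ D.bag u → Below D.tree r (top v) u →
        ∀ u', y ∈ D.bag u' → Below D.tree r (top v) u' := by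
      intro y hy u hu hb u' hu'
      obtain ⟨p, hp⟩ := hpath hu hu'
      exact hb.walk hT p fun w hw => (hle _ _ hy).trans (hmin y w (hp w hw))
    refine compIn_subset_of_closed ⟨le_rfl, ?_⟩ ?_
    · obtain ⟨p, hp, -⟩ := hT.existsUnique_path r (top v)
      exact key v le_rfl (top v) (htop v) ⟨p, hp, p.end_mem_support⟩
    · rintro y ⟨hy1, hy2⟩ z hz - hyz
      obtain ⟨u, hu, hu'⟩ := D.edge_cover y z hyz
      exact ⟨hz, key z hz u hu' (hy2 u hu)⟩
  have hsub : H.border (H.compIn {u | pos v ≤ pos u} v) ⊆ ↑((D.bag (top v)).erase v) := by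
    rintro w ⟨hw, y, hy, hyw⟩
    rw [Finset.mem_coe, Finset.mem_erase]
    have hyU := compIn_subset (U := {u | pos v ≤ pos u}) (by simp) hy
    have hwp : pos w ≤ pos v := by
      by_contra hlt
      exact hw (mem_compIn_of_adj hy hyU (by simp; omega) hyw)
    refine ⟨fun e => hw (e ▸ self_mem_compIn), ?_⟩
    obtain ⟨u, hu, hu'⟩ := D.edge_cover y w hyw
    obtain ⟨p, hp⟩ := hpath hu' (htop w)
    exact hp _ (((hbelow hy).2 u hu).mem_support hT p (hle _ _ hwp))
  refine (Set.ncard_le_ncard hsub (Finset.finite_toSet _)).trans ?_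
  rw [Set.ncard_coe_finset, Finset.card_erase_of_mem (htop v)]
  have : (D.bag (top v)).card ≤ Finset.univ.sup fun u => (D.bag u).card :=
    Finset.le_sup (f := fun u => (D.bag u).card) (Finset.mem_univ _)
  unfold TreeDecomposition.width at hk
  omega

end TreeDecomposition

theorem SimpleGraph.exists_isLayering_of_treewidth {n k : ℕ} {H : SimpleGraph (Fin n)}
    (hk : treewidth H ≤ k) : ∃ pos, H.IsLayering k pos := by
  obtain ⟨m, D, hD⟩ := (treewidth_le_iff H k).1 hk
  exact D.exists_isLayering hD

/-! ### Embeddings of small distortion as a local constraint problem -/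

namespace SimpleGraph

variable {V W : Type*} {G : SimpleGraph V} {H : SimpleGraph W}

theorem dist_map_le (hG : G.Connected) (hH : H.Connected) {f : V → W} {e : ℕ}
    (h : ∀ u v, G.Adj u v → H.dist (f u) (f v) ≤ e) (u v : V) :
    H.dist (f u) (f v) ≤ e * G.dist u v := by
  obtain ⟨p, hp⟩ := hG.exists_walk_length_eq_dist u v
  rw [← hp]
  clear hp
  induction p with
  | nil => simp
  | @cons u v w hadj p ih =>
    have h1 := hH.dist_triangle (u := f u) (v := f v) (w := f w)
    have h2 := h _ _ hadj
    rw [Walk.length_cons, mul_add, mul_one]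
    omega

theorem Connected.coe_edist (hG : G.Connected) (u v : V) :
    ((G.edist u v : ℕ∞) : ℝ≥0∞) = ((G.dist u v : ℕ) : ℝ≥0∞) := by
  rw [← (hG u v).coe_dist_eq_edist]; simp

theorem Connected.dist_lt_card [Fintype V] (hG : G.Connected) (u v : V) :
    G.dist u v < Fintype.card V := by
  obtain ⟨p, hp, hl⟩ := hG.exists_path_of_dist u v
  exact hl ▸ hp.length_lt

end SimpleGraph

/-! ### Expansion and contraction on edges -/

open SimpleGraph

theorem ratio_le_expansion {V W : Type*} (G : SimpleGraph V) (H : SimpleGraph W) (f : V → W)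
    {u v : V} (h : u ≠ v) :
    ((H.edist (f u) (f v) : ℕ∞) : ℝ≥0∞) / ((G.edist u v : ℕ∞) : ℝ≥0∞) ≤ expansion G H f := by
  unfold expansion
  refine le_iSup_of_le u (le_iSup_of_le v ?_)
  exact le_iSup (fun _ : u ≠ v =>
    ((H.edist (f u) (f v) : ℕ∞) : ℝ≥0∞) / ((G.edist u v : ℕ∞) : ℝ≥0∞)) h

theorem ratio_le_contraction {V W : Type*} (G : SimpleGraph V) (H : SimpleGraph W) (f : V → W)
    {u v : V} (h : u ≠ v) :
    ((G.edist u v : ℕ∞) : ℝ≥0∞) / ((H.edist (f u) (f v) : ℕ∞) : ℝ≥0∞) ≤ contraction G H f := by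
  unfold contraction
  refine le_iSup_of_le u (le_iSup_of_le v ?_)
  exact le_iSup (fun _ : u ≠ v =>
    ((G.edist u v : ℕ∞) : ℝ≥0∞) / ((H.edist (f u) (f v) : ℕ∞) : ℝ≥0∞)) h

theorem expansion_le_of_edges {V W : Type*} {G : SimpleGraph V} {H : SimpleGraph W}
    (hG : G.Connected) (hH : H.Connected) {f : V → W} {e : ℕ}
    (h : ∀ u v, G.Adj u v → H.dist (f u) (f v) ≤ e) : expansion G H f ≤ e := by
  refine iSup_le fun u => iSup_le fun v => iSup_le fun _ => ?_
  rw [hG.coe_edist, hH.coe_edist]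
  refine ENNReal.div_le_of_le_mul ?_
  exact_mod_cast dist_map_le hG hH h u v

theorem contraction_le_of_edges {V W : Type*} {G : SimpleGraph V} {H : SimpleGraph W}
    (hG : G.Connected) (hH : H.Connected) {f : V → W} (hf : Function.Bijective f) {c : ℕ}
    (h : ∀ u v, H.Adj (f u) (f v) → G.dist u v ≤ c) : contraction G H f ≤ c := by
  refine iSup_le fun u => iSup_le fun v => iSup_le fun _ => ?_
  rw [hG.coe_edist, hH.coe_edist]
  refine ENNReal.div_le_of_le_mul ?_
  obtain ⟨g, hgf, hfg⟩ := Function.bijective_iff_has_inverse.1 hf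
  have := dist_map_le (f := g) hH hG (e := c) (fun x y hxy => h _ _ (by rwa [hfg, hfg])) (f u) (f v)
  rw [hgf, hgf] at this
  exact_mod_cast this

/-- An edge whose image is longest determines a lower bound for the expansion. -/
theorem exists_edge_bound {n : ℕ} {G H : SimpleGraph (Fin n)} (hG : G.Connected)
    (hH : H.Connected) (f : Fin n → Fin n) (hf : Function.Injective f) (hn : 2 ≤ n) :
    ∃ e : ℕ, 1 ≤ e ∧ e ≤ n ∧ (∀ u v, G.Adj u v → H.dist (f u) (f v) ≤ e) ∧
      ∃ u v, G.Adj u v ∧ H.dist (f u) (f v) = e := by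
  classical
  have : Nontrivial (Fin n) := Fin.nontrivial_iff_two_le.2 hn
  obtain ⟨u₀, v₀, h₀⟩ : ∃ u v, G.Adj u v := by
    obtain ⟨u⟩ := hG.nonempty
    obtain ⟨v, hv⟩ := hG.preconnected.exists_adj_of_nontrivial u
    exact ⟨u, v, hv⟩
  obtain ⟨⟨u, v⟩, huv, hmax⟩ := Finset.exists_max_image
    ({p | G.Adj p.1 p.2} : Finset (Fin n × Fin n)) (fun p => H.dist (f p.1) (f p.2))
    ⟨(u₀, v₀), by simpa using h₀⟩
  simp only [Finset.mem_filter, Finset.mem_univ, true_and] at huv hmax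
  refine ⟨_, ?_, ?_, fun u' v' h' => hmax (u', v') h', u, v, huv, rfl⟩
  · exact hH.pos_dist_of_ne fun h => huv.ne (hf h)
  · simpa using (hH.dist_lt_card (f u) (f v)).le

/-- Two images in different components of `H` would give the ratio of ⊤ to a finite distance, which
is ⊤. -/
theorem connected_of_expansion {n : ℕ} {G H : SimpleGraph (Fin n)} (hG : G.Connected)
    {f : Fin n → Fin n} (hf : Function.Bijective f) (h : expansion G H f ≠ ⊤) : H.Connected := by
  have := hG.nonempty
  refine ⟨fun x y => ?_⟩
  obtain ⟨u, rfl⟩ := hf.2 x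
  obtain ⟨v, rfl⟩ := hf.2 y
  by_cases huv : u = v
  · rw [huv]
  · by_contra hr
    apply h
    rw [eq_top_iff]
    calc (⊤ : ℝ≥0∞) = ((H.edist (f u) (f v) : ℕ∞) : ℝ≥0∞) / ((G.edist u v : ℕ∞) : ℝ≥0∞) := by
          rw [edist_eq_top_of_not_reachable hr, hG.coe_edist]
          simp [ENNReal.top_div]
      _ ≤ _ := ratio_le_expansion G H f huv

theorem distortionAtMost_of_edges {n d e c : ℕ} {G H : SimpleGraph (Fin n)} (hG : G.Connected)
    (hH : H.Connected) {f : Fin n → Fin n} (hf : Function.Bijective f) (hd : e * c ≤ d)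
    (h1 : ∀ u v, G.Adj u v → H.dist (f u) (f v) ≤ e)
    (h2 : ∀ u v, H.Adj (f u) (f v) → G.dist u v ≤ c) : DistortionAtMost G H d f := by
  have h1 := expansion_le_of_edges hG hH h1
  have h2 := contraction_le_of_edges hG hH hf h2
  refine ⟨ne_top_of_le_ne_top (by simp) h1, ne_top_of_le_ne_top (by simp) h2, ?_⟩
  calc expansion G H f * contraction G H f ≤ (e : ℝ≥0∞) * c := mul_le_mul' h1 h2
    _ ≤ d := by exact_mod_cast hd

/-- The longest image of an edge has an integral length that is itself one of the ratios, so e and c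
are lower bounds for expansion and contraction and e * c ≤ d. Distances are below n and the other
factor is at least 1, whence the bound min n d. -/
theorem DistortionAtMost.exists_edges {n d : ℕ} {G H : SimpleGraph (Fin n)} (hG : G.Connected)
    (hd : 1 ≤ d) {f : Fin n → Fin n} (hf : Function.Bijective f) (h : DistortionAtMost G H d f) :
    H.Connected ∧ ∃ e c, 1 ≤ e ∧ e ≤ min n d ∧ 1 ≤ c ∧ c ≤ min n d ∧ e * c ≤ d ∧
      (∀ u v, G.Adj u v → H.dist (f u) (f v) ≤ e) ∧
      ∀ u v, H.Adj (f u) (f v) → G.dist u v ≤ c := by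
  obtain ⟨h1, h2, h3⟩ := h
  have hH := connected_of_expansion hG hf h1
  refine ⟨hH, ?_⟩
  have hn : 1 ≤ n := by
    obtain ⟨u⟩ := hG.nonempty
    exact u.pos
  -- With a single vertex there are no edges to maximise over, and e = c = 1 serves because d ≥ 1.
  rcases hn.eq_or_lt with rfl | hn2
  · refine ⟨1, 1, le_rfl, by simpa using hd, le_rfl, by simpa using hd, by simpa using hd, ?_, ?_⟩
    · intro u v huv; exact absurd (Subsingleton.elim u v) huv.ne
    · intro u v huv; exact absurd (Subsingleton.elim _ _) huv.ne
  · obtain ⟨e, he1, hen, he, u, v, huv, heq⟩ := exists_edge_bound hG hH f hf.1 hn2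
    obtain ⟨g, hgf, hfg⟩ := Function.bijective_iff_has_inverse.1 hf
    obtain ⟨c, hc1, hcn, hc, x, y, hxy, hceq⟩ :=
      exists_edge_bound hH hG g hfg.injective hn2
    have hE : (e : ℝ≥0∞) ≤ expansion G H f := by
      calc (e : ℝ≥0∞) =
            ((H.edist (f u) (f v) : ℕ∞) : ℝ≥0∞) / ((G.edist u v : ℕ∞) : ℝ≥0∞) := by
            rw [hG.coe_edist, hH.coe_edist, heq, dist_eq_one_iff_adj.2 huv]; simp
        _ ≤ _ := ratio_le_expansion G H f huv.ne
    have hC : (c : ℝ≥0∞) ≤ contraction G H f := by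
      calc (c : ℝ≥0∞) =
            ((G.edist (g x) (g y) : ℕ∞) : ℝ≥0∞) / ((H.edist (f (g x)) (f (g y)) : ℕ∞) : ℝ≥0∞) := by
            rw [hG.coe_edist, hH.coe_edist, hceq, hfg, hfg, dist_eq_one_iff_adj.2 hxy]; simp
        _ ≤ _ := ratio_le_contraction G H f fun h => hxy.ne (hfg.injective h)
    have hec : e * c ≤ d := by
      have : (e : ℝ≥0∞) * c ≤ d := (mul_le_mul' hE hC).trans h3
      exact_mod_cast this
    refine ⟨e, c, he1, le_min hen ((Nat.le_mul_of_pos_right e hc1).trans hec), hc1,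
      le_min hcn ((Nat.le_mul_of_pos_left c he1).trans hec), hec, he, fun u v huv => ?_⟩
    have := hc _ _ huv
    rwa [hgf, hgf] at this

/-- The constraints on the inverse `ψ` of an embedding with expansion `e` and contraction `c`,
each of which involves only a ball of radius `e`. -/
def IsLocalInverse {n : ℕ} (G H : SimpleGraph (Fin n)) (e c : ℕ) (ψ : Fin n → Fin n) : Prop :=
  (∀ x y, H.Adj x y → G.dist (ψ x) (ψ y) ≤ c) ∧
    ∀ x v, G.Adj (ψ x) v → ∃ z, H.dist x z ≤ e ∧ ψ z = v

/-! ### Properties of local inverses -/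

namespace IsLocalInverse

variable {n e c d : ℕ} {G H : SimpleGraph (Fin n)} {ψ : Fin n → Fin n}

/-- A walk of `G` that starts at ψ x is lifted edge by edge, each lift costing at most e in `H`. -/
theorem exists_of_dist_le (hG : G.Connected) (hH : H.Connected) (h : IsLocalInverse G H e c ψ)
    (r : ℕ) (x v : Fin n) (hr : G.dist (ψ x) v ≤ r) : ∃ z, H.dist x z ≤ r * e ∧ ψ z = v := by
  obtain ⟨p, hp⟩ := hG.exists_walk_length_eq_dist (ψ x) v
  rw [← hp] at hr
  clear hp
  generalize hu : ψ x = u at p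
  induction p generalizing r x with
  | nil => exact ⟨x, by simp, hu⟩
  | @cons u w v hadj p ih =>
    subst hu
    obtain ⟨y, hy, hyw⟩ := h.2 x w hadj
    rw [Walk.length_cons] at hr
    obtain ⟨z, hz, hzv⟩ := ih (r - 1) y (by omega) (hu := hyw)
    refine ⟨z, ?_, hzv⟩
    have h1 := hH.dist_triangle (u := x) (v := y) (w := z)
    obtain ⟨r, rfl⟩ : ∃ r', r = r' + 1 := ⟨r - 1, by omega⟩
    rw [Nat.add_sub_cancel] at hz
    rw [add_mul, one_mul]
    omega

/-- Lifting walks from one value of ψ reaches every vertex of the connected graph `G`. So ψ is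
surjective, and injective because both sides have n elements. Injectivity, which is not local, never
has to be tested. -/
theorem bijective (hG : G.Connected) (hH : H.Connected) (h : IsLocalInverse G H e c ψ) :
    Function.Bijective ψ := by
  refine Finite.surjective_iff_bijective.1 fun v => ?_
  obtain ⟨x⟩ := hG.nonempty
  obtain ⟨z, -, hz⟩ := h.exists_of_dist_le hG hH _ x v le_rfl
  exact ⟨z, hz⟩

theorem distortionAtMost (hG : G.Connected) (hH : H.Connected) (h : IsLocalInverse G H e c ψ)
    (hd : e * c ≤ d) {f : Fin n → Fin n} (hf : ∀ x, f (ψ x) = x) :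
    Function.Bijective f ∧ DistortionAtMost G H d f := by
  have hb := h.bijective hG hH
  have hf' : ∀ u, ψ (f u) = u := fun u => by
    obtain ⟨x, rfl⟩ := hb.2 u
    rw [hf]
  have hfb : Function.Bijective f := Function.bijective_iff_has_inverse.2 ⟨ψ, hf', hf⟩
  refine ⟨hfb, distortionAtMost_of_edges hG hH hfb hd (fun u v huv => ?_) fun u v huv => ?_⟩
  · obtain ⟨z, hz, hzv⟩ := h.2 (f u) v (by rwa [hf'])
    rw [← hzv, hf]
    exact hz
  · have := h.1 _ _ huv
    rwa [hf', hf'] at this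

theorem of_edges {f : Fin n → Fin n} (hf : ∀ x, f (ψ x) = x) (hf' : ∀ u, ψ (f u) = u)
    (h1 : ∀ u v, G.Adj u v → H.dist (f u) (f v) ≤ e)
    (h2 : ∀ u v, H.Adj (f u) (f v) → G.dist u v ≤ c) : IsLocalInverse G H e c ψ := by
  refine ⟨fun x y hxy => h2 _ _ (by rwa [hf, hf]), fun x v hv => ⟨f v, ?_, hf' v⟩⟩
  have := h1 _ _ hv
  rwa [hf] at this

theorem exists_of_distortionAtMost (hG : G.Connected) (hd : 1 ≤ d) {f : Fin n → Fin n}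
    (hf : Function.Bijective f) (h : DistortionAtMost G H d f) :
    H.Connected ∧ ∃ e c, 1 ≤ e ∧ e ≤ min n d ∧ 1 ≤ c ∧ c ≤ min n d ∧ e * c ≤ d ∧
      ∃ ψ, IsLocalInverse G H e c ψ := by
  obtain ⟨hH, e, c, h1, h2, h3, h4, h5, h6, h7⟩ := h.exists_edges hG hd hf
  obtain ⟨ψ, hψ, hψ'⟩ := Function.bijective_iff_has_inverse.1 hf
  exact ⟨hH, e, c, h1, h2, h3, h4, h5, ψ, of_edges hψ' hψ h6 h7⟩

/-- Views of the balls that agree along the edges of `H` come from a single map. -/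
theorem of_views (hH : H.Connected) (he : 1 ≤ e) (view : Fin n → Fin n → Fin n)
    (h1 : ∀ x y, H.Adj x y → G.dist (view x x) (view x y) ≤ c)
    (h2 : ∀ x v, G.Adj (view x x) v → ∃ z, H.dist x z ≤ e ∧ view x z = v)
    (h3 : ∀ x y, H.Adj x y → ∀ z, H.dist x z ≤ e → H.dist y z ≤ e → view x z = view y z) :
    IsLocalInverse G H e c fun x => view x x := by
  -- Induction along a shortest path from x to z. Its next vertex y is closer to z, so z lies in
  -- both balls and the views of x and y agree there.
  have key : ∀ r x z, H.dist x z = r → r ≤ e → view x z = view z z := by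
    intro r
    induction r with
    | zero =>
      intro x z hr _
      rw [(hH.dist_eq_zero_iff).1 hr]
    | succ r ih =>
      intro x z hr hre
      obtain ⟨p, hp⟩ := hH.exists_walk_length_eq_dist x z
      cases p with
      | nil => simp at hp; omega
      | @cons _ y _ hxy p =>
        rw [Walk.length_cons, hr] at hp
        have h4 := dist_le p
        have h5 := hH.dist_triangle (u := x) (v := y) (w := z)
        have h6 := dist_eq_one_iff_adj.2 hxy
        rw [h3 x y hxy z (by omega) (by omega)]
        exact ih y z (by omega) (by omega)
  refine ⟨fun x y hxy => ?_, fun x v hv => ?_⟩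
  · have h6 := dist_eq_one_iff_adj.2 hxy
    have := h1 x y hxy
    rwa [key 1 x y h6 he] at this
  · obtain ⟨z, hz, hzv⟩ := h2 x v hv
    exact ⟨z, hz, by rw [← hzv, key _ x z rfl hz]⟩

end IsLocalInverse

/-! ### Encoding of partial assignments by numbers -/

namespace LoopLang

open Classical in
/-- The values of `f` on the elements of `P` below `n`, as digits in base `b`. -/
noncomputable def encode (b : ℕ) (P : ℕ → Prop) (f : ℕ → ℕ) (n : ℕ) : ℕ :=
  ∑ w ∈ Finset.range n, if P w then f w * b ^ Nat.count P w else 0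

theorem encode_congr {b n : ℕ} {P : ℕ → Prop} {f g : ℕ → ℕ} (h : ∀ w < n, P w → f w = g w) :
    encode b P f n = encode b P g n := by
  classical
  refine Finset.sum_congr rfl fun w hw => ?_
  split
  · rw [h w (Finset.mem_range.1 hw) ‹_›]
  · rfl

-- The digit of w stands at its rank in P, so a code has as many digits as P has elements. This
-- keeps the number of codes independent of n for balls and exponential only in k for `upper` sets.
open Classical in
theorem encode_spec {b : ℕ} {P : ℕ → Prop} {f : ℕ → ℕ} (hb : 1 ≤ b) (n : ℕ)
    (hf : ∀ w < n, P w → f w < b) :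
    encode b P f n < b ^ Nat.count P n ∧
      ∀ w < n, P w → encode b P f n / b ^ Nat.count P w % b = f w := by
  induction n with
  | zero => simp [encode]
  | succ n ih =>
    obtain ⟨h1, h2⟩ := ih fun w hw => hf w (by omega)
    have hs : encode b P f (n + 1) =
        encode b P f n + if P n then f n * b ^ Nat.count P n else 0 := Finset.sum_range_succ _ _
    by_cases hP : P n
    · rw [if_pos hP] at hs
      have hfn := hf n (by omega) hP
      have hpos : 0 < b ^ Nat.count P n := Nat.pow_pos hb
      constructor
      · rw [hs, Nat.count_succ, if_pos hP, pow_succ]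
        calc _ < b ^ Nat.count P n + f n * b ^ Nat.count P n := by omega
          _ = b ^ Nat.count P n * (f n + 1) := by ring
          _ ≤ _ := Nat.mul_le_mul_left _ hfn
      · intro w hw hPw
        rcases Nat.lt_succ_iff_lt_or_eq.1 hw with hlt | rfl
        · rw [← h2 w hlt hPw, hs]
          have hc : Nat.count P w + 1 ≤ Nat.count P n := by
            rw [← Nat.count_succ_eq_succ_count_iff.2 hPw]
            exact Nat.count_monotone P hlt
          obtain ⟨t, ht⟩ := Nat.exists_eq_add_of_le hc
          have : f n * b ^ Nat.count P n = b ^ Nat.count P w * (b * (f n * b ^ t)) := by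
            rw [ht, pow_add, pow_succ]; ring
          rw [this, Nat.add_mul_div_left _ _ (Nat.pow_pos hb), Nat.add_mul_mod_self_left]
        · rw [hs, Nat.add_mul_div_right _ _ hpos, Nat.div_eq_of_lt h1, zero_add,
            Nat.mod_eq_of_lt hfn]
    · rw [if_neg hP, add_zero] at hs
      rw [hs, Nat.count_succ, if_neg hP, add_zero]
      refine ⟨h1, fun w hw hPw => ?_⟩
      rcases Nat.lt_succ_iff_lt_or_eq.1 hw with hlt | rfl
      · exact h2 w hlt hPw
      · exact absurd hPw hP

open Classical in
/-- The element of `P` below `n` that has exactly `q` predecessors in `P`. -/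
noncomputable def nthBelow (P : ℕ → Prop) (q n : ℕ) : ℕ :=
  ∑ v ∈ Finset.range n, if P v ∧ Nat.count P v = q then v else 0

open Classical in
theorem nthBelow_count {P : ℕ → Prop} {v n : ℕ} (hv : v < n) (hP : P v) :
    nthBelow P (Nat.count P v) n = v := by
  rw [nthBelow, Finset.sum_eq_single v]
  · simp [hP]
  · intro w _ hne
    rw [if_neg]
    rintro ⟨h1, h2⟩
    exact hne (Nat.count_injective h1 hP h2)
  · intro h; simp at h; omega

/-- When no element has rank q the sum is 0, still a legal vertex. Every number therefore decodes to
some view and codes need no validity test. -/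
theorem nthBelow_lt {P : ℕ → Prop} {q n : ℕ} (hn : 1 ≤ n) : nthBelow P q n < n := by
  classical
  by_cases h : ∃ v < n, P v ∧ Nat.count P v = q
  · obtain ⟨v, hv, hP, rfl⟩ := h
    have := nthBelow_count hv hP
    convert hv
  · rw [nthBelow, Finset.sum_eq_zero]
    · exact hn
    · intro v hv
      rw [if_neg]
      rintro ⟨h1, h2⟩
      refine h ⟨v, Finset.mem_range.1 hv, h1, ?_⟩
      convert h2

end LoopLang

/-! ### Dynamic programming along a layering -/

namespace SimpleGraph.IsLayering

variable {n k N : ℕ} {H : SimpleGraph (Fin n)} {pos : Fin n → ℕ}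

/-- The test for a value of `v`: the constraints with earlier vertices hold, and the tables of the
vertices that come next have an entry. -/
def Admits (H : SimpleGraph (Fin n)) (pos : Fin n → ℕ) (un : Fin n → ℕ → Prop)
    (bin : Fin n → ℕ → Fin n → ℕ → Prop) (T : Fin n → (ℕ → ℕ) → ℕ) (v : Fin n) (σ : ℕ → ℕ) :
    Prop :=
  un v (σ v) ∧ (∀ w ∈ H.upper pos v, H.Adj v w → bin v (σ v) w (σ w)) ∧
    ∀ u, v ∈ H.upper pos u → (∀ w ∈ H.upper pos u, w = v ∨ w ∈ H.upper pos v) → T u σ ≠ 0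

variable {un : Fin n → ℕ → Prop} {bin : Fin n → ℕ → Fin n → ℕ → Prop}
  {T : Fin n → (ℕ → ℕ) → ℕ}

/-- Induction from the last layer to the first: the value of the solution at v is admissible because
the entries of its children are already known to be nonzero. -/
theorem table_ne_zero_of_solution
    (hT : ∀ v σ, (∀ w : Fin n, σ w < N) → T v σ = 0 →
      ∀ a < N, ¬ Admits H pos un bin T v (Function.update σ v a))
    {σ : ℕ → ℕ} (hσ : ∀ w : Fin n, σ w < N) (hun : ∀ v, un v (σ v))
    (hbin : ∀ v w, H.Adj v w → bin v (σ v) w (σ w)) (v : Fin n) : T v σ ≠ 0 := by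
  obtain ⟨b, hb⟩ : ∃ b, ∀ v, pos v ≤ b :=
    ⟨Finset.univ.sup pos, fun v => Finset.le_sup (Finset.mem_univ v)⟩
  induction h : b - pos v using Nat.strong_induction_on generalizing v with
  | _ r ih =>
    intro h0
    refine hT v σ hσ h0 (σ v) (hσ v) ?_
    rw [Function.update_eq_self]
    refine ⟨hun v, fun w _ hvw => hbin v w hvw, fun u hu _ => ?_⟩
    have := lt_of_mem hu
    have := hb u
    exact ih (b - pos u) (by omega) u rfl

/-- A nonzero entry at the parent was only recorded after the entries of its children had been found
nonzero. Starting from the roots, this reaches every vertex through `exists_parent`. -/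
theorem table_ne_zero_of_extraction (hl : H.IsLayering k pos)
    (hT : ∀ v σ, T v σ ≠ 0 →
      ∃ a < N, Admits H pos un bin T v (Function.update σ v a) ∧ T v σ = a + 1)
    {σ : ℕ → ℕ} (hroot : ∀ v, H.upper pos v = ∅ → T v σ ≠ 0)
    (hσ : ∀ v : Fin n, σ v = T v σ - 1) (v : Fin n) :
    T v σ ≠ 0 ∧ σ v < N ∧ Admits H pos un bin T v σ := by
  have key : ∀ v, T v σ ≠ 0 → σ v < N ∧ Admits H pos un bin T v σ := by
    intro v hv
    obtain ⟨a, ha, hadm, hTa⟩ := hT v σ hv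
    have : σ v = a := by rw [hσ, hTa]; rfl
    rw [← this, Function.update_eq_self] at hadm
    exact ⟨this ▸ ha, hadm⟩
  suffices h : T v σ ≠ 0 from ⟨h, key v h⟩
  induction h : pos v using Nat.strong_induction_on generalizing v with
  | _ r ih =>
    rcases Set.eq_empty_or_nonempty (H.upper pos v) with he | hne
    · exact hroot v he
    · obtain ⟨u, hu, hsub⟩ := hl.exists_parent hne
      exact (key u (ih _ (h ▸ lt_of_mem hu) u rfl)).2.2.2 v hu hsub

/-- The ends of an edge lie in different layers, so the edge is tested at its later end, whose
`upper` set contains the other one. -/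
theorem bin_of_admits (hl : H.IsLayering k pos) {σ : ℕ → ℕ}
    (hsymm : ∀ v a w b, bin v a w b → bin w b v a)
    (h : ∀ v, Admits H pos un bin T v σ) (v w : Fin n) (hvw : H.Adj v w) :
    bin v (σ v) w (σ w) := by
  rcases lt_or_gt_of_ne (hl.ne_of_adj hvw) with hlt | hlt
  · exact hsymm _ _ _ _ ((h w).2.1 v (mem_upper_of_adj hvw.symm hlt) hvw.symm)
  · exact (h v).2.1 w (mem_upper_of_adj hvw hlt) hvw

end SimpleGraph.IsLayering

namespace LoopLang

open LoopLang.Expr LoopLang.Stmt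

attribute [simp] Expr.holds_read

/-- Row-major index for rows of length `n`, which is variable `0`. -/
def ix (a b : Expr) : Expr := .add (.mul 0 a) b

@[simp] theorem eval_ix (L : ℕ) (a b : Expr) (ρ : Env) (s : Store) :
    (ix a b).eval L ρ s = ρ 0 * a.eval L ρ s + b.eval L ρ s := rfl

theorem ix_div {n y : ℕ} (x : ℕ) (h : y < n) : (n * x + y) / n = x := by
  rw [mul_comm]; exact mul_add_div_of_lt x h

theorem ix_mod {n y : ℕ} (x : ℕ) (h : y < n) : (n * x + y) % n = y := by
  rw [mul_comm]; exact mul_add_mod_of_lt x h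

theorem ix_lt {m n x y : ℕ} (hx : x < m) (hy : y < n) : n * x + y < n * m := by
  rw [mul_comm n x, mul_comm n m]; exact mul_add_lt hx hy

/-! ### Iterated neighbourhoods -/

/-- Reachability in at most `i` steps along `a` through numbers below `n`. -/
def Within (a : ℕ → ℕ → Prop) (n : ℕ) : ℕ → ℕ → ℕ → Prop
  | 0, x, y => x = y
  | i + 1, x, y => Within a n i x y ∨ ∃ z < n, Within a n i x z ∧ a z y

theorem within_iff_walk {n : ℕ} (K : SimpleGraph (Fin n)) {a : ℕ → ℕ → Prop}
    (ha : ∀ x y : Fin n, a x y ↔ K.Adj x y) (i : ℕ) (x y : Fin n) :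
    Within a n i x y ↔ ∃ p : K.Walk x y, p.length ≤ i := by
  induction i generalizing y with
  | zero =>
    simp only [Within, Nat.le_zero]
    constructor
    · intro h
      obtain rfl := Fin.ext h
      exact ⟨.nil, rfl⟩
    · rintro ⟨p, hp⟩
      rw [SimpleGraph.Walk.eq_of_length_eq_zero hp]
  | succ i ih =>
    simp only [Within]
    constructor
    · rintro (h | ⟨z, hz, h1, h2⟩)
      · obtain ⟨p, hp⟩ := (ih y).1 h
        exact ⟨p, by omega⟩
      · obtain ⟨p, hp⟩ := (ih ⟨z, hz⟩).1 h1
        exact ⟨p.concat ((ha ⟨z, hz⟩ y).1 h2), by simp; omega⟩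
    · rintro ⟨p, hp⟩
      rcases Nat.lt_or_ge i p.length with h | h
      · right
        cases p with
        | nil => simp at h
        | cons h' p =>
          obtain ⟨z, q, hzy, e⟩ := SimpleGraph.Walk.exists_cons_eq_concat h' p
          rw [e, SimpleGraph.Walk.length_concat] at hp
          exact ⟨z, z.2, (ih z).2 ⟨q, by omega⟩, (ha z y).2 hzy⟩
      · exact .inl ((ih y).2 ⟨p, h⟩)

theorem within_iff_dist {n : ℕ} {K : SimpleGraph (Fin n)} (hK : K.Connected) {a : ℕ → ℕ → Prop}
    (ha : ∀ x y : Fin n, a x y ↔ K.Adj x y) (i : ℕ) (x y : Fin n) :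
    Within a n i x y ↔ K.dist x y ≤ i := by
  rw [within_iff_walk K ha]
  constructor
  · rintro ⟨p, hp⟩
    exact (SimpleGraph.dist_le p).trans hp
  · intro h
    obtain ⟨p, hp⟩ := hK.exists_walk_length_eq_dist x y
    exact ⟨p, hp.trans_le h⟩

/-- A path has fewer than n edges, so n steps exhaust the component. -/
theorem within_iff_reachable {n : ℕ} (K : SimpleGraph (Fin n)) {a : ℕ → ℕ → Prop}
    (ha : ∀ x y : Fin n, a x y ↔ K.Adj x y) (x y : Fin n) :
    Within a n n x y ↔ K.Reachable x y := by
  classical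
  rw [within_iff_walk K ha]
  constructor
  · rintro ⟨p, -⟩
    exact ⟨p⟩
  · rintro ⟨p⟩
    exact ⟨p.toPath, by simpa using p.toPath.2.length_lt.le⟩

/-- Computes the neighbourhoods of radius up to variable `r` for the adjacency matrix `A`. -/
def levels (A B : Fin 32) (r : ℕ) : Stmt :=
  .seq (.loop 20 0 (.loop 21 0 (.write B (ix (var 20) (var 21)) (Expr.eq (var 20) (var 21)).bit)))
  (.loop 22 r (.loop 20 0 (.loop 21 0 (.write B
    (ix (ix (add (var 22) (lit 1)) (var 20)) (var 21))
    (Expr.or (read B (ix (ix (var 22) (var 20)) (var 21)))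
      (Expr.ex 23 0 (Expr.and (read B (ix (ix (var 22) (var 20)) (var 23)))
        (read A (ix (var 23) (var 21)))))).bit))))

theorem levels_frame {L : ℕ} {A B C : Fin 32} (hC : C ≠ B) (r : ℕ) (ρ : Env) (s : Store) :
    (levels A B r).run L ρ s C = s C :=
  run_of_not_writes _ _ _ (by simp [levels, writes, hC.symm])

theorem levels_spec {L : ℕ} {A B : Fin 32} {r : ℕ} {ρ : Env} {s : Store} (hA : A ≠ 0)
    (hB : B ≠ 0) (hAB : A ≠ B) :
    ∀ i ≤ ρ r, ∀ x < ρ 0, ∀ y < ρ 0,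
      ((levels A B r).run L ρ s B (ρ 0 * (ρ 0 * i + x) + y) ≠ 0 ↔
        Within (fun z y => s A (ρ 0 * z + y) ≠ 0) (ρ 0) i x y) := by
  classical
  set n := ρ 0 with hn
  set a := fun z y => s A (n * z + y) ≠ 0 with ha
  unfold levels
  rw [run_seq, run_loop 22]
  refine (iter_induction (n := ρ r) (fun m (s' : Store) => s' A = s A ∧
    ∀ i ≤ m, ∀ x < n, ∀ y < n, (s' B (n * (n * i + x) + y) ≠ 0 ↔ Within a n i x y)) ?_ ?_).2
  · refine ⟨run_of_not_writes _ _ _ (by simp [writes, hAB.symm]), ?_⟩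
    intro i hi x hx y hy
    obtain rfl := Nat.le_zero.1 hi
    have := (run_fill₂ (L := L) (ρ := ρ) hB (s := s) (D := ∅) (x := 20) (v := 0) (y := 21) (w := 0)
      (ie := ix (var 20) (var 21)) (e := (Expr.eq (var 20) (var 21)).bit)
      (V := fun k => if k / n = k % n then 1 else 0)
      (fun i j => n * i + j) (by decide) (by simp) (by
        intro s' _ _ i hi j hj
        rw [← hn] at hi hj
        simp [← hn, ix_div _ hj, ix_mod _ hj])).1 x hx y hy
    rw [mul_zero, zero_add, this, ix_div _ hy, ix_mod _ hy]
    simp [Within]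
  · rintro m hm s' ⟨h1, h2⟩
    refine ⟨(run_of_not_writes _ _ _ (by simp [writes, hAB.symm])).trans h1, ?_⟩
    -- The protected set D consists of the levels up to m, which the computation of level m + 1
    -- reads and does not touch.
    obtain ⟨f1, f2⟩ := run_fill₂ (L := L) (ρ := Env.set ρ 22 m) hB (s := s')
      (D := {k | k < n * (n * (m + 1))}) (x := 20) (v := 0) (y := 21) (w := 0)
      (ie := ix (ix (add (var 22) (lit 1)) (var 20)) (var 21))
      (e := (Expr.or (read B (ix (ix (var 22) (var 20)) (var 21)))
        (Expr.ex 23 0 (Expr.and (read B (ix (ix (var 22) (var 20)) (var 23)))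
        (read A (ix (var 23) (var 21)))))).bit)
      (V := fun k => if Within a n (m + 1) (k / n % n) (k % n) then 1 else 0)
      (fun i j => n * (n * (m + 1) + i) + j) (by decide)
      (by intro i _ j _; simp only [Set.mem_ofPred_eq, not_lt, mul_add]; omega) (by
        intro s'' g1 g2 i hi j hj
        simp [← hn] at hi hj
        have hlev : ∀ z < n, s'' B (n * (n * m + i) + z) = s' B (n * (n * m + i) + z) := by
          intro z hz
          refine g2 _ ?_
          exact ix_lt (ix_lt (by omega) hi) hz
        have hA' : s'' A = s A := (g1 A hAB).trans h1
        simp only [eval_ix, eval_add, eval_var, eval_lit, Env.set_apply, eval_bit, holds_or,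
          holds_read _ hB, holds_ex, holds_and, holds_read _ hA, hA', ix_div _ hj, ix_mod _ hj,
          ix_mod _ hi, Nat.reduceEqDiff, if_true, if_false, Within]
        refine ⟨rfl, if_congr ?_ rfl rfl⟩
        simp [← hn]
        rw [← Ne, hlev j hj, h2 m le_rfl i hi j hj]
        refine or_congr Iff.rfl (exists_congr fun z => and_congr_right fun hz => ?_)
        rw [← Ne, hlev z hz, h2 m le_rfl i hi z hz])
    intro i hi x hx y hy
    rcases Nat.lt_succ_iff_lt_or_eq.1 (Nat.lt_succ_of_le hi) with hlt | rfl
    · rw [f2, h2 i (by omega) x hx y hy]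
      intro i' _ j' _ e
      have : n * (n * i + x) + y < n * (n * (m + 1)) := ix_lt (ix_lt hlt hx) hy
      rw [e, mul_add] at this
      omega
    · rw [f1 x (by simpa using hx) y (by simpa using hy)]
      simp [ix_div _ hy, ix_mod _ hy, ix_mod _ hx]

/-! ### Digits -/

/-- Stores the powers of variable `b` up to exponent variable `l` in array `A`. -/
def powers (A : Fin 32) (b l : ℕ) : Stmt :=
  .seq (.write A (lit 0) (lit 1))
    (.loop 20 l (.write A (add (var 20) (lit 1)) (mul b (read A (var 20)))))

theorem powers_spec {L : ℕ} {A : Fin 32} (hA : A ≠ 0) {b l : ℕ} (hb : b ≠ 20) (ρ : Env)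
    (s : Store) : ∀ p ≤ ρ l, (powers A b l).run L ρ s A p = ρ b ^ p := by
  unfold powers
  rw [run_seq, run_loop]
  refine iter_induction (n := ρ l) (fun m (s' : Store) => ∀ p ≤ m, s' A p = ρ b ^ p) ?_ ?_
  · intro p hp
    obtain rfl := Nat.le_zero.1 hp
    simp [run_write hA]
  · intro m hm s' h p hp
    rw [run_write hA]
    simp only [eval_add, eval_var, eval_lit, eval_mul, eval_read, hA, Env.set_apply, if_true,
      false_and, if_false, hb, Store.put_apply, true_and, h m le_rfl]
    split
    case isTrue e => rw [e, pow_succ, mul_comm]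
    case isFalse e => exact h p (by omega)

/-- Quotients and remainders modulo variable `b` of the numbers up to variable `m`. -/
def quotients (b m : ℕ) : Stmt :=
  .seq (.write 21 (lit 0) (lit 0)) <| .seq (.write 22 (lit 0) (lit 0)) <|
  .loop 20 m (.ite (Expr.eq (add (read 22 (var 20)) (lit 1)) (var b))
    (.seq (.write 21 (add (var 20) (lit 1)) (add (read 21 (var 20)) (lit 1)))
      (.write 22 (add (var 20) (lit 1)) (lit 0)))
    (.seq (.write 21 (add (var 20) (lit 1)) (read 21 (var 20)))
      (.write 22 (add (var 20) (lit 1)) (add (read 22 (var 20)) (lit 1)))))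

/-- The machine has no division. This recurrence tabulates quotients and remainders by counting up.
-/
theorem succ_div_mod {b j : ℕ} (hb : 1 ≤ b) :
    (j + 1) / b = (if j % b + 1 = b then j / b + 1 else j / b) ∧
      (j + 1) % b = if j % b + 1 = b then 0 else j % b + 1 := by
  have h := Nat.div_add_mod j b
  have hlt := Nat.mod_lt j hb
  split
  case isTrue e =>
    have : j + 1 = b * (j / b + 1) := by rw [mul_add, mul_one]; omega
    rw [this]
    exact ⟨Nat.mul_div_cancel_left _ hb, Nat.mul_mod_right _ _⟩
  case isFalse e =>
    have : j + 1 = b * (j / b) + (j % b + 1) := by omega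
    have hlt' : j % b + 1 < b := by omega
    constructor
    · conv_lhs => rw [this]
      exact ix_div _ hlt'
    · conv_lhs => rw [this]
      exact ix_mod _ hlt'

theorem quotients_spec {L : ℕ} {b m : ℕ} (hb : b ≠ 20) (ρ : Env) (hρ : 1 ≤ ρ b) (s : Store) :
    ∀ j ≤ ρ m, (quotients b m).run L ρ s 21 j = j / ρ b ∧
      (quotients b m).run L ρ s 22 j = j % ρ b := by
  unfold quotients
  rw [run_seq, run_seq, run_loop]
  refine iter_induction (n := ρ m) (fun m (s' : Store) => ∀ j ≤ m, s' 21 j = j / ρ b ∧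
    s' 22 j = j % ρ b) ?_ ?_
  · intro p hp
    obtain rfl := Nat.le_zero.1 hp
    simp [run_write]
  · intro m hm s' h p hp
    obtain ⟨h1, h2⟩ := h m le_rfl
    obtain ⟨d1, d2⟩ := succ_div_mod (j := m) hρ
    rcases Nat.lt_succ_iff_lt_or_eq.1 (Nat.lt_succ_of_le hp) with hlt | rfl
    · have := h p (by omega)
      have hne : p ≠ m + 1 := by omega
      simp only [run_ite]
      split <;> simp [run_write, hne, this]
    · rw [d1, d2]
      simp only [run_ite]
      simp [run_write, h1, h2, hb]
      split <;> simp

/-- Iterated quotients: entry `p * m + j` is `j / b ^ p`. -/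
def iterQuotients (l m : ℕ) : Stmt :=
  .seq (.loop 20 m (.write 23 (var 20) (var 20)))
    (.loop 21 l (.loop 20 m (.write 23 (add (add (mul 21 (var m)) (var m)) (var 20))
      (read 21 (read 23 (add (mul 21 (var m)) (var 20)))))))

theorem iterQuotients_spec {L : ℕ} {l m b : ℕ} (hm : m ≠ 20 ∧ m ≠ 21) (ρ : Env) (s : Store)
    (hq : ∀ j ≤ ρ m, s 21 j = j / b) :
    ∀ p ≤ ρ l, ∀ j < ρ m, (iterQuotients l m).run L ρ s 23 (p * ρ m + j) = j / b ^ p := by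
  unfold iterQuotients
  rw [run_seq, run_loop 21]
  set M := ρ m with hM
  refine (iter_induction (n := ρ l) (fun q (s' : Store) => s' 21 = s 21 ∧
    ∀ p ≤ q, ∀ j < M, s' 23 (p * M + j) = j / b ^ p) ?_ ?_).2
  · refine ⟨run_of_not_writes _ _ _ rfl, ?_⟩
    intro p hp j hj
    obtain rfl := Nat.le_zero.1 hp
    have := (run_fill (L := L) (ρ := ρ) (A := 23) (by decide) (s := s) (D := ∅) (x := 20) (v := m)
      (ie := var 20) (e := var 20) (V := fun k => k) (fun i => i) (by simp)
      (by simp)).1 j hj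
    simpa using this
  · rintro q hq' s' ⟨h1, h2⟩
    refine ⟨(run_of_not_writes _ _ _ rfl).trans h1, ?_⟩
    obtain ⟨f1, f2⟩ := run_fill (L := L) (ρ := Env.set ρ 21 q) (A := 23) (by decide) (s := s')
      (D := {k | k < (q + 1) * M}) (x := 20) (v := m)
      (ie := add (add (mul 21 (var m)) (var m)) (var 20))
      (e := read 21 (read 23 (add (mul 21 (var m)) (var 20))))
      (V := fun k => k % M / b ^ (k / M)) (fun j => (q + 1) * M + j)
      (by intro i _; simp) (by
        intro s'' g1 g2 j hj
        simp [hm.2, ← hM] at hj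
        have e1 : s'' 23 (q * M + j) = j / b ^ q := by
          rw [g2 _ (mul_add_lt (Nat.lt_succ_self q) hj), h2 q le_rfl j hj]
        have e2 : s'' 21 = s 21 := (g1 21 (by decide)).trans h1
        simp [hm.1, hm.2, ← hM, e1, e2, mul_add_div_of_lt _ hj, mul_add_mod_of_lt _ hj]
        refine ⟨by ring, ?_⟩
        -- The iterated quotient is at most j, hence still inside the table of quotients.
        rw [hq _ ((Nat.div_le_self _ _).trans hj.le), Nat.div_div_eq_div_mul, pow_succ])
    intro p hp j hj
    rcases Nat.lt_succ_iff_lt_or_eq.1 (Nat.lt_succ_of_le hp) with hlt | rfl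
    · rw [f2, h2 p (by omega) j hj]
      intro i' _ e
      have : p * M + j < (q + 1) * M := mul_add_lt hlt hj
      omega
    · rw [f1 j (by simpa [hm.2] using hj)]
      simp [mul_add_div_of_lt _ hj, mul_add_mod_of_lt _ hj]

/-- Tables for the `l` digits in base `b` of the numbers below `m`. -/
def digits (b l m : ℕ) : Stmt := .seq (quotients b m) (iterQuotients l m)

/-- The digit of number `j` at position `p`, where `pm` is `p` times the range of the numbers. -/
def digit (pm j : Expr) : Expr := read 22 (read 23 (add pm j))

@[simp] theorem eval_digit (L : ℕ) (pm j : Expr) (ρ : Env) (s : Store) :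
    (digit pm j).eval L ρ s = s 22 (s 23 (pm.eval L ρ s + j.eval L ρ s)) := by
  simp [digit]

/-- The digit tables for base `b`, length `l` and range `m` are in place. -/
def HasDigits (s : Store) (b l m : ℕ) : Prop :=
  ∀ p ≤ l, ∀ j < m, s 22 (s 23 (p * m + j)) = j / b ^ p % b

theorem digits_spec {L : ℕ} {b l m : ℕ} (hb : b ≠ 20) (hm : m ≠ 20 ∧ m ≠ 21) (ρ : Env)
    (hρ : 1 ≤ ρ b) (s : Store) : HasDigits ((digits b l m).run L ρ s) (ρ b) (ρ l) (ρ m) := by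
  intro p hp j hj
  unfold digits
  have hq := quotients_spec (L := L) (m := m) hb ρ hρ s
  rw [run_seq, iterQuotients_spec hm ρ _ (fun j hj => (hq j hj).1) p hp j hj,
    run_of_not_writes (A := 22) (iterQuotients l m) ρ _ rfl]
  exact (hq _ ((Nat.div_le_self _ _).trans hj.le)).2

end LoopLang

namespace LoopLang

open LoopLang.Expr LoopLang.Stmt SimpleGraph

/-! ### Components and their keys -/

variable {n : ℕ} {H : SimpleGraph (Fin n)} {L : ℕ}

open Classical in
/-- The number with the binary digits of `C`. -/
noncomputable def key (C : Set (Fin n)) : ℕ := ∑ z : Fin n, if z ∈ C then 2 ^ (z : ℕ) else 0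

/-- Keys serve as addresses, so an array becomes a dictionary indexed by vertex sets. Addresses may
be as large as 2 ^ n, yet an access is one step of the machine. -/
theorem key_injective : Function.Injective (key : Set (Fin n) → ℕ) := by
  classical
  intro C D h
  have e : ∀ C : Set (Fin n), key C =
      ∑ i ∈ ({z : Fin n | z ∈ C} : Finset (Fin n)).map Fin.valEmbedding, 2 ^ i := by
    intro C
    rw [Finset.sum_map, Finset.sum_filter]
    rfl
  rw [e, e] at h
  have := Finset.map_injective _ (Finset.geomSum_injective le_rfl h)
  ext z
  have hz := Finset.ext_iff.1 this z
  simpa using hz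

/-- Array `2` is the adjacency matrix of `H`, and array `3` has the powers of two. -/
structure Ctx (H : SimpleGraph (Fin n)) (s : Store) : Prop where
  adj : ∀ x y : Fin n, s 2 (n * x + y) ≠ 0 ↔ H.Adj x y
  pow : ∀ z < n, s 3 z = 2 ^ z

theorem Ctx.congr {s s' : Store} (h : Ctx H s) (h2 : s' 2 = s 2) (h3 : s' 3 = s 3) : Ctx H s' :=
  ⟨by rw [h2]; exact h.adj, by rw [h3]; exact h.pow⟩

theorem Ctx.run {s : Store} (h : Ctx H s) (p : Stmt) (ρ : Env) (h2 : p.writes 2 = false)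
    (h3 : p.writes 3 = false) : Ctx H (p.run L ρ s) :=
  h.congr (run_of_not_writes _ _ _ h2) (run_of_not_writes _ _ _ h3)

/-- Array `B` is the table of the components of the subgraph induced on `U`. -/
def HasComps (H : SimpleGraph (Fin n)) (s : Store) (B : Fin 32) (U : Set (Fin n)) : Prop :=
  ∀ x y : Fin n, s B (n * (n * n + x) + y) ≠ 0 ↔ y ∈ H.compIn U x

/-- Computes the components of the subgraph induced on the set given by the condition `c` for
variable `20` and by the condition `d` for variable `21`. -/
def comps (A B : Fin 32) (c d : Expr) : Stmt :=
  .seq (.loop 20 0 (.loop 21 0 (.write A (ix (var 20) (var 21))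
    (Expr.and (read 2 (ix (var 20) (var 21))) (Expr.and c d)).bit)))
  (levels A B 0)

theorem comps_frame {A B C : Fin 32} (hA : C ≠ A) (hB : C ≠ B) (c d : Expr) (ρ : Env)
    (s : Store) : (comps A B c d).run L ρ s C = s C :=
  run_of_not_writes _ _ _ (by simp [comps, levels, writes, hA.symm, hB.symm])

theorem comps_spec {A B : Fin 32} (hA : A ≠ 0) (hA2 : A ≠ 2) (hB : B ≠ 0) (hAB : A ≠ B)
    {c d : Expr} {ρ : Env} (hρ : ρ 0 = n) {s : Store} (hs : Ctx H s) (U : Set (Fin n))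
    (hc : ∀ s' : Store, (∀ C ≠ A, s' C = s C) → ∀ i j : Fin n,
      (c.Holds L (Env.set (Env.set ρ 20 i) 21 j) s' ↔ i ∈ U) ∧
      (d.Holds L (Env.set (Env.set ρ 20 i) 21 j) s' ↔ j ∈ U)) :
    HasComps H ((comps A B c d).run L ρ s) B U := by
  classical
  intro x y
  unfold comps
  rw [run_seq]
  set s₁ := (Stmt.loop 20 0 (.loop 21 0 (.write A (ix (var 20) (var 21))
    (Expr.and (read 2 (ix (var 20) (var 21))) (Expr.and c d)).bit))).run L ρ s with hs₁
  have h1 : ∀ i j : Fin n, s₁ A (n * i + j) ≠ 0 ↔ (H.within U).Adj i j := by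
    intro i j
    have := (run_fill₂ (L := L) (ρ := ρ) hA (s := s) (D := ∅) (x := 20) (v := 0) (y := 21) (w := 0)
      (ie := ix (var 20) (var 21))
      (e := (Expr.and (read 2 (ix (var 20) (var 21))) (Expr.and c d)).bit)
      (V := fun k => if ∃ i j : Fin n, k = n * i + j ∧ (H.within U).Adj i j then 1 else 0)
      (fun i j => n * i + j) (by decide) (by simp) (by
        intro s' hs' _ i hi j hj
        rw [hρ] at hi hj
        obtain ⟨c1, c2⟩ := hc s' hs' ⟨i, hi⟩ ⟨j, hj⟩
        have c3 := hs.adj ⟨i, hi⟩ ⟨j, hj⟩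
        rw [← hs' 2 hA2.symm] at c3
        refine ⟨by simp [hρ], ?_⟩
        rw [eval_bit]
        refine if_congr ?_ rfl rfl
        rw [holds_and, holds_and, holds_read _ (by decide), c1, c2]
        simp only [eval_ix, eval_var, Env.set_apply, Nat.reduceEqDiff, if_true, if_false,
          OfNat.zero_ne_ofNat, hρ]
        rw [c3]
        constructor
        · rintro ⟨a1, a2, a3⟩
          exact ⟨⟨i, hi⟩, ⟨j, hj⟩, rfl, a1, a2, a3⟩
        · rintro ⟨i', j', e, a1, a2, a3⟩
          have e1 : (i' : ℕ) = i := by rw [← ix_div (i' : ℕ) j'.2, ← e, ix_div _ hj]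
          have e2 : (j' : ℕ) = j := by rw [← ix_mod (i' : ℕ) j'.2, ← e, ix_mod _ hj]
          subst e1 e2
          exact ⟨a1, a2, a3⟩)).1 i (by rw [hρ]; exact i.2) j (by rw [hρ]; exact j.2)
    rw [← hs₁] at this
    rw [this]
    constructor
    · intro h
      simp only [ne_eq, ite_eq_right_iff, one_ne_zero, imp_false, not_not] at h
      obtain ⟨i', j', e, h⟩ := h
      have e1 : i' = i := Fin.ext (by rw [← ix_div (i' : ℕ) j'.2, ← e, ix_div _ j.2])
      have e2 : j' = j := Fin.ext (by rw [← ix_mod (i' : ℕ) j'.2, ← e, ix_mod _ j.2])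
      subst e1 e2
      exact h
    · intro h
      rw [if_pos ⟨i, j, rfl, h⟩]
      decide
  have := levels_spec (L := L) (r := 0) (ρ := ρ) (s := s₁) hA hB hAB n hρ.ge x
    (by rw [hρ]; exact x.2) y (by rw [hρ]; exact y.2)
  rw [hρ] at this
  rw [this, within_iff_reachable (H.within U) h1]
  rfl

theorem sum_eq_key {C : Set (Fin n)} {f : ℕ → ℕ} (h : ∀ z : Fin n, z ∈ C → f z = 2 ^ (z : ℕ))
    (h' : ∀ z : Fin n, z ∉ C → f z = 0) : ∑ z ∈ Finset.range n, f z = key C := by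
  classical
  rw [Finset.sum_range, key]
  refine Finset.sum_congr rfl fun z _ => ?_
  split
  · exact h z ‹_›
  · exact h' z ‹_›

/-- The key of the component of `x`, for the component table `B`. -/
def rowKey (B : Fin 32) (x : Expr) : Expr :=
  .sum 21 0 (.ite (read B (ix (ix (var 0) x) (var 21))) (read 3 (var 21)) (lit 0))

theorem eval_rowKey {B : Fin 32} (hB : B ≠ 0) {x : Expr} {ρ : Env} (hρ : ρ 0 = n) {s : Store}
    (hs : Ctx H s) {U : Set (Fin n)} (hU : HasComps H s B U) (v : Fin n)
    (hx : ∀ i, x.eval L (Env.set ρ 21 i) s = v) :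
    (rowKey B x).eval L ρ s = key (H.compIn U v) := by
  classical
  rw [rowKey, eval_sum, hρ]
  refine sum_eq_key (fun z hz => ?_) (fun z hz => ?_)
  · have := (hU v z).2 hz
    simp [hρ, hx, hB, this, hs.pow z z.2]
  · have := mt (hU v z).1 hz
    rw [not_not] at this
    simp [hρ, hx, hB, this]

theorem ncard_eq_sum (C : Set (Fin n)) {f : ℕ → ℕ} (h : ∀ z : Fin n, z ∈ C → f z = 1)
    (h' : ∀ z : Fin n, z ∉ C → f z = 0) : ∑ z ∈ Finset.range n, f z = C.ncard := by
  classical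
  rw [Finset.sum_range, Set.ncard_eq_toFinset_card', Set.toFinset_card, Fintype.card_subtype,
    Finset.card_filter]
  refine Finset.sum_congr rfl fun z _ => ?_
  split
  · exact h z ‹_›
  · exact h' z ‹_›

/-! ### The table of choices -/

/-- Entry `key C` of array `9` is zero or one more than a vertex that splits `C`. -/
def Sound (H : SimpleGraph (Fin n)) (k : ℕ) (s : Store) : Prop :=
  ∀ C : Set (Fin n), s 9 (key C) ≠ 0 → ∃ v : Fin n, s 9 (key C) = v + 1 ∧ v ∈ C ∧
    (H.border C).ncard ≤ k ∧ ∀ y ∈ C, y ≠ v → s 9 (key (H.compIn (C \ {v}) y)) ≠ 0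

theorem Sound.isSplitting {k : ℕ} {s : Store} (h : Sound H k s) :
    H.IsSplitting k fun C v => s 9 (key C) = (v : ℕ) + 1 := by
  refine ⟨fun C u v hu hv => Fin.ext (by omega), fun C v hv => ?_⟩
  obtain ⟨v', h1, h2, h3, h4⟩ := h C (by omega)
  obtain rfl : v' = v := Fin.ext (by omega)
  refine ⟨h2, h3, fun y hy hyv => ?_⟩
  obtain ⟨w, hw, -⟩ := h _ (h4 y hy hyv)
  exact ⟨w, hw⟩

/-- Choices found during an unsuccessful search stay valid for larger k and need not be erased. -/
theorem Sound.mono {k k' : ℕ} {s : Store} (h : Sound H k s) (hk : k ≤ k') : Sound H k' s := by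
  intro C hC
  obtain ⟨v, h1, h2, h3, h4⟩ := h C hC
  exact ⟨v, h1, h2, h3.trans hk, h4⟩

theorem Sound.congr {k : ℕ} {s s' : Store} (h : Sound H k s) (h9 : s' 9 = s 9) :
    Sound H k s' := by
  unfold Sound; rw [h9]; exact h

/-- The vertex `v` splits `C` into components with choices. -/
def Splits (H : SimpleGraph (Fin n)) (s : Store) (C : Set (Fin n)) (v : Fin n) : Prop :=
  v ∈ C ∧ ∀ y ∈ C, y ≠ v → s 9 (key (H.compIn (C \ {v}) y)) ≠ 0

/-- Choices are only added. -/
def Grows (s s' : Store) : Prop := ∀ i, s 9 i ≠ 0 → s' 9 i ≠ 0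

theorem Splits.grows {s s' : Store} (h : Grows s s') {C : Set (Fin n)} {v : Fin n}
    (hs : Splits H s C v) : Splits H s' C v :=
  ⟨hs.1, fun y hy hyv => h _ (hs.2 y hy hyv)⟩

theorem Grows.trans {s s' s'' : Store} (h : Grows s s') (h' : Grows s' s'') : Grows s s'' :=
  fun i hi => h' i (h i hi)

/-- Array `6` is the characteristic function of `C`. -/
def HasSet (s : Store) (C : Set (Fin n)) : Prop := ∀ z : Fin n, s 6 z ≠ 0 ↔ z ∈ C

/-- The condition that `x` is in the set of array `6` but is not variable `28`. -/
def others (x : ℕ) : Expr := Expr.and (read 6 (var x)) (Expr.eq (var x) (var 28)).not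

/-- Chooses variable `28` for the set of array `6` if the components it leaves have choices. -/
def tryVertex : Stmt :=
  .ite (read 6 (var 28))
    (.seq (comps 7 8 (others 20) (others 21))
      (.ite (Expr.all 20 0 (Expr.or (others 20).not (read 9 (rowKey 8 (var 20)))))
        (.write 9 (.sum 21 0 (.ite (read 6 (var 21)) (read 3 (var 21)) (lit 0)))
          (add (var 28) (lit 1)))
        .skip))
    .skip

/-- An entry is written only when the entries it relies on are nonzero. Overwriting an older choice
is harmless, because other entries only need this one to be nonzero, not to name a particular
vertex. -/
theorem tryVertex_spec {k : ℕ} {ρ : Env} (hρ : ρ 0 = n) {s : Store} (hs : Ctx H s)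
    (hS : Sound H k s) {C : Set (Fin n)} (hC : HasSet s C) (hk : (H.border C).ncard ≤ k)
    (v : Fin n) (hv : ρ 28 = v) :
    let s' := tryVertex.run L ρ s
    Sound H k s' ∧ Grows s s' ∧ (Splits H s C v → s' 9 (key C) ≠ 0) := by
  classical
  intro s'
  by_cases hvC : v ∈ C
  swap
  · have : s' = s := by
      have h6 : ¬ s 6 v ≠ 0 := mt (hC v).1 hvC
      simp only [s', tryVertex, run_ite, holds_read _ (show (6 : Fin 32) ≠ 0 by decide), eval_var,
        hv, h6, if_false, run_skip]
    rw [this]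
    exact ⟨hS, fun _ h => h, fun h => absurd h.1 hvC⟩
  have h6 : s 6 v ≠ 0 := (hC v).2 hvC
  have e1 : s' = (Stmt.seq (comps 7 8 (others 20) (others 21))
      (.ite (Expr.all 20 0 (Expr.or (others 20).not (read 9 (rowKey 8 (var 20)))))
        (.write 9 (.sum 21 0 (.ite (read 6 (var 21)) (read 3 (var 21)) (lit 0)))
          (add (var 28) (lit 1)))
        .skip)).run L ρ s := by
    simp only [s', tryVertex, run_ite, holds_read _ (show (6 : Fin 32) ≠ 0 by decide), eval_var,
      hv, h6, ne_eq, not_false_eq_true, if_true]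
  rw [run_seq] at e1
  set s₁ := (comps 7 8 (others 20) (others 21)).run L ρ s with hs₁
  have f : ∀ A : Fin 32, A ≠ 7 → A ≠ 8 → s₁ A = s A := fun A h7 h8 =>
    comps_frame h7 h8 _ _ _ _
  have hc1 : Ctx H s₁ := hs.congr (f 2 (by decide) (by decide)) (f 3 (by decide) (by decide))
  have hcomp : HasComps H s₁ 8 (C \ {v}) := by
    refine comps_spec (by decide) (by decide) (by decide) (by decide) hρ hs _ ?_
    intro s'' hs'' i j
    have h6' := hs'' 6 (by decide)
    simp [others, hv, h6', Fin.ext_iff, ← hC i, ← hC j]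
  have hcond : (Expr.all 20 0 (Expr.or (others 20).not (read 9 (rowKey 8 (var 20))))).Holds L ρ s₁
      ↔ ∀ y ∈ C, y ≠ v → s 9 (key (H.compIn (C \ {v}) y)) ≠ 0 := by
    have h6' := f 6 (by decide) (by decide)
    have h9' := f 9 (by decide) (by decide)
    rw [holds_all, hρ]
    constructor
    · intro h y hy hyv
      have h := h y y.2
      rw [holds_or, holds_read _ (by decide), eval_rowKey (by decide) (by simp [hρ]) hc1 hcomp y
        (by simp), h9'] at h
      refine h.resolve_left ?_
      simp [others, h6', hv, (hC y).2 hy, Fin.val_inj, hyv]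
    · intro h y hy
      rw [holds_or, holds_read _ (by decide), eval_rowKey (by decide) (by simp [hρ]) hc1 hcomp
        ⟨y, hy⟩ (by simp), h9']
      by_cases hyC : (⟨y, hy⟩ : Fin n) ∈ C ∧ (⟨y, hy⟩ : Fin n) ≠ v
      · exact .inr (h _ hyC.1 hyC.2)
      · left
        have h1 := hC ⟨y, hy⟩
        rw [← h1] at hyC
        simpa [others, h6', hv, Fin.ext_iff] using hyC
  rw [run_ite] at e1
  by_cases hsp : ∀ y ∈ C, y ≠ v → s 9 (key (H.compIn (C \ {v}) y)) ≠ 0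
  swap
  · rw [if_neg (mt hcond.1 hsp), run_skip] at e1
    have h9 : s' 9 = s 9 := by rw [e1]; exact f 9 (by decide) (by decide)
    exact ⟨hS.congr h9, fun i hi => by rwa [h9], fun h => absurd h.2 hsp⟩
  · rw [if_pos (hcond.2 hsp), run_write (by decide)] at e1
    have hkey : (Expr.sum 21 0 (.ite (read 6 (var 21)) (read 3 (var 21)) (lit 0))).eval L ρ s₁ =
        key C := by
      rw [eval_sum, hρ]
      refine sum_eq_key (fun z hz => ?_) (fun z hz => ?_)
      · simp [f 6, (hC z).2 hz, hc1.pow z z.2]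
      · have := mt (hC z).1 hz
        rw [not_not] at this
        simp [f 6, this]
    have h9 : ∀ i, s' 9 i = if i = key C then (v : ℕ) + 1 else s 9 i := by
      intro i
      rw [e1, hkey]
      simp [hv, f 9]
    have hg : Grows s s' := by
      intro i hi
      rw [h9]; split <;> simp [hi]
    refine ⟨?_, hg, fun _ => by simp [h9]⟩
    intro D hD
    by_cases hDC : D = C
    · subst hDC
      exact ⟨v, by simp [h9], hvC, hk, fun y hy hyv => hg _ (hsp y hy hyv)⟩
    · have hne : key D ≠ key C := fun e => hDC (key_injective e)
      rw [h9, if_neg hne] at hD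
      obtain ⟨w, a1, a2, a3, a4⟩ := hS D hD
      exact ⟨w, by rw [h9, if_neg hne, a1], a2, a3, fun y hy hyw => hg _ (a4 y hy hyw)⟩

/-- Tries all vertices of the component of variable `27`, for the component table `5`. -/
def tryComp : Stmt :=
  .seq (.loop 20 0 (.write 6 (var 20) (read 5 (ix (ix (var 0) (var 27)) (var 20)))))
    (.ite (Expr.le (.sum 20 0 (Expr.and (read 6 (var 20)).not
      (Expr.ex 21 0 (Expr.and (read 6 (var 21)) (read 2 (ix (var 21) (var 20)))))).bit) (var 2))
      (.loop 28 0 tryVertex) .skip)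

theorem tryComp_spec {ρ : Env} (hρ : ρ 0 = n) {s : Store} (hs : Ctx H s)
    (hS : Sound H (ρ 2) s) {U : Set (Fin n)} (hU : HasComps H s 5 U) (x : Fin n)
    (hx : ρ 27 = x) :
    let s' := tryComp.run L ρ s
    Sound H (ρ 2) s' ∧ Grows s s' ∧ ((H.border (H.compIn U x)).ncard ≤ ρ 2 →
      ∀ v, Splits H s (H.compIn U x) v → s' 9 (key (H.compIn U x)) ≠ 0) := by
  classical
  intro s'
  set s₁ := (Stmt.loop 20 0 (.write 6 (var 20) (read 5 (ix (ix (var 0) (var 27)) (var 20))))).run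
    L ρ s with hs₁
  have f : ∀ A : Fin 32, A ≠ 6 → s₁ A = s A := fun A h6 =>
    run_of_not_writes _ _ _ (by simp [writes, h6.symm])
  have hc1 : Ctx H s₁ := hs.congr (f 2 (by decide)) (f 3 (by decide))
  have hS1 : Sound H (ρ 2) s₁ := hS.congr (f 9 (by decide))
  have hset : HasSet s₁ (H.compIn U x) := by
    intro z
    have := (run_fill (L := L) (ρ := ρ) (A := 6) (by decide) (s := s) (D := ∅) (x := 20) (v := 0)
      (ie := var 20) (e := read 5 (ix (ix (var 0) (var 27)) (var 20)))
      (V := fun z => s 5 (n * (n * n + x) + z)) (fun i => i) (by simp) (by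
        intro s' hs' _ i _
        simp [hρ, hx, hs'])).1 z (by rw [hρ]; exact z.2)
    rw [← hs₁] at this
    rw [this]
    exact hU x z
  set C := H.compIn U x with hC
  have hcard : (Expr.sum 20 0 (Expr.and (read 6 (var 20)).not
      (Expr.ex 21 0 (Expr.and (read 6 (var 21)) (read 2 (ix (var 21) (var 20)))))).bit).eval L ρ s₁
      = (H.border C).ncard := by
    rw [eval_sum, hρ]
    have key : ∀ z : Fin n, (Expr.and (read 6 (var 20)).not
      (Expr.ex 21 0 (Expr.and (read 6 (var 21)) (read 2 (ix (var 21) (var 20)))))).Holds L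
      (Env.set ρ 20 z) s₁ ↔ z ∈ H.border C := by
      intro z
      rw [holds_and, holds_not, holds_ex, holds_read _ (by decide)]
      refine and_congr (not_congr (by simpa using hset z)) ?_
      simp only [Env.set_apply, hρ]
      constructor
      · rintro ⟨y, hy, h⟩
        simp [hρ] at h
        exact ⟨⟨y, hy⟩, (hset ⟨y, hy⟩).1 h.1, (hc1.adj ⟨y, hy⟩ z).1 h.2⟩
      · rintro ⟨y, hy, h⟩
        refine ⟨y, y.2, ?_⟩
        simp [hρ]
        exact ⟨(hset y).2 hy, (hc1.adj y z).2 h⟩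
    refine ncard_eq_sum _ (fun z hz => ?_) (fun z hz => ?_)
    · rw [eval_bit, if_pos ((key z).2 hz)]
    · rw [eval_bit, if_neg (mt (key z).1 hz)]
  have e1 : s' = if (H.border C).ncard ≤ ρ 2 then (Stmt.loop 28 0 tryVertex).run L ρ s₁ else s₁ := by
    simp only [s', tryComp, run_seq, run_ite, ← hs₁, holds_le, hcard, eval_var, run_skip]
  by_cases hk : (H.border C).ncard ≤ ρ 2
  swap
  · rw [if_neg hk] at e1
    rw [e1]
    exact ⟨hS1, fun i hi => by rwa [f 9 (by decide)], fun h => absurd h hk⟩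
  · rw [if_pos hk, run_loop, hρ] at e1
    -- Success is promised for vertices that split C in the initial store. Since choices are only
    -- added, such a vertex still splits C when its turn comes.
    have := iter_induction (n := n) (s := s₁)
      (f := fun i s => tryVertex.run L (Env.set ρ 28 i) s)
      (fun m s'' => Ctx H s'' ∧ Sound H (ρ 2) s'' ∧ HasSet s'' C ∧ Grows s s'' ∧
        ∀ v : Fin n, (v : ℕ) < m → Splits H s C v → s'' 9 (key C) ≠ 0)
      ⟨hc1, hS1, hset, fun i hi => by rwa [f 9 (by decide)], by simp⟩ ?_
    · rw [← e1] at this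
      exact ⟨this.2.1, this.2.2.2.1, fun _ v hv => this.2.2.2.2 v v.2 hv⟩
    · rintro i hi s'' ⟨a1, a2, a3, a4, a5⟩
      obtain ⟨b1, b2, b3⟩ := tryVertex_spec (L := L) (k := ρ 2) (ρ := Env.set ρ 28 i)
        (by simp [hρ]) a1 a2 a3 hk ⟨i, hi⟩ (by simp)
      refine ⟨a1.run _ _ rfl rfl, b1, ?_, a4.trans b2, ?_⟩
      · intro z
        rw [run_of_not_writes (A := 6) _ _ _ rfl]
        exact a3 z
      · intro v hv hsp
        rcases Nat.lt_succ_iff_lt_or_eq.1 hv with h | h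
        · exact b2 _ (a5 v h hsp)
        · obtain rfl : v = ⟨i, hi⟩ := Fin.ext h
          exact b3 (hsp.grows a4)

end LoopLang

namespace LoopLang

open LoopLang.Expr LoopLang.Stmt SimpleGraph

variable {n : ℕ} {H : SimpleGraph (Fin n)} {L : ℕ}

/-! ### Search for separators -/

/-- The set of the entries of a tuple given by its digits. -/
def tupleSet (n k j : ℕ) : Set (Fin n) := {x | ∃ p < k, j / (n + 1) ^ p % (n + 1) = x}

/-- The digit n marks an unused position, which lets tuples of length k describe sets with fewer
elements. This is the reason for base n + 1. -/
theorem exists_tupleSet {k : ℕ} (S : Set (Fin n)) (hS : S.ncard ≤ k) :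
    ∃ j < (n + 1) ^ k, tupleSet n k j = S := by
  classical
  obtain ⟨l, hl⟩ : ∃ l : List (Fin n), l.length = S.ncard ∧ ∀ x, x ∈ l ↔ x ∈ S :=
    ⟨S.toFinset.toList, by rw [Finset.length_toList, Set.ncard_eq_toFinset_card'], by simp⟩
  set f : ℕ → ℕ := fun p => if h : p < l.length then l[p] else n with hf
  have hfb : ∀ p, f p < n + 1 := by
    intro p
    simp only [hf]
    split
    · exact (l[p]).2.trans (Nat.lt_succ_self n)
    · omega
  obtain ⟨h1, h2⟩ := encode_spec (b := n + 1) (P := fun _ => True) (f := f) (by omega) k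
    (fun p _ _ => hfb p)
  -- For the predicate that is always true, the rank of a position is the position itself.
  have hcount : ∀ m, @Nat.count (fun _ => True) (fun _ => Classical.propDecidable _) m = m :=
    fun m => by convert Nat.count_true m
  refine ⟨_, by convert h1; exact (hcount k).symm, ?_⟩
  ext x
  simp only [tupleSet, Set.mem_ofPred_eq]
  constructor
  · rintro ⟨p, hp, e⟩
    have := h2 p hp trivial
    have h3 : encode (n + 1) (fun _ => True) f k / (n + 1) ^ p % (n + 1) = f p := by
      convert this; exact (hcount p).symm
    rw [h3] at e
    simp only [hf] at e
    split at e
    · rw [← hl.2, ← Fin.ext e]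
      exact List.getElem_mem _
    · have := x.2; omega
  · intro hx
    obtain ⟨p, hp, e⟩ := List.getElem_of_mem ((hl.2 x).2 hx)
    have hpk : p < k := by omega
    refine ⟨p, hpk, ?_⟩
    have := h2 p hpk trivial
    have h3 : encode (n + 1) (fun _ => True) f k / (n + 1) ^ p % (n + 1) = f p := by
      convert this; exact (hcount p).symm
    rw [h3]
    simp [hf, hp, e]

/-- The condition that variable `x` is in the tuple of variable `25`. -/
def inTuple (x : ℕ) : Expr :=
  Expr.ex 24 2 (Expr.eq (digit (mul 24 (var 4)) (var 25)) (var x))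

/-- Tries the components outside the tuple of variable `25`. -/
def tryTuple : Stmt :=
  .seq (comps 4 5 (inTuple 20).not (inTuple 21).not) (.loop 27 0 tryComp)

theorem tryTuple_spec {ρ : Env} (hρ : ρ 0 = n) {s : Store} (hs : Ctx H s)
    (hS : Sound H (ρ 2) s) (hd : HasDigits s (n + 1) (ρ 2) (ρ 4)) (hj : ρ 25 < ρ 4) :
    let s' := tryTuple.run L ρ s
    Sound H (ρ 2) s' ∧ Grows s s' ∧ ∀ x,
      (H.border (H.compIn (tupleSet n (ρ 2) (ρ 25))ᶜ x)).ncard ≤ ρ 2 →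
      ∀ v, Splits H s (H.compIn (tupleSet n (ρ 2) (ρ 25))ᶜ x) v →
        s' 9 (key (H.compIn (tupleSet n (ρ 2) (ρ 25))ᶜ x)) ≠ 0 := by
  intro s'
  set U := (tupleSet n (ρ 2) (ρ 25))ᶜ with hU
  set s₁ := (comps 4 5 (inTuple 20).not (inTuple 21).not).run L ρ s with hs₁
  have f : ∀ A : Fin 32, A ≠ 4 → A ≠ 5 → s₁ A = s A := fun A h4 h5 =>
    comps_frame h4 h5 _ _ _ _
  have hc1 : Ctx H s₁ := hs.congr (f 2 (by decide) (by decide)) (f 3 (by decide) (by decide))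
  have hcomp : HasComps H s₁ 5 U := by
    refine comps_spec (by decide) (by decide) (by decide) (by decide) hρ hs _ ?_
    intro s'' hs'' i j
    have key : ∀ y : Fin n, (¬ ∃ p < ρ 2, s'' 22 (s'' 23 (p * ρ 4 + ρ 25)) = y) ↔ y ∈ U := by
      intro y
      rw [hU, Set.mem_compl_iff, tupleSet, Set.mem_ofPred_eq]
      refine not_congr (exists_congr fun p => and_congr_right fun hp => ?_)
      rw [hs'' 22 (by decide), hs'' 23 (by decide), hd p hp.le _ hj]
    refine ⟨?_, ?_⟩
    · rw [← key, inTuple]; simp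
    · rw [← key, inTuple]; simp
  have e1 : s' = iter (fun i s => tryComp.run L (Env.set ρ 27 i) s) n s₁ := by
    simp only [s', tryTuple, run_seq, run_loop, hρ, hs₁]
  have := iter_induction (n := n) (s := s₁)
    (f := fun i s => tryComp.run L (Env.set ρ 27 i) s)
    (fun m s'' => Ctx H s'' ∧ Sound H (ρ 2) s'' ∧ HasComps H s'' 5 U ∧ Grows s s'' ∧
      ∀ x : Fin n, (x : ℕ) < m → (H.border (H.compIn U x)).ncard ≤ ρ 2 →
        ∀ v, Splits H s (H.compIn U x) v → s'' 9 (key (H.compIn U x)) ≠ 0)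
    ⟨hc1, hS.congr (f 9 (by decide) (by decide)), hcomp,
      fun i hi => by rwa [f 9 (by decide) (by decide)], by simp⟩ ?_
  · rw [← e1] at this
    exact ⟨this.2.1, this.2.2.2.1, fun x => this.2.2.2.2 x x.2⟩
  · rintro i hi s'' ⟨a1, a2, a3, a4, a5⟩
    obtain ⟨b1, b2, b3⟩ := tryComp_spec (L := L) (ρ := Env.set ρ 27 i)
      (by simp [hρ]) a1 a2 a3 ⟨i, hi⟩ (by simp)
    refine ⟨a1.run _ _ rfl rfl, b1, ?_, a4.trans b2, ?_⟩
    · unfold HasComps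
      rw [run_of_not_writes (A := 5) _ _ _ rfl]
      exact a3
    · intro x hx hk v hsp
      rcases Nat.lt_succ_iff_lt_or_eq.1 hx with h | h
      · exact b2 _ (a5 x h hk v hsp)
      · obtain rfl : x = ⟨i, hi⟩ := Fin.ext h
        exact b3 hk v (hsp.grows a4)

/-- A set C of the required kind is a component of the complement of its border, and a border of at
most k vertices occurs among the tuples, so C is met during the round. -/
theorem round_spec {ρ : Env} (hρ : ρ 0 = n) {s : Store} (hs : Ctx H s)
    (hS : Sound H (ρ 2) s) (hd : HasDigits s (n + 1) (ρ 2) (ρ 4)) (hM : ρ 4 = (n + 1) ^ ρ 2) :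
    let s' := (Stmt.loop 25 4 tryTuple).run L ρ s
    Sound H (ρ 2) s' ∧ Grows s s' ∧ ∀ C : Set (Fin n), ∀ v ∈ C,
      (∀ x ∈ C, H.compIn (H.border C)ᶜ x = C) → (H.border C).ncard ≤ ρ 2 →
        Splits H s C v → s' 9 (key C) ≠ 0 := by
  intro s'
  have e1 : s' = iter (fun i s => tryTuple.run L (Env.set ρ 25 i) s) (ρ 4) s := rfl
  have := iter_induction (n := ρ 4) (s := s)
    (f := fun i s => tryTuple.run L (Env.set ρ 25 i) s)
    (fun m s'' => Ctx H s'' ∧ Sound H (ρ 2) s'' ∧ HasDigits s'' (n + 1) (ρ 2) (ρ 4) ∧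
      Grows s s'' ∧ ∀ j < m, ∀ x : Fin n,
        (H.border (H.compIn (tupleSet n (ρ 2) j)ᶜ x)).ncard ≤ ρ 2 →
        ∀ v, Splits H s (H.compIn (tupleSet n (ρ 2) j)ᶜ x) v →
          s'' 9 (key (H.compIn (tupleSet n (ρ 2) j)ᶜ x)) ≠ 0)
    ⟨hs, hS, hd, fun i hi => hi, by simp⟩ ?_
  · rw [← e1] at this
    refine ⟨this.2.1, this.2.2.2.1, fun C v hv hC hk hsp => ?_⟩
    obtain ⟨j, hj, hjS⟩ := exists_tupleSet (H.border C) hk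
    have h := this.2.2.2.2 j (hM ▸ hj) v
    rw [hjS, hC v hv] at h
    exact h hk v hsp
  · rintro i hi s'' ⟨a1, a2, a3, a4, a5⟩
    obtain ⟨b1, b2, b3⟩ := tryTuple_spec (L := L) (ρ := Env.set ρ 25 i)
      (by simp [hρ]) a1 a2 (by simpa using a3) (by simpa using hi)
    refine ⟨a1.run _ _ rfl rfl, b1, ?_, a4.trans b2, ?_⟩
    · unfold HasDigits
      rw [run_of_not_writes (A := 22) _ _ _ rfl, run_of_not_writes (A := 23) _ _ _ rfl]
      exact a3
    · intro j hj x hk v hsp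
      rcases Nat.lt_succ_iff_lt_or_eq.1 hj with h | rfl
      · exact b2 _ (a5 j h x hk v hsp)
      · exact b3 x hk v (hsp.grows a4)

theorem compIn_univ (hH : H.Connected) (x : Fin n) : H.compIn Set.univ x = Set.univ := by
  refine Set.eq_univ_of_forall fun y => ?_
  exact (hH x y).mono (show H ≤ H.within Set.univ from fun a b h => ⟨h, trivial, trivial⟩)

/-- By `IsLayering.marked`, after r rounds all components of a layering with at most r vertices have
choices. The whole vertex set of a connected graph is such a component with n vertices. -/
theorem rounds_spec {ρ : Env} (hρ : ρ 0 = n) {s : Store} (hs : Ctx H s)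
    (hS : Sound H (ρ 2) s) (hd : HasDigits s (n + 1) (ρ 2) (ρ 4)) (hM : ρ 4 = (n + 1) ^ ρ 2)
    (hH : H.Connected) :
    let s' := (Stmt.loop 26 0 (.loop 25 4 tryTuple)).run L ρ s
    Sound H (ρ 2) s' ∧ ((∃ pos, H.IsLayering (ρ 2) pos) → s' 9 (key (Set.univ : Set (Fin n))) ≠ 0)
    := by
  intro s'
  set g := fun i s => (Stmt.loop 25 4 tryTuple).run L (Env.set ρ 26 i) s with hg
  have e1 : s' = iter g n s := by
    simp only [s', run_loop 26, hρ, hg]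
  have hinv : ∀ r, Ctx H (iter g r s) ∧ Sound H (ρ 2) (iter g r s) ∧
      HasDigits (iter g r s) (n + 1) (ρ 2) (ρ 4) := by
    intro r
    refine iter_induction (n := r) (fun _ s' => Ctx H s' ∧ Sound H (ρ 2) s' ∧
      HasDigits s' (n + 1) (ρ 2) (ρ 4)) ⟨hs, hS, hd⟩ ?_
    rintro i _ s'' ⟨a1, a2, a3⟩
    refine ⟨a1.run _ _ rfl rfl, (round_spec (ρ := Env.set ρ 26 i) (by simp [hρ]) a1 a2
      (by simpa using a3) (by simpa using hM)).1, ?_⟩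
    unfold HasDigits
    simp only [hg]
    rw [run_of_not_writes (A := 22) _ _ _ rfl, run_of_not_writes (A := 23) _ _ _ rfl]
    exact a3
  refine ⟨e1 ▸ (hinv n).2.1, ?_⟩
  rintro ⟨pos, hl⟩
  obtain ⟨x⟩ := hH.nonempty
  have := hl.marked (fun r C => iter g r s 9 (key C) ≠ 0) (by
    intro r C v hv hC hk hsp
    obtain ⟨a1, a2, a3⟩ := hinv r
    exact (round_spec (L := L) (ρ := Env.set ρ 26 r) (by simp [hρ]) a1 a2
      (by simpa using a3) (by simpa using hM)).2.2 C v hv hC hk ⟨hv, hsp⟩) n 0 x (Nat.zero_le _)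
    (by
      refine (Set.ncard_le_ncard (Set.subset_univ _)).trans ?_
      rw [Set.ncard_univ, Nat.card_eq_fintype_card, Fintype.card_fin])
  rw [e1]
  have hu : ({u | 0 ≤ pos u} : Set (Fin n)) = Set.univ := by ext; simp
  rwa [hu, compIn_univ hH] at this

/-- Looks for separators of size variable `2` and records success in array `10`. -/
def tryWidth : Stmt :=
  .seq (powers 20 3 2) <| .letv 4 (read 20 (var 2)) <| .seq (digits 3 2 4) <|
  .seq (.loop 26 0 (.loop 25 4 tryTuple))
  (.ite (read 9 (.sum 21 0 (read 3 (var 21))))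
    (.write 10 (lit 0) (add (var 2) (lit 1))) .skip)

theorem tryWidth_spec {ρ : Env} (hρ : ρ 0 = n) (h3 : ρ 3 = n + 1) {s : Store} (hs : Ctx H s)
    (hS : Sound H (ρ 2) s) (hH : H.Connected) :
    let s' := tryWidth.run L ρ s
    Ctx H s' ∧ Sound H (ρ 2) s' ∧
      ((s' 10 0 = s 10 0 ∧ ¬ ∃ pos, H.IsLayering (ρ 2) pos) ∨
        (s' 10 0 = ρ 2 + 1 ∧ s' 9 (key (Set.univ : Set (Fin n))) ≠ 0)) := by
  classical
  intro s'
  refine ⟨hs.run _ _ rfl rfl, ?_⟩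
  set s₁ := (powers 20 3 2).run L ρ s with hs₁
  have hp : s₁ 20 (ρ 2) = (n + 1) ^ ρ 2 := by
    rw [hs₁, powers_spec (by decide) (by decide) ρ s _ le_rfl, h3]
  set ρ' := Env.set ρ 4 ((n + 1) ^ ρ 2) with hρ'
  set s₂ := (digits 3 2 4).run L ρ' s₁ with hs₂
  have hd : HasDigits s₂ (n + 1) (ρ 2) ((n + 1) ^ ρ 2) := by
    have := digits_spec (L := L) (b := 3) (l := 2) (m := 4) (by decide) (by decide) ρ'
      (by simp [hρ', h3]) s₁
    simpa [hρ', h3] using this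
  have hc2 : Ctx H s₂ := (hs.run _ _ rfl rfl).run _ _ rfl rfl
  have hS2 : Sound H (ρ 2) s₂ := (hS.congr (run_of_not_writes (A := 9) (powers 20 3 2) _ _ rfl)).congr
    (run_of_not_writes (A := 9) (digits 3 2 4) _ _ rfl)
  obtain ⟨r1, r2⟩ := rounds_spec (L := L) (ρ := ρ') (by simp [hρ', hρ]) hc2 (by simpa [hρ'] using hS2)
    (by simpa [hρ'] using hd) (by simp [hρ']) hH
  set s₃ := (Stmt.loop 26 0 (.loop 25 4 tryTuple)).run L ρ' s₂ with hs₃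
  have hc3 : Ctx H s₃ := hc2.run _ _ rfl rfl
  have h10 : s₃ 10 = s 10 := by
    rw [hs₃, run_of_not_writes (A := 10) _ _ _ rfl, hs₂, run_of_not_writes (A := 10) _ _ _ rfl,
      hs₁, run_of_not_writes (A := 10) _ _ _ rfl]
  have hkey : (Expr.sum 21 0 (read 3 (var 21))).eval L ρ' s₃ = key (Set.univ : Set (Fin n)) := by
    rw [eval_sum]
    simp only [hρ', Env.set_apply, hρ]
    exact sum_eq_key (fun z _ => by simp [hc3.pow z z.2]) (fun z hz => absurd trivial hz)
  have e1 : s' = if s₃ 9 (key (Set.univ : Set (Fin n))) ≠ 0 then s₃.put 10 0 (ρ 2 + 1) else s₃ := by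
    simp only [s', tryWidth, run_seq, run_letv, ← hs₁]
    have : (read 20 (var 2)).eval L ρ s₁ = (n + 1) ^ ρ 2 := by simp [hp]
    rw [this, ← hρ', ← hs₂, ← hs₃, run_ite]
    refine if_congr ?_ ?_ rfl
    · rw [holds_read _ (by decide), hkey]
    · rw [run_write (by decide)]; simp [hρ']
  have hr1 : Sound H (ρ 2) s₃ := by simpa [hρ'] using r1
  by_cases hu : s₃ 9 (key (Set.univ : Set (Fin n))) ≠ 0
  · rw [if_pos hu] at e1
    have h9 : s' 9 = s₃ 9 := by rw [e1]; exact Store.put_of_ne _ _ _ (by decide)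
    exact ⟨hr1.congr h9, .inr ⟨by rw [e1]; simp, by rwa [h9]⟩⟩
  · rw [if_neg hu] at e1
    rw [e1]
    refine ⟨hr1, .inl ⟨by rw [h10], fun h => hu (r2 ?_)⟩⟩
    simpa [hρ'] using h

/-- Finds the least size of separators that suffices. -/
def findWidth : Stmt :=
  .loop 2 3 (.ite (read 10 (lit 0)) .skip tryWidth)

/-- Eliminating vertices one at a time always has width at most n, so the search for the width
succeeds by k = n. -/
theorem isLayering_val (H : SimpleGraph (Fin n)) : H.IsLayering n Fin.val := by
  refine ⟨fun v => ?_, fun u v h _ => Fin.ext h⟩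
  refine (Set.ncard_le_ncard (Set.subset_univ _)).trans ?_
  rw [Set.ncard_univ, Nat.card_eq_fintype_card, Fintype.card_fin]

/-- The state of the search for the width, before size `m` is tried. -/
def WidthInv (H : SimpleGraph (Fin n)) (m : ℕ) (s : Store) : Prop :=
  Ctx H s ∧
    ((s 10 0 = 0 ∧ Sound H m s ∧ ∀ k < m, ¬ ∃ pos, H.IsLayering k pos) ∨
      ∃ k < m, s 10 0 = k + 1 ∧ Sound H k s ∧ s 9 (key (Set.univ : Set (Fin n))) ≠ 0 ∧
        ∀ k' < k, ¬ ∃ pos, H.IsLayering k' pos)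

/-- The invariant is kept for every number of passes, not just the last: the running time needs that
size m is tried only if no layering of smaller width exists. -/
theorem findWidth_inv {ρ : Env} (hρ : ρ 0 = n) (h3 : ρ 3 = n + 1) {s : Store} (hs : Ctx H s)
    (h9 : s 9 = 0) (h10 : s 10 = 0) (hH : H.Connected) (m : ℕ) :
    WidthInv H m (iter (fun i s =>
      (Stmt.ite (read 10 (lit 0)) .skip tryWidth).run L (Env.set ρ 2 i) s) m s) := by
  refine iter_induction (n := m) (WidthInv H) ?_ ?_
  · exact ⟨hs, .inl ⟨by simp [h10], fun C hC => absurd (by simp [h9]) hC, by simp⟩⟩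
  · rintro i hi s' ⟨hc, h⟩
    rw [run_ite, holds_read _ (by decide)]
    rcases h with ⟨a1, a2, a3⟩ | ⟨k, a1, a2, a3, a4, a5⟩
    · simp only [eval_lit, a1, ne_eq, not_true_eq_false, if_false]
      obtain ⟨b1, b2, b3⟩ := tryWidth_spec (L := L) (ρ := Env.set ρ 2 i) (by simp [hρ])
        (by simp [h3]) hc (by simpa using a2) hH
      refine ⟨b1, ?_⟩
      rcases b3 with ⟨c1, c2⟩ | ⟨c1, c2⟩
      · refine .inl ⟨c1.trans a1, Sound.mono b2 (by simp), fun k hk => ?_⟩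
        rcases Nat.lt_succ_iff_lt_or_eq.1 hk with h | rfl
        · exact a3 k h
        · simpa using c2
      · exact .inr ⟨i, by omega, by simpa using c1, by simpa using b2, c2, a3⟩
    · simp only [eval_lit, a2, ne_eq, Nat.succ_ne_zero, not_false_eq_true, if_true, run_skip]
      exact ⟨hc, .inr ⟨k, by omega, a2, a3, a4, a5⟩⟩

theorem findWidth_spec {ρ : Env} (hρ : ρ 0 = n) (h3 : ρ 3 = n + 1) {s : Store} (hs : Ctx H s)
    (h9 : s 9 = 0) (h10 : s 10 = 0) (hH : H.Connected) :
    let s' := findWidth.run L ρ s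
    Ctx H s' ∧ ∃ k ≤ n, s' 10 0 = k + 1 ∧ Sound H k s' ∧
      s' 9 (key (Set.univ : Set (Fin n))) ≠ 0 ∧ ∀ k' < k, ¬ ∃ pos, H.IsLayering k' pos := by
  intro s'
  have := findWidth_inv (L := L) hρ h3 hs h9 h10 hH (n + 1)
  have e1 : s' = iter (fun i s =>
      (Stmt.ite (read 10 (lit 0)) .skip tryWidth).run L (Env.set ρ 2 i) s) (n + 1) s := by
    simp only [s', findWidth, run_loop, h3]
  rw [← e1] at this
  obtain ⟨hc, ⟨-, -, h⟩ | ⟨k, hk, h⟩⟩ := this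
  · exact absurd ⟨_, isLayering_val H⟩ (h n (by omega))
  · exact ⟨hc, k, by omega, h⟩

/-! ### Layers -/

/-- Places variable `28` in the layer of variable `26` if it is the choice for its component. -/
def placeVertex : Stmt :=
  .ite (Expr.and (read 11 (var 28)).not
      (Expr.eq (read 9 (rowKey 5 (var 28))) (add (var 28) (lit 1))))
    (.seq (.loop 20 0 (.write 12 (ix (var 28) (var 20))
        (Expr.and (read 5 (ix (ix (var 0) (var 28)) (var 20))).not
          (Expr.ex 21 0 (Expr.and (read 5 (ix (ix (var 0) (var 28)) (var 21)))
            (read 2 (ix (var 21) (var 20)))))).bit))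
      (.write 11 (var 28) (add (var 26) (lit 1))))
    .skip

theorem placeVertex_spec {ρ : Env} (hρ : ρ 0 = n) {s : Store} (hs : Ctx H s) {U : Set (Fin n)}
    (hU : HasComps H s 5 U) (v : Fin n) (hv : ρ 28 = v) :
    let s' := placeVertex.run L ρ s
    (∀ A : Fin 32, A ≠ 11 → A ≠ 12 → s' A = s A) ∧
    (∀ u : Fin n, u ≠ v → s' 11 u = s 11 u) ∧
    (∀ u : Fin n, u ≠ v → ∀ w : Fin n, s' 12 (n * u + w) = s 12 (n * u + w)) ∧
    (s 11 v = 0 ∧ s 9 (key (H.compIn U v)) = v + 1 → s' 11 v = ρ 26 + 1 ∧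
      ∀ w : Fin n, s' 12 (n * v + w) ≠ 0 ↔ w ∈ H.border (H.compIn U v)) ∧
    (¬ (s 11 v = 0 ∧ s 9 (key (H.compIn U v)) = v + 1) → s' = s) := by
  classical
  intro s'
  set p : Stmt := .loop 20 0 (.write 12 (ix (var 28) (var 20))
        (Expr.and (read 5 (ix (ix (var 0) (var 28)) (var 20))).not
          (Expr.ex 21 0 (Expr.and (read 5 (ix (ix (var 0) (var 28)) (var 21)))
            (read 2 (ix (var 21) (var 20)))))).bit) with hp
  have e1 : s' = if s 11 v = 0 ∧ s 9 (key (H.compIn U v)) = v + 1 then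
      (p.run L ρ s).put 11 v (ρ 26 + 1) else s := by
    simp only [s', placeVertex, run_ite, run_seq, run_skip, ← hp]
    refine if_congr ?_ ?_ rfl
    · rw [holds_and, holds_not, holds_read _ (by decide), holds_eq, eval_read,
        eval_rowKey (by decide) hρ hs hU v (by simp [hv])]
      simp [hv]
    · rw [run_write (by decide)]; simp [hv]
  have hframe : ∀ A : Fin 32, A ≠ 12 → p.run L ρ s A = s A := fun A h =>
    run_of_not_writes _ _ _ (by simp [hp, writes, h.symm])
  obtain ⟨f1, f2⟩ := run_fill (L := L) (ρ := ρ) (A := 12) (by decide) (s := s) (D := ∅) (x := 20)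
    (v := 0) (ie := ix (var 28) (var 20))
    (e := (Expr.and (read 5 (ix (ix (var 0) (var 28)) (var 20))).not
          (Expr.ex 21 0 (Expr.and (read 5 (ix (ix (var 0) (var 28)) (var 21)))
            (read 2 (ix (var 21) (var 20)))))).bit)
    (V := fun k => if ∃ w : Fin n, k % n = w ∧ w ∈ H.border (H.compIn U v) then 1 else 0)
    (fun i => n * v + i) (by simp) (by
      intro s'' hs'' _ i hi
      rw [hρ] at hi
      refine ⟨by simp [hρ, hv], ?_⟩
      rw [eval_bit, ix_mod _ hi]
      refine if_congr ?_ rfl rfl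
      rw [holds_and, holds_not, holds_read _ (by decide), holds_ex]
      have h5 := hs'' 5 (by decide)
      have h2 := hs'' 2 (by decide)
      constructor
      · rintro ⟨a1, y, hy, a2⟩
        simp [hρ, hv, h5, h2] at hy a1 a2
        refine ⟨⟨i, hi⟩, rfl, fun h => ?_, ⟨y, hy⟩, (hU v ⟨y, hy⟩).1 a2.1, (hs.adj ⟨y, hy⟩ ⟨i, hi⟩).1 a2.2⟩
        exact (hU v ⟨i, hi⟩).2 h a1
      · rintro ⟨w, rfl, a1, y, hy, a2⟩
        refine ⟨?_, y, by simp [hρ, y.2], ?_⟩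
        · have := mt (hU v w).1 a1
          simpa [hρ, hv, h5] using this
        · simp [hρ, hv, h5, h2]
          exact ⟨(hU v y).2 hy, (hs.adj y w).2 a2⟩)
  rw [← hp] at f1 f2
  by_cases hc : s 11 v = 0 ∧ s 9 (key (H.compIn U v)) = v + 1
  · rw [if_pos hc] at e1
    refine ⟨?_, ?_, ?_, fun _ => ⟨by rw [e1]; simp, ?_⟩, fun h => absurd hc h⟩
    · intro A h11 h12
      rw [e1, Store.put_of_ne _ _ _ h11, hframe A h12]
    · intro u hu
      rw [e1]
      simp [Fin.val_inj, hu, hframe 11]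
    · intro u hu w
      rw [e1, Store.put_of_ne _ _ _ (by decide), f2]
      intro i hi e
      rw [hρ] at hi
      refine hu (Fin.ext ?_)
      rw [← ix_div (u : ℕ) w.2, e, ix_div _ hi]
    · intro w
      rw [e1, Store.put_of_ne _ _ _ (by decide), f1 w (by rw [hρ]; exact w.2), ix_mod _ w.2]
      simp [Fin.val_inj]
  · rw [if_neg hc] at e1
    rw [e1]
    exact ⟨fun _ _ _ => rfl, fun _ _ => rfl, fun _ _ _ => rfl, fun h => absurd h hc, fun _ => rfl⟩

/-- Computes the layer of variable `26`. -/
def placeLayer : Stmt :=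
  .seq (comps 4 5 (read 11 (var 20)).not (read 11 (var 21)).not) (.loop 28 0 placeVertex)

/-- The components are those of the vertices unplaced when the layer begins. Their table is not
recomputed while array `11` changes, so a layer is chosen simultaneously in all components. -/
theorem placeLayer_spec {ρ : Env} (hρ : ρ 0 = n) {s : Store} (hs : Ctx H s) :
    let s' := placeLayer.run L ρ s
    let U : Set (Fin n) := {v | s 11 v = 0}
    (∀ A : Fin 32, A ≠ 4 → A ≠ 5 → A ≠ 11 → A ≠ 12 → s' A = s A) ∧
    ∀ v : Fin n,
      (s 11 v = 0 ∧ s 9 (key (H.compIn U v)) = v + 1 → s' 11 v = ρ 26 + 1 ∧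
        ∀ w : Fin n, s' 12 (n * v + w) ≠ 0 ↔ w ∈ H.border (H.compIn U v)) ∧
      (¬ (s 11 v = 0 ∧ s 9 (key (H.compIn U v)) = v + 1) → s' 11 v = s 11 v ∧
        ∀ w : Fin n, s' 12 (n * v + w) = s 12 (n * v + w)) := by
  intro s' U
  set s₁ := (comps 4 5 (read 11 (var 20)).not (read 11 (var 21)).not).run L ρ s with hs₁
  have f : ∀ A : Fin 32, A ≠ 4 → A ≠ 5 → s₁ A = s A := fun A h4 h5 =>
    comps_frame h4 h5 _ _ _ _
  have hc1 : Ctx H s₁ := hs.congr (f 2 (by decide) (by decide)) (f 3 (by decide) (by decide))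
  have hcomp : HasComps H s₁ 5 U := by
    refine comps_spec (by decide) (by decide) (by decide) (by decide) hρ hs _ ?_
    intro s'' hs'' i j
    have h11 := hs'' 11 (by decide)
    simp [U, h11]
  have h9 := f 9 (by decide) (by decide)
  have h11 := f 11 (by decide) (by decide)
  have h12 := f 12 (by decide) (by decide)
  have e1 : s' = iter (fun i s => placeVertex.run L (Env.set ρ 28 i) s) n s₁ := by
    simp only [s', placeLayer, run_seq, run_loop, hρ, hs₁]
  have := iter_induction (n := n) (s := s₁)
    (f := fun i s => placeVertex.run L (Env.set ρ 28 i) s)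
    (fun m s'' => (∀ A : Fin 32, A ≠ 11 → A ≠ 12 → s'' A = s₁ A) ∧
      (∀ v : Fin n, m ≤ v → s'' 11 v = s 11 v ∧
        ∀ w : Fin n, s'' 12 (n * v + w) = s 12 (n * v + w)) ∧
      ∀ v : Fin n, (v : ℕ) < m →
      (s 11 v = 0 ∧ s 9 (key (H.compIn U v)) = v + 1 → s'' 11 v = ρ 26 + 1 ∧
        ∀ w : Fin n, s'' 12 (n * v + w) ≠ 0 ↔ w ∈ H.border (H.compIn U v)) ∧
      (¬ (s 11 v = 0 ∧ s 9 (key (H.compIn U v)) = v + 1) → s'' 11 v = s 11 v ∧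
        ∀ w : Fin n, s'' 12 (n * v + w) = s 12 (n * v + w)))
    ⟨fun _ _ _ => rfl, fun v _ => ⟨by rw [h11], by rw [h12]; simp⟩, by simp⟩ ?_
  · rw [← e1] at this
    refine ⟨fun A a4 a5 a11 a12 => (this.1 A a11 a12).trans (f A a4 a5), fun v => this.2.2 v v.2⟩
  · rintro i hi s'' ⟨a1, a2, a3⟩
    have hcU : HasComps H s'' 5 U := by
      unfold HasComps; rw [a1 5 (by decide) (by decide)]; exact hcomp
    obtain ⟨b1, b2, b3, b4, b5⟩ := placeVertex_spec (L := L) (ρ := Env.set ρ 28 i)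
      (by simp [hρ]) (hc1.congr (a1 2 (by decide) (by decide)) (a1 3 (by decide) (by decide)))
      hcU ⟨i, hi⟩ (by simp)
    rw [(a2 ⟨i, hi⟩ le_rfl).1, a1 9 (by decide) (by decide), h9] at b4 b5
    refine ⟨fun A h h' => (b1 A h h').trans (a1 A h h'), fun v hv => ?_, fun v hv => ?_⟩
    · have hne : v ≠ ⟨i, hi⟩ := fun e => by subst e; simp at hv
      have := a2 v (by omega)
      exact ⟨(b2 v hne).trans this.1, fun w => (b3 v hne w).trans (this.2 w)⟩
    · by_cases hne : v = ⟨i, hi⟩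
      · subst hne
        refine ⟨fun h => by simpa using b4 h, fun h => ?_⟩
        have := b5 h
        simp only at this ⊢
        rw [this]
        exact a2 ⟨i, hi⟩ le_rfl
      · have hlt : (v : ℕ) < i := by
          have : (v : ℕ) ≠ i := fun e => hne (Fin.ext e)
          omega
        simp only [b2 v hne, b3 v hne]
        exact a3 v hlt

/-- Array `11` holds the layers, increased by one, and array `12` the sets `upper`. -/
structure HasLayers (H : SimpleGraph (Fin n)) (s : Store) (k : ℕ) (pos : Fin n → ℕ) : Prop where
  layering : H.IsLayering k pos
  pos_lt : ∀ v, pos v < n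
  pos_eq : ∀ v : Fin n, s 11 v = pos v + 1
  upper : ∀ v w : Fin n, s 12 (n * v + w) ≠ 0 ↔ w ∈ H.upper pos v

/-- Each round places the choice of every remaining component. A vertex not yet placed counts as
later than all placed ones, so the sets in the invariant do not change after v is placed and finally
become the sets {u | pos v ≤ pos u}. -/
theorem placeLayers_spec {ρ : Env} (hρ : ρ 0 = n) {s : Store} (hs : Ctx H s) {k : ℕ}
    (hS : Sound H k s) (hu : s 9 (key (Set.univ : Set (Fin n))) ≠ 0) (h11 : s 11 = 0)
    (hH : H.Connected) : ∃ pos, HasLayers H ((Stmt.loop 26 0 placeLayer).run L ρ s) k pos := by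
  set s' := (Stmt.loop 26 0 placeLayer).run L ρ s with hs'
  have hsplit := hS.isSplitting
  set ch : Set (Fin n) → Fin n → Prop := fun C v => s 9 (key C) = (v : ℕ) + 1 with hch
  have hex : ∀ C, s 9 (key C) ≠ 0 ↔ ∃ w, ch C w := by
    intro C
    constructor
    · intro h
      obtain ⟨v, hv, -⟩ := hS C h
      exact ⟨v, hv⟩
    · rintro ⟨v, hv⟩
      simp only [hch] at hv
      omega
  have := iter_induction (n := n) (s := s)
    (f := fun i s => placeLayer.run L (Env.set ρ 26 i) s)
    (fun t s'' => Ctx H s'' ∧ s'' 9 = s 9 ∧ (∀ v : Fin n, s'' 11 v ≤ t) ∧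
      (∀ v : Fin n, s'' 11 v ≠ 0 →
        ch (H.compIn {u | s'' 11 u = 0 ∨ s'' 11 v ≤ s'' 11 u} v) v ∧
        ∀ w : Fin n, s'' 12 (n * v + w) ≠ 0 ↔
          w ∈ H.border (H.compIn {u | s'' 11 u = 0 ∨ s'' 11 v ≤ s'' 11 u} v)) ∧
      (∀ v ∈ {u : Fin n | s'' 11 u = 0}, ∃ w, ch (H.compIn {u | s'' 11 u = 0} v) w) ∧
      ({u : Fin n | s'' 11 u = 0} : Set (Fin n)).ncard ≤ n - t) ?_ ?_
  · have e1 : s' = iter (fun i s => placeLayer.run L (Env.set ρ 26 i) s) n s := by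
      simp only [hs', run_loop 26, hρ]
    rw [← e1] at this
    obtain ⟨-, -, a1, a2, -, a3⟩ := this
    have hne : ∀ v : Fin n, s' 11 v ≠ 0 := by
      intro v hv
      rw [Nat.sub_self, Nat.le_zero, Set.ncard_eq_zero] at a3
      have : v ∈ ({u : Fin n | s' 11 u = 0} : Set (Fin n)) := hv
      rw [a3] at this
      exact this
    have hset : ∀ v : Fin n, ({u : Fin n | s' 11 u = 0 ∨ s' 11 v ≤ s' 11 u} : Set (Fin n)) =
        {u : Fin n | s' 11 v - 1 ≤ s' 11 u - 1} := by
      intro v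
      ext u
      have := hne u; have := hne v
      simp only [Set.mem_ofPred_eq]
      omega
    refine ⟨fun v => s' 11 v - 1, hsplit.isLayering fun v => ?_, fun v => ?_, fun v => ?_,
      fun v w => ?_⟩
    · rw [← hset v]
      exact (a2 v (hne v)).1
    · have := a1 v; have := hne v; omega
    · have := hne v; omega
    · rw [(a2 v (hne v)).2 w, hset v]
      rfl
  · refine ⟨hs, rfl, by simp [h11], by simp [h11], ?_, ?_⟩
    · intro v _
      have : ({u : Fin n | s 11 u = 0} : Set (Fin n)) = Set.univ := by
        ext; simp [h11]
      rw [this, compIn_univ hH]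
      exact (hex _).1 hu
    · refine (Set.ncard_le_ncard (Set.subset_univ _)).trans ?_
      rw [Set.ncard_univ, Nat.card_eq_fintype_card, Fintype.card_fin, Nat.sub_zero]
  · rintro t ht s₁ ⟨hc, h9, a1, a2, a3, a4⟩
    obtain ⟨b1, b2⟩ := placeLayer_spec (L := L) (ρ := Env.set ρ 26 t) (by simp [hρ]) hc
    set s₂ := placeLayer.run L (Env.set ρ 26 t) s₁ with hs₂
    set U : Set (Fin n) := {u | s₁ 11 u = 0} with hU
    rw [h9] at b2
    simp only [Env.set_apply, if_true] at b2
    have hU' : ({u : Fin n | s₂ 11 u = 0} : Set (Fin n)) =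
        {u | u ∈ U ∧ ¬ ch (H.compIn U u) u} := by
      ext u
      simp only [Set.mem_ofPred_eq, hU]
      by_cases hcu : s₁ 11 u = 0 ∧ ch (H.compIn U u) u
      · rw [((b2 u).1 hcu).1]
        simp only [Nat.succ_ne_zero, false_iff, not_and, not_not]
        exact fun _ => hcu.2
      · rw [((b2 u).2 hcu).1]
        exact ⟨fun h => ⟨h, fun h' => hcu ⟨h, h'⟩⟩, fun h => h.1⟩
    refine ⟨hc.congr (b1 2 (by decide) (by decide) (by decide) (by decide))
      (b1 3 (by decide) (by decide) (by decide) (by decide)),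
      (b1 9 (by decide) (by decide) (by decide) (by decide)).trans h9, ?_, ?_, ?_, ?_⟩
    · intro v
      have := a1 v
      by_cases hcv : s₁ 11 v = 0 ∧ ch (H.compIn U v) v
      · rw [((b2 v).1 hcv).1]
      · rw [((b2 v).2 hcv).1]; omega
    · intro v hv
      by_cases hcv : s₁ 11 v = 0 ∧ ch (H.compIn U v) v
      · obtain ⟨c1, c2⟩ := (b2 v).1 hcv
        have hset : ({u : Fin n | s₂ 11 u = 0 ∨ s₂ 11 v ≤ s₂ 11 u} : Set (Fin n)) = U := by
          ext u
          rw [c1]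
          simp only [Set.mem_ofPred_eq, hU]
          have := a1 u
          by_cases hcu : s₁ 11 u = 0 ∧ ch (H.compIn U u) u
          · rw [((b2 u).1 hcu).1]; simp [hcu.1]
          · rw [((b2 u).2 hcu).1]; omega
        rw [hset]
        exact ⟨hcv.2, c2⟩
      · obtain ⟨c1, c2⟩ := (b2 v).2 hcv
        rw [c1] at hv
        have hset : ({u : Fin n | s₂ 11 u = 0 ∨ s₂ 11 v ≤ s₂ 11 u} : Set (Fin n)) =
            {u : Fin n | s₁ 11 u = 0 ∨ s₁ 11 v ≤ s₁ 11 u} := by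
          ext u
          rw [c1]
          simp only [Set.mem_ofPred_eq]
          have := a1 v
          by_cases hcu : s₁ 11 u = 0 ∧ ch (H.compIn U u) u
          · rw [((b2 u).1 hcu).1]; simp [hcu.1]; omega
          · rw [((b2 u).2 hcu).1]
        rw [hset]
        obtain ⟨d1, d2⟩ := a2 v hv
        exact ⟨d1, fun w => by rw [c2 w]; exact d2 w⟩
    · rw [hU']
      rintro v ⟨hv1, hv2⟩
      exact hsplit.step a3 v hv1 hv2
    · rw [hU']
      -- If vertices remain, the choice of some component is placed and their number drops. Hence n
      -- rounds place all of them.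
      by_cases hne : U.Nonempty
      · obtain ⟨x, hx⟩ := hne
        obtain ⟨w, hw⟩ := a3 x hx
        have hwC := (hsplit.2 _ w hw).1
        have hlt : ({u | u ∈ U ∧ ¬ ch (H.compIn U u) u} : Set (Fin n)).ncard < U.ncard := by
          refine Set.ncard_lt_ncard ⟨fun u hu => hu.1, fun h => ?_⟩ (Set.toFinite _)
          have := (h (compIn_subset hx hwC)).2
          rw [compIn_eq_of_mem hwC] at this
          exact this hw
        omega
      · rw [Set.not_nonempty_iff_eq_empty] at hne
        rw [hne]
        simp

end LoopLang

namespace LoopLang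

open LoopLang.Expr LoopLang.Stmt SimpleGraph

/-! ### Views -/

section Views

variable {n : ℕ}

/-- The ball of radius `r` as a set of numbers. -/
def nball (K : SimpleGraph (Fin n)) (r x z : ℕ) : Prop :=
  ∃ (hx : x < n) (hz : z < n), K.dist ⟨x, hx⟩ ⟨z, hz⟩ ≤ r

@[simp] theorem nball_val (K : SimpleGraph (Fin n)) (r : ℕ) (x z : Fin n) :
    nball K r x z ↔ K.dist x z ≤ r := by
  simp [nball]

open Classical in
theorem count_eq_card (P : ℕ → Prop) : Nat.count P n = Nat.card {x : Fin n // P x} := by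
  rw [Nat.count_eq_card_filter_range, Nat.card_eq_fintype_card, Fintype.card_subtype]
  refine (Finset.card_nbij (fun x : Fin n => (x : ℕ)) ?_ ?_ ?_).symm
  · intro x hx
    simpa using hx
  · exact Fin.val_injective.injOn
  · intro x hx
    simp only [Finset.coe_filter, Finset.mem_range, Set.mem_ofPred_eq] at hx
    exact ⟨⟨x, hx.1⟩, by simpa using hx.2, rfl⟩

open Classical in
/-- The largest number of vertices in a ball of radius `r`. -/
noncomputable def ballMax (K : SimpleGraph (Fin n)) (r : ℕ) : ℕ :=
  Finset.univ.sup fun x : Fin n => Nat.count (nball K r x) n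

open Classical in
theorem count_le_ballMax (K : SimpleGraph (Fin n)) {r r' : ℕ} (h : r' ≤ r) (x : Fin n) :
    Nat.count (nball K r' x) n ≤ ballMax K r := by
  refine le_trans ?_ (Finset.le_sup (f := fun x : Fin n => Nat.count (nball K r x) n)
    (Finset.mem_univ x))
  exact Nat.count_mono_left fun z _ ⟨h1, h2, h3⟩ => ⟨h1, h2, h3.trans h⟩

theorem ballMax_le (K : SimpleGraph (Fin n)) (r : ℕ) : ballMax K r ≤ n := by
  classical
  exact Finset.sup_le fun x _ => Nat.count_le _

open Classical in
/-- The value that view `a` of the ball around `x` gives to `z`. -/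
noncomputable def view (G H : SimpleGraph (Fin n)) (e c g : ℕ) (x a z : ℕ) : ℕ :=
  nthBelow (nball G (c * e) (a / g ^ g)) (a % g ^ g / g ^ Nat.count (nball H e x) z % g) n

variable (G H : SimpleGraph (Fin n)) (e c g : ℕ)

/-- The constraints on the value of a single vertex. -/
def ViewOk (x : Fin n) (a : ℕ) : Prop :=
  (∀ y, H.Adj x y → nball G c (view G H e c g x a x) (view G H e c g x a y)) ∧
    ∀ v : Fin n, (∃ u : Fin n, u = view G H e c g x a x ∧ G.Adj u v) →
      ∃ z, H.dist x z ≤ e ∧ view G H e c g x a z = v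

/-- The constraint on the values of two vertices. -/
def ViewsAgree (x : Fin n) (a : ℕ) (y : Fin n) (b : ℕ) : Prop :=
  ∀ z : Fin n, H.dist x z ≤ e → H.dist y z ≤ e → view G H e c g x a z = view G H e c g y b z

variable {G H e c g}

theorem isLocalInverse_of_views (hH : H.Connected) (he : 1 ≤ e) {σ : ℕ → ℕ}
    (h1 : ∀ x : Fin n, ViewOk G H e c g x (σ x))
    (h2 : ∀ x y : Fin n, H.Adj x y → ViewsAgree G H e c g x (σ x) y (σ y)) :
    ∃ ψ : Fin n → Fin n, IsLocalInverse G H e c ψ ∧ ∀ x, (ψ x : ℕ) = view G H e c g x (σ x) x := by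
  obtain ⟨x₀⟩ := hH.nonempty
  have hn : 1 ≤ n := Nat.one_le_of_lt x₀.2
  refine ⟨_, IsLocalInverse.of_views (G := G) (c := c) hH he
    (fun x z => ⟨view G H e c g x (σ x) z, nthBelow_lt hn⟩) ?_ ?_ ?_, fun x => rfl⟩
  · intro x y hxy
    obtain ⟨_, _, h⟩ := (h1 x).1 y hxy
    exact h
  · intro x v hv
    obtain ⟨z, hz, hzv⟩ := (h1 x).2 v ⟨_, rfl, hv⟩
    exact ⟨z, hz, Fin.ext hzv⟩
  · intro x y hxy z hxz hyz
    exact Fin.ext (h2 x y hxy z hxz hyz)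

/-- By contraction, ψ maps the e-ball around x into the `G`-ball of radius c * e around ψ x. By
lifting walks, that ball is covered by the ψ-image of the `H`-ball of radius c * e * e, so it has at
most g elements. Ranks in it are digits below g, and the e-ball itself needs at most g digits. -/
theorem exists_views (hG : G.Connected) (hH : H.Connected) (he : 1 ≤ e) (hc : 1 ≤ c)
    {ψ : Fin n → Fin n} (hψ : IsLocalInverse G H e c ψ) (hg : g = ballMax H (c * e * e)) :
    ∃ σ : ℕ → ℕ, (∀ x : Fin n, σ x < n * g ^ g) ∧ (∀ x : Fin n, ViewOk G H e c g x (σ x)) ∧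
      ∀ x y : Fin n, H.Adj x y → ViewsAgree G H e c g x (σ x) y (σ y) := by
  classical
  have hcontr : ∀ x z, G.dist (ψ x) (ψ z) ≤ c * H.dist x z := fun x z =>
    dist_map_le hH hG (fun x y h => hψ.1 x y h) x z
  have hle : e ≤ c * e * e := Nat.le_mul_of_pos_left _ (Nat.mul_pos hc he)
  have hball : ∀ x, Nat.count (nball G (c * e) (ψ x)) n ≤ g := by
    intro x
    rw [hg]
    refine le_trans ?_ (count_le_ballMax H le_rfl x)
    rw [count_eq_card, count_eq_card]
    refine Nat.card_le_card_of_surjective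
      (fun z : {z : Fin n // nball H (c * e * e) x z ∧ nball G (c * e) (ψ x) (ψ z)} =>
        (⟨ψ z.1, z.2.2⟩ : {v : Fin n // nball G (c * e) (ψ x) v})) ?_ |>.trans ?_
    · rintro ⟨v, hv⟩
      obtain ⟨z, hz, hzv⟩ := hψ.exists_of_dist_le hG hH (c * e) x v (by simpa using hv)
      exact ⟨⟨z, by simpa using hz, by rw [hzv]; exact hv⟩, Subtype.ext hzv⟩
    · exact Nat.card_le_card_of_injective (fun z => ⟨z.1, z.2.1⟩) fun a b h => by
        simpa [Subtype.ext_iff] using h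
  have hex : ∀ x : Fin n, ∃ a < n * g ^ g, ∀ z, H.dist x z ≤ e → view G H e c g x a z = ψ z := by
    intro x
    set f : ℕ → ℕ := fun z => if h : z < n then Nat.count (nball G (c * e) (ψ x)) (ψ ⟨z, h⟩) else 0
      with hf
    have hmem : ∀ z : Fin n, H.dist x z ≤ e → nball G (c * e) (ψ x) (ψ z) := fun z hz => by
      rw [nball_val]
      exact (hcontr x z).trans (Nat.mul_le_mul_left _ hz)
    have hcard : Nat.count (nball H e x) n ≤ g := hg ▸ count_le_ballMax H hle x
    have hg1 : 1 ≤ g := by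
      refine le_trans ?_ hcard
      rw [count_eq_card, Nat.one_le_iff_ne_zero, Nat.card_ne_zero]
      exact ⟨⟨⟨x, by simp⟩⟩, inferInstance⟩
    obtain ⟨h1, h2⟩ := encode_spec (b := g) (P := nball H e x) (f := f) hg1 n (by
      intro z hz hP
      have := hmem ⟨z, hz⟩ (by rw [← nball_val]; exact hP)
      simp only [hf, hz, dif_pos]
      refine lt_of_lt_of_le ?_ (hball x)
      exact Nat.count_strict_mono this (ψ ⟨z, hz⟩).2)
    have hlt : encode g (nball H e x) f n < g ^ g := h1.trans_le (Nat.pow_le_pow_right hg1 hcard)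
    -- The centre of the view is ψ x; the remaining digits are the ranks of the values ψ z in the
    -- ball around it.
    refine ⟨ψ x * g ^ g + encode g (nball H e x) f n, mul_add_lt (ψ x).2 hlt, fun z hz => ?_⟩
    rw [view, mul_add_div_of_lt _ hlt, mul_add_mod_of_lt _ hlt, h2 z z.2 (by simpa using hz)]
    simp only [hf, z.2, dif_pos]
    exact nthBelow_count (ψ z).2 (hmem z hz)
  choose a ha hview using hex
  refine ⟨fun x => if h : x < n then a ⟨x, h⟩ else 0, fun x => by simp [ha], fun x => ?_,
    fun x y hxy z hxz hyz => ?_⟩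
  · have hxx : view G H e c g x (a x) x = ψ x := hview x x (by simp)
    simp only [x.2, dif_pos]
    refine ⟨fun y hxy => ?_, ?_⟩
    · rw [hxx, hview x y (by rw [dist_eq_one_iff_adj.2 hxy]; exact he), nball_val]
      exact hψ.1 x y hxy
    · rintro v ⟨u, hu, huv⟩
      rw [hxx] at hu
      obtain rfl := Fin.ext hu
      obtain ⟨z, hz, hzv⟩ := hψ.2 x v huv
      exact ⟨z, hz, by rw [hview x z hz, hzv]⟩
  · simp only [x.2, y.2, dif_pos]
    rw [hview x z hxz, hview y z hyz]

end Views

/-! ### Layered loops -/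

/-- Each pass scans all vertices but acts only on those of its level. The property of v is
established in pass ℓ v and must survive the treatment of all vertices that come later in the order
by level and index. -/
theorem iter_layers {σ : Type*} {n : ℕ} {ℓ : Fin n → ℕ} (hℓ : ∀ v, ℓ v < n)
    {F : ℕ → ℕ → σ → σ} (I : σ → Prop) (Q : Fin n → σ → Prop)
    (h : ∀ (t : ℕ) (v : Fin n) (s : σ), I s → t < n →
      (ℓ v = t → I (F t v s) ∧ Q v (F t v s) ∧ ∀ u ≠ v, ℓ u ≤ t → Q u s → Q u (F t v s)) ∧
      (ℓ v ≠ t → F t v s = s)) {s : σ} (h0 : I s) :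
    I (iter (fun t s => iter (F t) n s) n s) ∧
      ∀ v, Q v (iter (fun t s => iter (F t) n s) n s) := by
  have key := iter_induction (n := n) (s := s) (f := fun t s => iter (F t) n s)
    (fun t s => I s ∧ ∀ v, ℓ v < t → Q v s) ⟨h0, by simp⟩ ?_
  · exact ⟨key.1, fun v => key.2 v (hℓ v)⟩
  · rintro t ht s₁ ⟨a1, a2⟩
    have := iter_induction (n := n) (s := s₁) (f := F t)
      (fun i s => I s ∧ ∀ v, ℓ v < t ∨ ℓ v = t ∧ (v : ℕ) < i → Q v s) ⟨a1, ?_⟩ ?_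
    · refine ⟨this.1, fun v hv => this.2 v ?_⟩
      rcases Nat.lt_succ_iff_lt_or_eq.1 hv with h' | h'
      · exact .inl h'
      · exact .inr ⟨h', v.2⟩
    · rintro v (hv | ⟨-, hv⟩)
      · exact a2 v hv
      · simp at hv
    · rintro i hi s₂ ⟨b1, b2⟩
      obtain ⟨c1, c2⟩ := h t ⟨i, hi⟩ s₂ b1 ht
      by_cases hl : ℓ ⟨i, hi⟩ = t
      · obtain ⟨d1, d2, d3⟩ := c1 hl
        refine ⟨d1, fun v hv => ?_⟩
        by_cases hvi : v = ⟨i, hi⟩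
        · rw [hvi]; exact d2
        · have : (v : ℕ) ≠ i := fun e => hvi (Fin.ext e)
          exact d3 v hvi (by omega) (b2 v (by omega))
      · have hc := c2 hl
        simp only at hc
        rw [hc]
        refine ⟨b1, fun v hv => b2 v ?_⟩
        by_cases hvi : v = ⟨i, hi⟩
        · subst hvi
          simp only at hv
          omega
        · have : (v : ℕ) ≠ i := fun e => hvi (Fin.ext e)
          omega

end LoopLang

namespace LoopLang

open LoopLang.Expr LoopLang.Stmt SimpleGraph

variable {n k D e c g M L : ℕ} {G H : SimpleGraph (Fin n)} {pos : Fin n → ℕ} {s : Store} {ρ : Env}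

/-! ### Tables used by the search for an embedding -/

/-- The tables computed in advance: adjacency matrices, balls of radius up to `D`, layers. -/
structure Setup (G H : SimpleGraph (Fin n)) (k D : ℕ) (pos : Fin n → ℕ) (s : Store) : Prop where
  adjG : ∀ x y : Fin n, s 1 (n * x + y) ≠ 0 ↔ G.Adj x y
  adjH : ∀ x y : Fin n, s 2 (n * x + y) ≠ 0 ↔ H.Adj x y
  ballG : ∀ r ≤ D, ∀ x < n, ∀ y < n, s 13 (n * (n * r + x) + y) ≠ 0 ↔ nball G r x y
  ballH : ∀ r ≤ D, ∀ x < n, ∀ y < n, s 14 (n * (n * r + x) + y) ≠ 0 ↔ nball H r x y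
  layers : HasLayers H s k pos

theorem Setup.congr (h : Setup G H k D pos s) {s' : Store}
    (h' : ∀ A : Fin 32, A = 1 ∨ A = 2 ∨ A = 11 ∨ A = 12 ∨ A = 13 ∨ A = 14 → s' A = s A) :
    Setup G H k D pos s' := by
  refine ⟨?_, ?_, ?_, ?_, h.layers.layering, h.layers.pos_lt, ?_, ?_⟩
  · rw [h' 1 (by decide)]; exact h.adjG
  · rw [h' 2 (by decide)]; exact h.adjH
  · rw [h' 13 (by decide)]; exact h.ballG
  · rw [h' 14 (by decide)]; exact h.ballH
  · rw [h' 11 (by decide)]; exact h.layers.pos_eq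
  · rw [h' 12 (by decide)]; exact h.layers.upper

/-- The values of the global variables. -/
structure Vars (n D e c g : ℕ) (ρ : Env) : Prop where
  v0 : ρ 0 = n
  v7 : ρ 7 = e
  v8 : ρ 8 = c
  v9 : ρ 9 = c * e
  v12 : ρ 12 = g ^ g
  v13 : ρ 13 = n * g ^ g
  le_e : e ≤ D
  le_c : c ≤ D
  le_ce : c * e ≤ D

theorem Vars.set (h : Vars n D e c g ρ) {x : ℕ} (hx : 15 ≤ x) (i : ℕ) :
    Vars n D e c g (Env.set ρ x i) := by
  obtain ⟨h0, h7, h8, h9, h12, h13, l1, l2, l3⟩ := h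
  refine ⟨?_, ?_, ?_, ?_, ?_, ?_, l1, l2, l3⟩ <;> rw [Env.set_apply, if_neg (by omega)] <;> assumption

/-- Membership in a ball of `G` whose radius is variable `r`. -/
def inBallG (r : ℕ) (x z : Expr) : Expr := read 13 (ix (ix (var r) x) z)

/-- Membership in a ball of `H` whose radius is variable `r`. -/
def inBallH (r : ℕ) (x z : Expr) : Expr := read 14 (ix (ix (var r) x) z)

theorem holds_inBallG (hs : Setup G H k D pos s) (h0 : ρ 0 = n) {r : ℕ} (hr : ρ r ≤ D)
    {x z : Expr} (hx : x.eval L ρ s < n) (hz : z.eval L ρ s < n) :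
    (inBallG r x z).Holds L ρ s ↔ nball G (ρ r) (x.eval L ρ s) (z.eval L ρ s) := by
  rw [inBallG, holds_read _ (by decide), ← hs.ballG _ hr _ hx _ hz]
  simp [h0]

theorem holds_inBallH (hs : Setup G H k D pos s) (h0 : ρ 0 = n) {r : ℕ} (hr : ρ r ≤ D)
    {x z : Expr} (hx : x.eval L ρ s < n) (hz : z.eval L ρ s < n) :
    (inBallH r x z).Holds L ρ s ↔ nball H (ρ r) (x.eval L ρ s) (z.eval L ρ s) := by
  rw [inBallH, holds_read _ (by decide), ← hs.ballH _ hr _ hx _ hz]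
  simp [h0]

/-- Counts the values of `x` below variable `v` that satisfy `c`, each with weight `a`. -/
def count (x v : ℕ) (c a : Expr) : Expr := .sum x v (.ite c a (lit 0))

theorem eval_count {x v : ℕ} {b a : Expr} {P : ℕ → Prop} [DecidablePred P] {A m : ℕ} (hm : ρ v = m)
    (h : ∀ i < m, (b.Holds L (Env.set ρ x i) s ↔ P i) ∧ a.eval L (Env.set ρ x i) s = A) :
    (count x v b a).eval L ρ s = Nat.count P m * A := by
  rw [count, eval_sum, Nat.count_eq_card_filter_range, hm, Finset.card_filter, Finset.sum_mul]
  refine Finset.sum_congr rfl fun i hi => ?_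
  obtain ⟨h1, h2⟩ := h i (Finset.mem_range.1 hi)
  rw [eval_ite, h2, eval_lit]
  by_cases hP : P i
  · rw [if_pos (h1.2 hP), if_pos hP, one_mul]
  · rw [if_neg (mt h1.1 hP), if_neg hP, zero_mul]

/-- The largest number of vertices of a ball of `H` whose radius is variable `10`. -/
def ballSize : Expr :=
  .sum 20 0 (Expr.ex 21 0 (Expr.lt (var 20)
    (count 22 0 (inBallH 10 (var 21) (var 22)) (lit 1)))).bit

/-- A maximum of numbers up to n is evaluated by counting the t < n that at least one of them
exceeds. -/
theorem eval_ballSize (hs : Setup G H k D pos s) (h0 : ρ 0 = n) (hr : ρ 10 ≤ D) :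
    ballSize.eval L ρ s = ballMax H (ρ 10) := by
  classical
  have : ∀ t < n, ((Expr.ex 21 0 (Expr.lt (var 20)
      (count 22 0 (inBallH 10 (var 21) (var 22)) (lit 1)))).Holds L (Env.set ρ 20 t) s ↔
        t < ballMax H (ρ 10)) := by
    intro t ht
    rw [ballMax, Finset.lt_sup_iff, holds_ex]
    have hx : ∀ x : Fin n, (count 22 0 (inBallH 10 (var 21) (var 22)) (lit 1)).eval L
        (Env.set (Env.set ρ 20 t) 21 x) s = Nat.count (nball H (ρ 10) x) n := by
      intro x
      rw [eval_count (P := nball H (ρ 10) x) (A := 1) (m := n) (by simp [h0]), mul_one]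
      intro i hi
      rw [holds_inBallH hs (by simp [h0]) (by simpa using hr) (by simp) (by simpa using hi)]
      simp
    constructor
    · rintro ⟨x, hx', h⟩
      simp only [Env.set_apply, OfNat.zero_ne_ofNat, if_false, h0] at hx'
      rw [holds_lt, hx ⟨x, hx'⟩] at h
      exact ⟨⟨x, hx'⟩, Finset.mem_univ _, by simpa using h⟩
    · rintro ⟨x, -, h⟩
      refine ⟨x, by simp [h0], ?_⟩
      rw [holds_lt, hx x]
      simpa using h
  have h1 := eval_count (L := L) (ρ := ρ) (s := s) (x := 20) (v := 0) (a := lit 1) (A := 1) h0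
    fun i hi => ⟨this i hi, rfl⟩
  have h2 : ballSize.eval L ρ s = _ := h1
  rw [h2, mul_one, Nat.count_eq_card_filter_range]
  have : (Finset.range n).filter (fun t => t < ballMax H (ρ 10)) =
      Finset.range (ballMax H (ρ 10)) := by
    have := ballMax_le H (ρ 10)
    ext t
    simp only [Finset.mem_filter, Finset.mem_range]
    omega
  rw [this, Finset.card_range]

/-! ### The table of views -/

/-- View `(u, w)`, with `u` in variable `25` and `w` in variable `26`, of the ball around variable
`24`, at variable `27`. -/
def viewExpr : Expr :=
  .sum 31 0 (.ite (Expr.and (inBallG 9 (var 25) (var 31))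
    (Expr.eq (count 32 31 (inBallG 9 (var 25) (var 32)) (lit 1))
      (digit (count 30 27 (inBallH 7 (var 24) (var 30)) (var 12)) (var 26)))) (var 31) (lit 0))

/-- The digit table is addressed by position times range. Counting the ball with weight g ^ g yields
that product directly. -/
theorem eval_viewExpr (hs : Setup G H k D pos s) (hv : Vars n D e c g ρ)
    (hd : HasDigits s g g (g ^ g)) (hg : g = ballMax H (c * e * e)) (hce : 1 ≤ c * e) {x u w z : ℕ}
    (hx : x < n) (hu : u < n) (hw : w < g ^ g) (hz : z < n) (h24 : ρ 24 = x) (h25 : ρ 25 = u)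
    (h26 : ρ 26 = w) (h27 : ρ 27 = z) :
    viewExpr.eval L ρ s = view G H e c g x (g ^ g * u + w) z := by
  classical
  rw [view, ix_div _ hw, ix_mod _ hw, viewExpr, nthBelow, eval_sum, hv.v0]
  refine Finset.sum_congr rfl fun v hvn => ?_
  rw [Finset.mem_range] at hvn
  rw [eval_ite]
  refine if_congr ?_ (by simp) (by simp)
  have hv' : Vars n D e c g (Env.set ρ 31 v) := hv.set (by decide) _
  rw [holds_and, holds_eq, holds_inBallG hs hv'.v0 (hv'.v9.trans_le hv.le_ce) (by simpa [h25])
    (by simpa), hv'.v9]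
  rw [eval_count (P := nball G (c * e) u) (A := 1) (m := v) (by simp) (fun i hi => ⟨by
    have hv'' := hv'.set (x := 32) (by decide) i
    rw [holds_inBallG hs hv''.v0 (hv''.v9.trans_le hv.le_ce) (by simpa [h25])
      (by simp; omega), hv''.v9]
    simp [h25], rfl⟩)]
  rw [eval_digit, eval_count (P := nball H e x) (A := g ^ g) (m := z) (by simp [h27])
    (fun i hi => ⟨by
      have hv'' := hv'.set (x := 30) (by decide) i
      rw [holds_inBallH hs hv''.v0 (hv''.v7.trans_le hv.le_e) (by simpa [h24])
        (by simp; omega), hv''.v7]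
      simp [h24], by simp [hv.v12]⟩)]
  have hcount : Nat.count (nball H e x) z ≤ g := by
    refine (Nat.count_monotone _ hz.le).trans ?_
    rw [hg]
    exact count_le_ballMax H (Nat.le_mul_of_pos_left _ hce) ⟨x, hx⟩
  simp only [eval_var, Env.set_apply, Nat.reduceEqDiff, if_false, h26, if_true, h25, mul_one]
  rw [hd _ hcount _ hw]

/-- Array `15` is the table of views. -/
def HasViews (G H : SimpleGraph (Fin n)) (e c g : ℕ) (s : Store) : Prop :=
  ∀ x < n, ∀ a < n * g ^ g, ∀ z < n,
    s 15 (n * (n * g ^ g * x + a) + z) = view G H e c g x a z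

/-- Computes the table of views. -/
def fillViews : Stmt :=
  .loop 24 0 <| .loop 25 0 <| .loop 26 12 <| .loop 27 0 <|
    .write 15 (ix (add (add (mul 13 (var 24)) (mul 12 (var 25))) (var 26)) (var 27)) viewExpr

theorem fillViews_spec (hs : Setup G H k D pos s) (hv : Vars n D e c g ρ)
    (hd : HasDigits s g g (g ^ g)) (hg : g = ballMax H (c * e * e)) (hce : 1 ≤ c * e) :
    HasViews G H e c g (fillViews.run L ρ s) := by
  set W := g ^ g with hW
  have hfill := Fills.loop (L := L) (ρ := ρ) (A := 15) (s₀ := s) (D := ∅) (x := 24) (v := 0)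
    (V := fun k => view G H e c g (k / n / (n * W)) (k / n % (n * W)) (k % n)) (fun i hi => by simp)
    fun x hx => Fills.loop (x := 25) (v := 0) (fun i hi => by simp) fun u hu =>
      Fills.loop (x := 26) (v := 12) (fun i hi => by simp) fun w hw =>
        Fills.loop (x := 27) (v := 0) (fun i hi => by simp) fun z hz =>
          Fills.write (L := L) (ie := ix (add (add (mul 13 (var 24)) (mul 12 (var 25))) (var 26))
            (var 27)) (e := viewExpr) (i := n * (n * W * x + (W * u + w)) + z) (by decide)
            fun s' h1 _ => by
              have hv' := (((hv.set (x := 24) (by decide) x).set (x := 25) (by decide) u).set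
                (x := 26) (by decide) w).set (x := 27) (by decide) z
              simp [hv.v0, hv.v12, ← hW] at hx hu hw hz
              have ha : W * u + w < n * W := by rw [mul_comm n]; exact ix_lt hu hw
              refine ⟨?_, ?_⟩
              · simp [hv.v0, hv.v12, hv.v13, ← hW, add_assoc]
              · rw [ix_div _ hz, ix_mod _ hz, ix_div _ ha, ix_mod _ ha]
                refine eval_viewExpr (hs.congr fun A hA => h1 A ?_) hv' ?_ hg hce hx hu hw hz
                  (by simp) (by simp) (by simp) (by simp)
                · rintro rfl; revert hA; decide
                · unfold HasDigits
                  rw [h1 22 (by decide), h1 23 (by decide)]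
                  exact hd
  have hrun := (hfill s (fun _ _ => rfl) (fun _ _ => rfl)).2.1
  intro x hx a ha z hz
  have hWpos : 0 < W := by
    rcases Nat.eq_zero_or_pos W with h | h
    · rw [← hW, h] at ha; simp at ha
    · exact h
  have ha1 : a / W < n := (Nat.div_lt_iff_lt_mul hWpos).2 ha
  have := hrun (n * (n * W * x + (W * (a / W) + a % W)) + z)
    ⟨x, by rwa [hv.v0], a / W, by simpa [hv.v0], a % W, by simpa [hv.v12] using Nat.mod_lt _ hWpos, z,
      by simpa [hv.v0], rfl⟩
  beta_reduce at this
  rw [Nat.div_add_mod, ix_div _ hz, ix_mod _ hz, ix_div _ ha, ix_mod _ ha] at this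
  exact this

end LoopLang

namespace LoopLang

open LoopLang.Expr LoopLang.Stmt SimpleGraph

variable {n k D e c g M L : ℕ} {G H : SimpleGraph (Fin n)} {pos : Fin n → ℕ} {s : Store} {ρ : Env}

/-! ### Dynamic programming -/

protected def Expr.imp (a b : Expr) : Expr := Expr.or a.not b

@[simp] theorem Expr.holds_imp (a b : Expr) :
    (a.imp b).Holds L ρ s ↔ (a.Holds L ρ s → b.Holds L ρ s) := by
  rw [Expr.imp, holds_or, holds_not]; tauto

/-- Membership in `upper`, for numbers. -/
def nupper (H : SimpleGraph (Fin n)) (pos : Fin n → ℕ) (v w : ℕ) : Prop :=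
  ∃ (hv : v < n) (hw : w < n), ⟨w, hw⟩ ∈ H.upper pos ⟨v, hv⟩

@[simp] theorem nupper_val (v w : Fin n) : nupper H pos v w ↔ w ∈ H.upper pos v := by
  simp [nupper]

open Classical in
theorem count_nupper (hl : H.IsLayering k pos) (v : Fin n) : Nat.count (nupper H pos v) n ≤ k := by
  rw [count_eq_card]
  simp only [nupper_val]
  exact hl.1 v

/-- Membership of `w` in the set `upper` of `v`. -/
def isUpper (v w : Expr) : Expr := read 12 (ix v w)

theorem holds_isUpper (hs : Setup G H k D pos s) (h0 : ρ 0 = n) {v w : Expr}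
    (hv : v.eval L ρ s < n) (hw : w.eval L ρ s < n) :
    (isUpper v w).Holds L ρ s ↔ nupper H pos (v.eval L ρ s) (w.eval L ρ s) := by
  have := hs.layers.upper ⟨_, hv⟩ ⟨_, hw⟩
  rw [← nupper_val] at this
  rw [isUpper, holds_read _ (by decide), ← this]
  simp [h0]

/-- The code of the values in array `16` on the set `upper` of variable `v`. -/
def codeExpr (v : ℕ) : Expr :=
  .sum 30 0 (.ite (isUpper (var v) (var 30)) (count 31 13 (Expr.lt (var 31) (read 16 (var 30)))
    (read 20 (count 32 30 (isUpper (var v) (var 32)) (lit 1)))) (lit 0))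

/-- The place in the table for variable `v` and the values in array `16`. -/
def entryIx (v : ℕ) : Expr := add (.sum 33 v (var 14)) (codeExpr v)

/-- Array `20` has the powers of `N` up to `k`. -/
def HasPowers (s : Store) (N k : ℕ) : Prop := ∀ p ≤ k, s 20 p = N ^ p

theorem count_lt {a m : ℕ} (h : a ≤ m) : Nat.count (fun i => i < a) m = a := by
  rw [Nat.count_eq_card_filter_range]
  have : (Finset.range m).filter (fun t => t < a) = Finset.range a := by
    ext t
    simp only [Finset.mem_filter, Finset.mem_range]
    omega
  rw [this, Finset.card_range]

/-- The language multiplies only by variables, while here a stored value meets a stored power of N.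
The product is evaluated by counting the i below the value, each with the power as its weight. -/
theorem eval_codeExpr (hs : Setup G H k D pos s) (hv : Vars n D e c g ρ)
    (hp : HasPowers s (n * g ^ g) k) {v : ℕ} (hv' : v ∉ [30, 31, 32]) (x : Fin n) (hx : ρ v = x)
    (hσ : ∀ w < n, s 16 w < n * g ^ g) :
    (codeExpr v).eval L ρ s = encode (n * g ^ g) (nupper H pos x) (s 16) n := by
  classical
  simp only [List.mem_cons, List.not_mem_nil, or_false, not_or] at hv'
  rw [codeExpr, encode, eval_sum, hv.v0]
  refine Finset.sum_congr rfl fun w hw => ?_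
  rw [Finset.mem_range] at hw
  rw [eval_ite]
  refine if_congr ?_ ?_ (by simp)
  · rw [holds_isUpper hs (by simp [hv.v0]) (by simp [hv', hx]) (by simpa)]
    simp [hv', hx]
  · rw [eval_count (P := fun i => i < s 16 w) (m := n * g ^ g)
      (A := (n * g ^ g) ^ Nat.count (nupper H pos x) w) (by simp [hv.v13]) (fun i hi => ⟨by simp, ?_⟩),
      count_lt (hσ w hw).le]
    rw [eval_read, eval_count (P := nupper H pos x) (A := 1) (m := w) (by simp) (fun j hj => ⟨by
      rw [holds_isUpper hs (by simp [hv.v0]) (by simp [hv', hx]) (by simp; omega)]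
      simp [hv', hx], rfl⟩), mul_one, if_neg (by simp)]
    exact hp _ ((Nat.count_monotone _ hw.le).trans (count_nupper hs.layers.layering x))

theorem eval_entryIx (hs : Setup G H k D pos s) (hv : Vars n D e c g ρ) (hM : ρ 14 = M)
    (hp : HasPowers s (n * g ^ g) k) {v : ℕ} (hv' : v ∉ [30, 31, 32]) (x : Fin n) (hx : ρ v = x)
    (hσ : ∀ w < n, s 16 w < n * g ^ g) :
    (entryIx v).eval L ρ s = x * M + encode (n * g ^ g) (nupper H pos x) (s 16) n := by
  rw [entryIx, eval_add, eval_codeExpr hs hv hp hv' x hx hσ]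
  simp [hM, hx]

/-! ### Table entries and the admissibility test -/

open Classical in
/-- The table entry for `v` and the values `σ`. -/
noncomputable def entry (H : SimpleGraph (Fin n)) (pos : Fin n → ℕ) (N M : ℕ) (s : Store)
    (v : Fin n) (σ : ℕ → ℕ) : ℕ :=
  if ∀ w : Fin n, σ w < N then s 17 (v * M + encode N (nupper H pos v) σ n) else 0

/-- The value that the view chosen for `x` gives to `z`. -/
def valExpr (x z : Expr) : Expr := read 15 (ix (add (mul 13 x) (read 16 x)) z)

theorem eval_valExpr (hv : Vars n D e c g ρ) (hw : HasViews G H e c g s) {x z : Expr} {a b : ℕ}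
    (hx : x.eval L ρ s = a) (hz : z.eval L ρ s = b) (ha : a < n) (hb : b < n)
    (hσ : ∀ w < n, s 16 w < n * g ^ g) :
    (valExpr x z).eval L ρ s = view G H e c g a (s 16 a) b := by
  have := hw a ha (s 16 a) (hσ a ha) b hb
  simpa [valExpr, hv.v0, hv.v13, hx, hz] using this

/-- The constraints on the value of variable `25` alone. -/
def viewCheck : Expr :=
  Expr.and
    (Expr.all 28 0 (Expr.imp (read 2 (ix (var 25) (var 28)))
      (inBallG 8 (valExpr (var 25) (var 25)) (valExpr (var 25) (var 28)))))
    (Expr.all 28 0 (Expr.imp (read 1 (ix (valExpr (var 25) (var 25)) (var 28)))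
      (Expr.ex 29 0 (Expr.and (inBallH 7 (var 25) (var 29))
        (Expr.eq (valExpr (var 25) (var 29)) (var 28))))))

/-- The constraints between variable `25` and its neighbours in earlier layers. -/
def agreeCheck : Expr :=
  Expr.all 28 0 (Expr.imp (Expr.and (isUpper (var 25) (var 28)) (read 2 (ix (var 25) (var 28))))
    (Expr.all 29 0 (Expr.imp (inBallH 7 (var 25) (var 29)) (Expr.imp (inBallH 7 (var 28) (var 29))
      (Expr.eq (valExpr (var 25) (var 29)) (valExpr (var 28) (var 29)))))))

/-- The condition that the tables for the children of variable `25` have entries. -/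
def childCheck : Expr :=
  Expr.all 28 0 (Expr.imp (isUpper (var 28) (var 25)) (Expr.imp
    (Expr.all 29 0 (Expr.imp (isUpper (var 28) (var 29))
      (Expr.or (Expr.eq (var 29) (var 25)) (isUpper (var 25) (var 29)))))
    (read 17 (entryIx 28))))

theorem holds_viewCheck (hs : Setup G H k D pos s) (hv : Vars n D e c g ρ)
    (hw : HasViews G H e c g s) (x : Fin n) (hx : ρ 25 = x) (hσ : ∀ w < n, s 16 w < n * g ^ g) :
    viewCheck.Holds L ρ s ↔ ViewOk G H e c g x (s 16 x) := by
  have hn : 1 ≤ n := Nat.one_le_of_lt x.2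
  have hlt : ∀ a z, view G H e c g x a z < n := fun _ _ => nthBelow_lt hn
  rw [viewCheck, holds_and]
  refine and_congr ?_ ?_
  · rw [holds_all, hv.v0]
    have : ∀ y : Fin n, (Expr.imp (read 2 (ix (var 25) (var 28)))
        (inBallG 8 (valExpr (var 25) (var 25)) (valExpr (var 25) (var 28)))).Holds L
          (Env.set ρ 28 y) s ↔
        (H.Adj x y → nball G c (view G H e c g x (s 16 x) x) (view G H e c g x (s 16 x) y)) := by
      intro y
      have hv' := hv.set (x := 28) (by decide) (y : ℕ)
      have e1 := eval_valExpr (L := L) hv' hw (x := var 25) (z := var 25) (a := x) (b := x)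
        (by simp [hx]) (by simp [hx]) x.2 x.2 hσ
      have e2 := eval_valExpr (L := L) hv' hw (x := var 25) (z := var 28) (a := x) (b := y)
        (by simp [hx]) (by simp) x.2 y.2 hσ
      rw [holds_imp, holds_read _ (by decide),
        holds_inBallG hs hv'.v0 (hv'.v8.trans_le hv.le_c) (e1 ▸ hlt _ _) (e2 ▸ hlt _ _),
        e1, e2, hv'.v8, ← hs.adjH]
      simp [hv.v0, hx]
    exact ⟨fun h y => (this y).1 (h y y.2), fun h y hy => (this ⟨y, hy⟩).2 (h ⟨y, hy⟩)⟩
  · rw [holds_all, hv.v0]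
    refine ⟨fun h v => ?_, fun h v hvn => ?_⟩
    · rintro ⟨u, hu, huv⟩
      have hv' := hv.set (x := 28) (by decide) (v : ℕ)
      have e1 := eval_valExpr (L := L) hv' hw (x := var 25) (z := var 25) (a := x) (b := x)
        (by simp [hx]) (by simp [hx]) x.2 x.2 hσ
      have := h v v.2
      rw [holds_imp, holds_read _ (by decide), eval_ix, e1, ← hu, eval_var, hv'.v0, Env.set_apply,
        if_pos rfl, hs.adjG, holds_ex] at this
      obtain ⟨z, hz, hz2⟩ := this huv
      rw [hv'.v0] at hz
      have hv'' := hv'.set (x := 29) (by decide) z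
      rw [holds_and, holds_inBallH hs hv''.v0 (hv''.v7.trans_le hv.le_e) (by simp [hx])
        (by simpa), holds_eq, eval_valExpr (L := L) hv'' hw (a := x) (b := z)
        (by simp [hx]) (by simp) x.2 hz hσ, hv''.v7] at hz2
      exact ⟨⟨z, hz⟩, by simpa [hx] using (nball_val H e x ⟨z, hz⟩).1 (by simpa [hx] using hz2.1),
        by simpa using hz2.2⟩
    · have hv' := hv.set (x := 28) (by decide) v
      have e1 := eval_valExpr (L := L) hv' hw (x := var 25) (z := var 25) (a := x) (b := x)
        (by simp [hx]) (by simp [hx]) x.2 x.2 hσ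
      rw [holds_imp, holds_read _ (by decide), eval_ix, e1, eval_var, hv'.v0, Env.set_apply,
        if_pos rfl, holds_ex]
      intro hadj
      obtain ⟨z, hz, hz2⟩ := h ⟨v, hvn⟩ ⟨⟨_, hlt (s 16 x) x⟩, rfl,
        (hs.adjG ⟨_, hlt (s 16 x) x⟩ ⟨v, hvn⟩).1 hadj⟩
      refine ⟨z, by rw [hv'.v0]; exact z.2, ?_⟩
      have hv'' := hv'.set (x := 29) (by decide) (z : ℕ)
      rw [holds_and, holds_inBallH hs hv''.v0 (hv''.v7.trans_le hv.le_e) (by simp [hx])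
        (by simp), holds_eq, eval_valExpr (L := L) hv'' hw (a := x) (b := z)
        (by simp [hx]) (by simp) x.2 z.2 hσ, hv''.v7]
      exact ⟨by simpa [hx] using hz, by simpa using hz2⟩

theorem holds_agreeCheck (hs : Setup G H k D pos s) (hv : Vars n D e c g ρ)
    (hw : HasViews G H e c g s) (x : Fin n) (hx : ρ 25 = x) (hσ : ∀ w < n, s 16 w < n * g ^ g) :
    agreeCheck.Holds L ρ s ↔
      ∀ w ∈ H.upper pos x, H.Adj x w → ViewsAgree G H e c g x (s 16 x) w (s 16 w) := by
  have hn : 1 ≤ n := Nat.one_le_of_lt x.2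
  rw [agreeCheck, holds_all, hv.v0]
  have key : ∀ y : Fin n, (Expr.imp (Expr.and (isUpper (var 25) (var 28))
      (read 2 (ix (var 25) (var 28)))) (Expr.all 29 0 (Expr.imp (inBallH 7 (var 25) (var 29))
        (Expr.imp (inBallH 7 (var 28) (var 29))
      (Expr.eq (valExpr (var 25) (var 29)) (valExpr (var 28) (var 29))))))).Holds L
        (Env.set ρ 28 y) s ↔ (y ∈ H.upper pos x → H.Adj x y →
          ViewsAgree G H e c g x (s 16 x) y (s 16 y)) := by
    intro y
    have hv' := hv.set (x := 28) (by decide) (y : ℕ)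
    rw [holds_imp, holds_and, holds_isUpper hs hv'.v0 (by simp [hx]) (by simp),
      holds_read _ (by decide), holds_all, hv'.v0, and_imp]
    refine imp_congr (by simp [hx]) (imp_congr ?_ ?_)
    · rw [← hs.adjH]
      simp [hv.v0, hx]
    · have key2 : ∀ z : Fin n, (Expr.imp (inBallH 7 (var 25) (var 29))
          (Expr.imp (inBallH 7 (var 28) (var 29)) (Expr.eq (valExpr (var 25) (var 29))
            (valExpr (var 28) (var 29))))).Holds L (Env.set (Env.set ρ 28 y) 29 z) s ↔
          (H.dist x z ≤ e → H.dist y z ≤ e →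
            view G H e c g x (s 16 x) z = view G H e c g y (s 16 y) z) := by
        intro z
        have hv'' := hv'.set (x := 29) (by decide) (z : ℕ)
        rw [holds_imp, holds_imp, holds_inBallH hs hv''.v0 (hv''.v7.trans_le hv.le_e)
          (by simp [hx]) (by simp), holds_inBallH hs hv''.v0 (hv''.v7.trans_le hv.le_e)
          (by simp) (by simp), holds_eq, eval_valExpr (L := L) hv'' hw (a := x) (b := z)
          (by simp [hx]) (by simp) x.2 z.2 hσ, eval_valExpr (L := L) hv'' hw (a := y) (b := z)
          (by simp) (by simp) y.2 z.2 hσ, hv''.v7]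
        simp [hx]
      exact ⟨fun h z => (key2 z).1 (h z z.2), fun h z hz => (key2 ⟨z, hz⟩).2 (h ⟨z, hz⟩)⟩
  exact ⟨fun h y => (key y).1 (h y y.2), fun h y hy => (key ⟨y, hy⟩).2 (h ⟨y, hy⟩)⟩

theorem holds_childCheck (hs : Setup G H k D pos s) (hv : Vars n D e c g ρ) (hM : ρ 14 = M)
    (hp : HasPowers s (n * g ^ g) k) (x : Fin n) (hx : ρ 25 = x)
    (hσ : ∀ w < n, s 16 w < n * g ^ g) :
    childCheck.Holds L ρ s ↔ ∀ u, x ∈ H.upper pos u →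
      (∀ w ∈ H.upper pos u, w = x ∨ w ∈ H.upper pos x) →
        entry H pos (n * g ^ g) M s u (s 16) ≠ 0 := by
  rw [childCheck, holds_all, hv.v0]
  have key : ∀ u : Fin n, (Expr.imp (isUpper (var 28) (var 25)) (Expr.imp
    (Expr.all 29 0 (Expr.imp (isUpper (var 28) (var 29))
      (Expr.or (Expr.eq (var 29) (var 25)) (isUpper (var 25) (var 29)))))
    (read 17 (entryIx 28)))).Holds L (Env.set ρ 28 u) s ↔ (x ∈ H.upper pos u →
      (∀ w ∈ H.upper pos u, w = x ∨ w ∈ H.upper pos x) →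
        entry H pos (n * g ^ g) M s u (s 16) ≠ 0) := by
    intro u
    have hv' := hv.set (x := 28) (by decide) (u : ℕ)
    rw [holds_imp, holds_imp, holds_isUpper hs hv'.v0 (by simp) (by simp [hx]), holds_all, hv'.v0,
      holds_read _ (by decide), eval_entryIx hs hv' (M := M) (by simp [hM]) hp (by decide) u
        (by simp) hσ, entry, if_pos (fun w : Fin n => hσ w w.2)]
    refine imp_congr (by simp [hx]) (imp_congr ?_ Iff.rfl)
    have key2 : ∀ w : Fin n, (Expr.imp (isUpper (var 28) (var 29))
        (Expr.or (Expr.eq (var 29) (var 25)) (isUpper (var 25) (var 29)))).Holds L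
          (Env.set (Env.set ρ 28 u) 29 w) s ↔
        (w ∈ H.upper pos u → w = x ∨ w ∈ H.upper pos x) := by
      intro w
      have hv'' := hv'.set (x := 29) (by decide) (w : ℕ)
      rw [holds_imp, holds_or, holds_isUpper hs hv''.v0 (by simp) (by simp), holds_eq,
        holds_isUpper hs hv''.v0 (by simp [hx]) (by simp)]
      simp [hx, Fin.val_inj]
    exact ⟨fun h z => (key2 z).1 (h z z.2), fun h z hz => (key2 ⟨z, hz⟩).2 (h ⟨z, hz⟩)⟩
  exact ⟨fun h y => (key y).1 (h y y.2), fun h y hy => (key ⟨y, hy⟩).2 (h ⟨y, hy⟩)⟩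

/-- The test of the value of variable `25` in array `16`. -/
def checkExpr : Expr := Expr.and viewCheck (Expr.and agreeCheck childCheck)

theorem holds_checkExpr (hs : Setup G H k D pos s) (hv : Vars n D e c g ρ) (hM : ρ 14 = M)
    (hw : HasViews G H e c g s) (hp : HasPowers s (n * g ^ g) k) (x : Fin n) (hx : ρ 25 = x)
    (hσ : ∀ w < n, s 16 w < n * g ^ g) :
    checkExpr.Holds L ρ s ↔ IsLayering.Admits H pos (ViewOk G H e c g) (ViewsAgree G H e c g)
      (entry H pos (n * g ^ g) M s) x (s 16) := by
  rw [checkExpr, holds_and, holds_and, holds_viewCheck hs hv hw x hx hσ,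
    holds_agreeCheck hs hv hw x hx hσ, holds_childCheck hs hv hM hp x hx hσ]
  rfl

end LoopLang

namespace LoopLang

open LoopLang.Expr LoopLang.Stmt SimpleGraph

variable {n k D e c g M N L : ℕ} {G H : SimpleGraph (Fin n)} {pos : Fin n → ℕ} {s : Store} {ρ : Env}

/-! ### Filling the table -/

theorem encode_lt (hl : H.IsLayering k pos) (v : Fin n) {σ : ℕ → ℕ} (hσ : ∀ w : Fin n, σ w < N) :
    encode N (nupper H pos v) σ n < N ^ k := by
  classical
  have hN : 1 ≤ N := Nat.one_le_of_lt (hσ v)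
  exact (encode_spec hN n fun w hw _ => hσ ⟨w, hw⟩).1.trans_le
    (Nat.pow_le_pow_right hN (count_nupper hl v))

/-- An entry depends on an assignment only through its code on `upper`, and on the store only
through the row of u. -/
theorem entry_congr (hl : H.IsLayering k pos) {s' : Store} {u : Fin n} {σ σ' : ℕ → ℕ}
    (hs : ∀ i < N ^ k, s' 17 (u * N ^ k + i) = s 17 (u * N ^ k + i)) (hσ : ∀ w : Fin n, σ w < N)
    (hσ' : ∀ w : Fin n, σ' w < N) (h : ∀ w ∈ H.upper pos u, σ w = σ' w) :
    entry H pos N (N ^ k) s u σ = entry H pos N (N ^ k) s' u σ' := by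
  have e : encode N (nupper H pos u) σ n = encode N (nupper H pos u) σ' n :=
    encode_congr fun w hw hP => h ⟨w, hw⟩ ((nupper_val u ⟨w, hw⟩).1 hP)
  rw [entry, entry, if_pos hσ, if_pos hσ', ← e, hs _ (encode_lt hl u hσ)]

/-- A child is consulted only if its `upper` set lies in that of x together with x. The test
therefore sees no other values, and it reads only rows of later vertices. -/
theorem admits_congr (hl : H.IsLayering k pos) {un : Fin n → ℕ → Prop}
    {bin : Fin n → ℕ → Fin n → ℕ → Prop} {s' : Store} {x : Fin n} {σ σ' : ℕ → ℕ}
    (hs : ∀ u, x ∈ H.upper pos u → ∀ i < N ^ k, s' 17 (u * N ^ k + i) = s 17 (u * N ^ k + i))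
    (hσ : ∀ w : Fin n, σ w < N) (hσ' : ∀ w : Fin n, σ' w < N) (hx : σ x = σ' x)
    (h : ∀ w ∈ H.upper pos x, σ w = σ' w) :
    IsLayering.Admits H pos un bin (entry H pos N (N ^ k) s) x σ ↔
      IsLayering.Admits H pos un bin (entry H pos N (N ^ k) s') x σ' := by
  unfold IsLayering.Admits
  refine and_congr (by rw [hx]) (and_congr (forall₂_congr fun w hw => by rw [hx, h w hw])
    (forall₃_congr fun u hu hsub => ?_))
  rw [entry_congr hl (hs u hu) hσ hσ']
  intro w hw
  rcases hsub w hw with rfl | h'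
  · exact hx
  · exact h w h'

open Classical in
/-- The values with code `j`. -/
noncomputable def decode (N : ℕ) (P : ℕ → Prop) (j w : ℕ) : ℕ :=
  if P w then j / N ^ Nat.count P w % N else 0

theorem decode_lt (hN : 1 ≤ N) (P : ℕ → Prop) (j w : ℕ) : decode N P j w < N := by
  unfold decode
  split
  · exact Nat.mod_lt _ hN
  · exact hN

theorem update_lt {σ : ℕ → ℕ} (hσ : ∀ w, σ w < N) {a : ℕ} (ha : a < N) (x w : ℕ) :
    Function.update σ x a w < N := by
  rw [Function.update_apply]
  split
  · exact ha
  · exact hσ w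

/-- Puts the values with code variable `26` on the set `upper` of variable `25` into array `16`. -/
def loadCode : Stmt :=
  .loop 27 0 (.write 16 (var 27) (.ite (isUpper (var 25) (var 27))
    (digit (count 32 27 (isUpper (var 25) (var 32)) (var 14)) (var 26)) (lit 0)))

theorem loadCode_spec (hs : Setup G H k D pos s) (h0 : ρ 0 = n) (hM : ρ 14 = N ^ k)
    (hd : HasDigits s N k (N ^ k)) (x : Fin n) (hx : ρ 25 = x) {j : ℕ} (hj : j < N ^ k)
    (h26 : ρ 26 = j) :
    ∀ w < n, loadCode.run L ρ s 16 w = decode N (nupper H pos x) j w := by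
  classical
  have := (run_fill (L := L) (ρ := ρ) (A := 16) (by decide) (s := s) (D := ∅) (x := 27) (v := 0)
    (ie := var 27) (e := .ite (isUpper (var 25) (var 27))
      (digit (count 32 27 (isUpper (var 25) (var 32)) (var 14)) (var 26)) (lit 0))
    (V := decode N (nupper H pos x) j) (fun i => i) (by simp) (by
      intro s' h' _ w hw
      rw [h0] at hw
      refine ⟨by simp, ?_⟩
      have hs' : Setup G H k D pos s' := hs.congr fun A hA => h' A (by rintro rfl; revert hA; decide)
      rw [eval_ite, decode]
      refine if_congr ?_ ?_ (by simp)
      · rw [holds_isUpper hs' (by simp [h0]) (by simp [hx]) (by simpa)]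
        simp [hx]
      · rw [eval_digit, eval_count (P := nupper H pos x) (A := N ^ k) (m := w) (by simp)
          (fun i hi => ⟨by
            rw [holds_isUpper hs' (by simp [h0]) (by simp [hx]) (by simp; omega)]
            simp [hx], by simp [hM]⟩), h' 22 (by decide), h' 23 (by decide)]
        simp only [eval_var, Env.set_apply, Nat.reduceEqDiff, if_false, h26]
        exact hd _ ((Nat.count_monotone _ hw.le).trans (count_nupper hs.layers.layering x)) _ hj)).1
  intro w hw
  exact this w (by rwa [h0])

/-- The place in the table for variable `25` and code variable `26`. -/
def codeIx : Expr := add (.sum 33 25 (var 14)) (var 26)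

/-- Computes the table entry for variable `25` and code variable `26`. -/
def fillEntry : Stmt :=
  .seq (.write 17 codeIx (lit 0)) <| .seq loadCode <|
  .loop 27 13 (.seq (.write 16 (var 25) (var 27))
    (.ite checkExpr (.write 17 codeIx (add (var 27) (lit 1))) .skip))

/-- What the value `t` of the table entry for `x` and `j` should be. -/
def EntryOk (G H : SimpleGraph (Fin n)) (e c g k : ℕ) (pos : Fin n → ℕ) (s : Store) (x : Fin n)
    (j t : ℕ) : Prop :=
  let A : ℕ → Prop := fun a => IsLayering.Admits H pos (ViewOk G H e c g) (ViewsAgree G H e c g)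
      (entry H pos (n * g ^ g) ((n * g ^ g) ^ k) s) x
        (Function.update (decode (n * g ^ g) (nupper H pos x) j) x a)
  (t = 0 ∧ ∀ a < n * g ^ g, ¬ A a) ∨ ∃ a < n * g ^ g, A a ∧ t = a + 1

theorem EntryOk.congr (hl : H.IsLayering k pos) {s' : Store} {x : Fin n} {j t : ℕ}
    (hs : ∀ u, x ∈ H.upper pos u → ∀ i < (n * g ^ g) ^ k,
      s' 17 (u * (n * g ^ g) ^ k + i) = s 17 (u * (n * g ^ g) ^ k + i))
    (h : EntryOk G H e c g k pos s x j t) : EntryOk G H e c g k pos s' x j t := by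
  -- Without any candidate value the test is never consulted. Otherwise decoded values are legal
  -- because there is at least one candidate.
  rcases Nat.eq_zero_or_pos (n * g ^ g) with h0 | hN
  · unfold EntryOk at h ⊢
    rw [h0] at h ⊢
    simpa using h
  have key : ∀ a < n * g ^ g, _ := fun a ha => admits_congr (un := ViewOk G H e c g)
    (bin := ViewsAgree G H e c g) hl hs
    (fun w => update_lt (decode_lt hN (nupper H pos x) j) ha x w)
    (fun w => update_lt (decode_lt hN (nupper H pos x) j) ha x w) rfl (fun _ _ => rfl)
  rcases h with ⟨h1, h2⟩ | ⟨a, ha, h1, h2⟩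
  · exact .inl ⟨h1, fun a ha => mt (key a ha).2 (h2 a ha)⟩
  · exact .inr ⟨a, ha, (key a ha).1 h1, h2⟩

/-- The tables that the dynamic programming relies on. -/
structure DPSetup (G H : SimpleGraph (Fin n)) (k D e c g : ℕ) (pos : Fin n → ℕ) (s : Store) :
    Prop where
  setup : Setup G H k D pos s
  views : HasViews G H e c g s
  pows : HasPowers s (n * g ^ g) k
  digits : HasDigits s (n * g ^ g) k ((n * g ^ g) ^ k)

theorem DPSetup.congr (h : DPSetup G H k D e c g pos s) {s' : Store}
    (h' : ∀ A : Fin 32, A ≠ 16 → A ≠ 17 → s' A = s A) : DPSetup G H k D e c g pos s' := by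
  obtain ⟨h1, h2, h3, h4⟩ := h
  refine ⟨h1.congr fun A hA => h' A ?_ ?_, ?_, ?_, ?_⟩
  · rintro rfl; revert hA; decide
  · rintro rfl; revert hA; decide
  · unfold HasViews; rw [h' 15 (by decide) (by decide)]; exact h2
  · unfold HasPowers; rw [h' 20 (by decide) (by decide)]; exact h3
  · unfold HasDigits; rw [h' 22 (by decide) (by decide), h' 23 (by decide) (by decide)]; exact h4

theorem fillEntry_spec (hs : DPSetup G H k D e c g pos s) (hv : Vars n D e c g ρ)
    (hM : ρ 14 = (n * g ^ g) ^ k) (hN : 1 ≤ n * g ^ g) (x : Fin n) (hx : ρ 25 = x) {j : ℕ}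
    (hj : j < (n * g ^ g) ^ k) (h26 : ρ 26 = j) :
    let s' := fillEntry.run L ρ s
    let i₀ := x * (n * g ^ g) ^ k + j
    (∀ A : Fin 32, A ≠ 16 → A ≠ 17 → s' A = s A) ∧ (∀ i ≠ i₀, s' 17 i = s 17 i) ∧
      EntryOk G H e c g k pos s x j (s' 17 i₀) := by
  intro s' i₀
  set N := n * g ^ g with hNdef
  have hl := hs.setup.layers.layering
  have hix : ∀ (y : ℕ) (s : Store), codeIx.eval L (Env.set ρ 27 y) s = i₀ := by
    intro y s
    simp [codeIx, hx, hM, h26, i₀, hNdef]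
  have hix' : codeIx.eval L ρ s = i₀ := by
    simp [codeIx, hx, hM, h26, i₀, hNdef]
  set s₀ := s.put 17 i₀ 0 with hs₀
  have hs₀' : ∀ A : Fin 32, A ≠ 16 → A ≠ 17 → s₀ A = s A := fun A _ h => Store.put_of_ne _ _ _ h
  have hd₀ := hs.congr hs₀'
  set s₁ := loadCode.run L ρ s₀ with hs₁
  have hs₁' : ∀ A ≠ 16, s₁ A = s₀ A := fun A hA =>
    run_of_not_writes _ _ _ (by simp [loadCode, writes, hA.symm])
  have hload := loadCode_spec (L := L) hd₀.setup hv.v0 hM hd₀.digits x hx hj h26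
  rw [← hs₁] at hload
  have e1 : s' = iter (fun a s => (Stmt.seq (.write 16 (var 25) (var 27))
    (.ite checkExpr (.write 17 codeIx (add (var 27) (lit 1))) .skip)).run L (Env.set ρ 27 a) s) N s₁
    := by
    simp only [s', fillEntry, run_seq, run_loop 27, hv.v13]
    rw [run_write (by decide), hix', eval_lit]
  set σ := decode N (nupper H pos x) j with hσ
  have := iter_induction (n := N) (s := s₁)
    (f := fun a s => (Stmt.seq (.write 16 (var 25) (var 27))
    (.ite checkExpr (.write 17 codeIx (add (var 27) (lit 1))) .skip)).run L (Env.set ρ 27 a) s)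
    (fun m s'' => (∀ A : Fin 32, A ≠ 16 → A ≠ 17 → s'' A = s A) ∧ (∀ i ≠ i₀, s'' 17 i = s 17 i) ∧
      (∀ w < n, w ≠ x → s'' 16 w = σ w) ∧
      ((s'' 17 i₀ = 0 ∧ ∀ a < m, ¬ IsLayering.Admits H pos (ViewOk G H e c g)
          (ViewsAgree G H e c g) (entry H pos N (N ^ k) s) x (Function.update σ x a)) ∨
        ∃ a < N, IsLayering.Admits H pos (ViewOk G H e c g)
          (ViewsAgree G H e c g) (entry H pos N (N ^ k) s) x (Function.update σ x a) ∧
          s'' 17 i₀ = a + 1)) ?_ ?_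
  · rw [← e1] at this
    exact ⟨this.1, this.2.1, this.2.2.2⟩
  · refine ⟨fun A h h' => (hs₁' A h).trans (hs₀' A h h'), fun i hi => ?_, fun w hw _ => hload w hw,
      .inl ⟨?_, by simp⟩⟩
    · rw [hs₁' 17 (by decide), hs₀]; simp [hi]
    · rw [hs₁' 17 (by decide), hs₀]; simp
  · rintro a ha s₂ ⟨a1, a2, a3, a4⟩
    set s₃ := s₂.put 16 x a with hs₃
    have b1 : ∀ A : Fin 32, A ≠ 16 → s₃ A = s₂ A := fun A h => Store.put_of_ne _ _ _ h
    have b2 : ∀ w < n, s₃ 16 w = Function.update σ x a w := by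
      intro w hw
      rw [hs₃, Store.put_apply, Function.update_apply]
      by_cases h : w = x
      · simp [h]
      · simp [h, a3 w hw h]
    have hlt : ∀ w, Function.update σ x a w < N := fun w =>
      update_lt (decode_lt hN (nupper H pos x) j) ha x w
    have hd₃ := hs.congr (s' := s₃) fun A h h' => (b1 A h).trans (a1 A h h')
    have hcheck := holds_checkExpr (L := L) hd₃.setup (hv.set (x := 27) (by decide) a) (M := N ^ k)
      (by simp [hM]) hd₃.views hd₃.pows x (by simp [hx]) (fun w hw => by rw [b2 w hw]; exact hlt w)
    -- The cell being written lies in the row of x, but the test reads rows of later vertices only.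
    -- So it may be evaluated in the initial table.
    rw [← hNdef, ← admits_congr (s := s) hl (σ := Function.update σ x a) ?_ (fun w => hlt w)
      (fun w => by rw [b2 w w.2]; exact hlt w) (b2 x x.2).symm fun w _ => (b2 w w.2).symm] at hcheck
    · rw [run_seq, run_write (by decide)]
      simp only [eval_var, Env.set_apply, Nat.reduceEqDiff, if_false, hx, if_true]
      rw [← hs₃, run_ite]
      split
      case isTrue h =>
        rw [run_write (by decide), hix]
        refine ⟨fun A h h' => ?_, fun i hi => ?_, fun w hw hne => ?_, .inr ⟨a, ha, hcheck.1 h, ?_⟩⟩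
        · rw [Store.put_of_ne _ _ _ h', b1 A h, a1 A h h']
        · rw [Store.put_apply, if_neg (by simp [hi]), b1 17 (by decide), a2 i hi]
        · rw [Store.put_of_ne _ _ _ (by decide), b2 w hw, Function.update_of_ne hne]
        · simp
      case isFalse h =>
        rw [run_skip]
        refine ⟨fun A h h' => (b1 A h).trans (a1 A h h'), fun i hi => ?_, fun w hw hne => ?_, ?_⟩
        · rw [b1 17 (by decide), a2 i hi]
        · rw [b2 w hw, Function.update_of_ne hne]
        · rw [b1 17 (by decide)]
          refine a4.imp (fun ⟨c1, c2⟩ => ⟨c1, fun b hb => ?_⟩) id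
          rcases Nat.lt_succ_iff_lt_or_eq.1 hb with h' | rfl
          · exact c2 b h'
          · exact mt hcheck.2 h
    · intro u hu i hi
      rw [b1 17 (by decide), a2]
      intro e
      have := (mul_add_inj hi hj).1 e
      have h2 := IsLayering.lt_of_mem hu
      rw [Fin.ext this.1] at h2
      omega

/-- Computes the table entries for variable `25`. -/
def fillRow : Stmt := .loop 26 14 fillEntry

theorem fillRow_spec (hs : DPSetup G H k D e c g pos s) (hv : Vars n D e c g ρ)
    (hM : ρ 14 = (n * g ^ g) ^ k) (hN : 1 ≤ n * g ^ g) (x : Fin n) (hx : ρ 25 = x) :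
    let s' := fillRow.run L ρ s
    (∀ A : Fin 32, A ≠ 16 → A ≠ 17 → s' A = s A) ∧
      (∀ u ≠ x, ∀ i < (n * g ^ g) ^ k,
        s' 17 (u * (n * g ^ g) ^ k + i) = s 17 (u * (n * g ^ g) ^ k + i)) ∧
      ∀ j < (n * g ^ g) ^ k,
        EntryOk G H e c g k pos s' x j (s' 17 (x * (n * g ^ g) ^ k + j)) := by
  intro s'
  have hl := hs.setup.layers.layering
  have hne : ∀ u, x ∈ H.upper pos u → u ≠ x := by
    rintro u hu rfl
    exact lt_irrefl _ (IsLayering.lt_of_mem hu)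
  have e1 : s' = iter (fun j s => fillEntry.run L (Env.set ρ 26 j) s) ((n * g ^ g) ^ k) s := by
    simp only [s', fillRow, run_loop, hM]
  have := iter_induction (n := (n * g ^ g) ^ k) (s := s)
    (f := fun j s => fillEntry.run L (Env.set ρ 26 j) s)
    (fun m s'' => (∀ A : Fin 32, A ≠ 16 → A ≠ 17 → s'' A = s A) ∧
      (∀ u ≠ x, ∀ i < (n * g ^ g) ^ k,
        s'' 17 (u * (n * g ^ g) ^ k + i) = s 17 (u * (n * g ^ g) ^ k + i)) ∧
      ∀ j < (n * g ^ g) ^ k, j < m →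
        EntryOk G H e c g k pos s'' x j (s'' 17 (x * (n * g ^ g) ^ k + j)))
    ⟨fun _ _ _ => rfl, fun _ _ _ _ => rfl, by simp⟩ ?_
  · rw [← e1] at this
    exact ⟨this.1, this.2.1, fun j hj => this.2.2 j hj hj⟩
  · rintro j hj s₁ ⟨a1, a2, a3⟩
    obtain ⟨b1, b2, b3⟩ := fillEntry_spec (L := L) (hs.congr a1) (hv.set (x := 26) (by decide) j)
      (by simp [hM]) hN x (by simp [hx]) hj (by simp)
    have hrow : ∀ u ≠ x, ∀ i < (n * g ^ g) ^ k,
        fillEntry.run L (Env.set ρ 26 j) s₁ 17 (u * (n * g ^ g) ^ k + i) =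
          s₁ 17 (u * (n * g ^ g) ^ k + i) := by
      intro u hu i hi
      refine b2 _ fun e => hu (Fin.ext ((mul_add_inj hi hj).1 e).1)
    refine ⟨fun A h h' => (b1 A h h').trans (a1 A h h'), fun u hu i hi =>
      (hrow u hu i hi).trans (a2 u hu i hi), fun i hi hij => ?_⟩
    refine EntryOk.congr (s := s₁) hl (fun u hu i hi => hrow u (hne u hu) i hi) ?_
    rcases Nat.lt_succ_iff_lt_or_eq.1 hij with h | rfl
    · rw [b2 _ fun e => h.ne ((mul_add_inj hi hj).1 e).2]
      exact a3 i hi h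
    · exact b3

/-- Computes the whole table, from the last layer to the first. -/
def fillTable : Stmt :=
  .loop 24 0 (.loop 25 0 (.ite (Expr.eq (read 11 (var 25)) (sub (var 0) (var 24))) fillRow .skip))

theorem fillTable_spec (hs : DPSetup G H k D e c g pos s) (hv : Vars n D e c g ρ)
    (hM : ρ 14 = (n * g ^ g) ^ k) (hN : 1 ≤ n * g ^ g) :
    let s' := fillTable.run L ρ s
    (∀ A : Fin 32, A ≠ 16 → A ≠ 17 → s' A = s A) ∧ ∀ x, ∀ j < (n * g ^ g) ^ k,
        EntryOk G H e c g k pos s' x j (s' 17 (x * (n * g ^ g) ^ k + j)) := by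
  intro s'
  have hl := hs.setup.layers.layering
  have hpos := hs.setup.layers.pos_lt
  have e1 : s' = iter (fun t s => iter (fun v s => (Stmt.ite (Expr.eq (read 11 (var 25))
      (sub (var 0) (var 24))) fillRow .skip).run L (Env.set (Env.set ρ 24 t) 25 v) s) n s) n s := by
    simp [s', fillTable, run_loop, hv.v0]
  rw [e1]
  -- Children come before parents: pass t treats position n - 1 - t. Array `11` stores positions
  -- plus one, which is why the program compares with n - t.
  refine iter_layers (ℓ := fun v => n - 1 - pos v) (fun v => by have := v.2; omega)
    (fun s' => ∀ A : Fin 32, A ≠ 16 → A ≠ 17 → s' A = s A)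
    (fun x s' => ∀ j < (n * g ^ g) ^ k,
        EntryOk G H e c g k pos s' x j (s' 17 (x * (n * g ^ g) ^ k + j))) ?_ fun _ _ _ => rfl
  intro t v s₁ hI ht
  have hd := hs.congr hI
  have hcond : (Expr.eq (read 11 (var 25)) (sub (var 0) (var 24))).Holds L
      (Env.set (Env.set ρ 24 t) 25 v) s₁ ↔ n - 1 - pos v = t := by
    rw [holds_eq]
    have := hpos v
    simp [hd.setup.layers.pos_eq v, hv.v0]
    omega
  obtain ⟨b1, b2, b3⟩ := fillRow_spec (L := L) hd ((hv.set (x := 24) (by decide) t).set (x := 25)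
    (by decide) v) (by simp [hM]) hN v (by simp)
  refine ⟨fun h => ?_, fun h => ?_⟩
  · rw [run_ite, if_pos (hcond.2 h)]
    refine ⟨fun A h h' => (b1 A h h').trans (hI A h h'), b3, fun u hu hut hQ j hj => ?_⟩
    rw [b2 u hu j hj]
    refine EntryOk.congr (s := s₁) hl (fun w hw i hi => b2 w ?_ i hi) (hQ j hj)
    rintro rfl
    have h1 := IsLayering.lt_of_mem hw
    have h2 := hpos w
    omega
  · rw [run_ite, if_neg (mt hcond.1 h), run_skip]

/-! ### Entries for arbitrary assignments -/

open Classical in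
theorem decode_encode (hN : 1 ≤ N) {P : ℕ → Prop} {σ : ℕ → ℕ} (hσ : ∀ w < n, σ w < N) {w : ℕ}
    (hw : w < n) (hP : P w) : decode N P (encode N P σ n) w = σ w := by
  rw [decode, if_pos hP]
  exact (encode_spec hN n fun w hw _ => hσ w hw).2 w hw hP

/-- Table cells are indexed by codes, but decoding the code of σ returns σ on `upper`, which
together with the tentative value at x is all that the test sees. -/
theorem table_spec (hl : H.IsLayering k pos) (hN : 1 ≤ n * g ^ g)
    (h : ∀ x, ∀ j < (n * g ^ g) ^ k,
      EntryOk G H e c g k pos s x j (s 17 (x * (n * g ^ g) ^ k + j))) (x : Fin n) {σ : ℕ → ℕ}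
    (hσ : ∀ w : Fin n, σ w < n * g ^ g) :
    let A : ℕ → Prop := fun a => IsLayering.Admits H pos (ViewOk G H e c g) (ViewsAgree G H e c g)
      (entry H pos (n * g ^ g) ((n * g ^ g) ^ k) s) x (Function.update σ x a)
    let t := entry H pos (n * g ^ g) ((n * g ^ g) ^ k) s x σ
    (t = 0 ∧ ∀ a < n * g ^ g, ¬ A a) ∨ ∃ a < n * g ^ g, A a ∧ t = a + 1 := by
  intro A t
  have hx := h x _ (encode_lt hl x hσ)
  have ht : t = s 17 (x * (n * g ^ g) ^ k + encode (n * g ^ g) (nupper H pos x) σ n) := if_pos hσ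
  rw [← ht] at hx
  have key : ∀ a < n * g ^ g, _ := fun a ha => admits_congr (un := ViewOk G H e c g) (s := s)
    (s' := s) (x := x) (bin := ViewsAgree G H e c g) hl (fun _ _ _ _ => rfl)
    (fun w => update_lt (decode_lt hN (nupper H pos x)
      (encode (n * g ^ g) (nupper H pos x) σ n)) ha x w)
    (σ' := Function.update σ x a) (fun w => by
      rw [Function.update_apply]
      split
      · exact ha
      · exact hσ w) (by simp) (fun w hw => by
      have : (w : ℕ) ≠ x := by
        have := IsLayering.lt_of_mem hw
        intro e
        rw [Fin.ext e] at this
        omega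
      rw [Function.update_of_ne this, Function.update_of_ne this,
        decode_encode hN (fun w hw => hσ ⟨w, hw⟩) w.2 ((nupper_val x w).2 hw)])
  rcases hx with ⟨h1, h2⟩ | ⟨a, ha, h1, h2⟩
  · exact .inl ⟨h1, fun a ha => mt (key a ha).2 (h2 a ha)⟩
  · exact .inr ⟨a, ha, (key a ha).1 h1, h2⟩

end LoopLang

namespace LoopLang

open LoopLang.Expr LoopLang.Stmt SimpleGraph

variable {n k D e c g M N L : ℕ} {G H : SimpleGraph (Fin n)} {pos : Fin n → ℕ} {s : Store} {ρ : Env}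

/-! ### Extraction of a solution -/

/-- The condition that the tables for the vertices without earlier vertices have entries. -/
def rootCheck : Expr :=
  Expr.all 28 0 (Expr.imp (Expr.ex 29 0 (isUpper (var 28) (var 29))).not
    (read 17 (.sum 33 28 (var 14))))

/-- A root has an empty `upper` set, so the only code that occurs for it is 0 and its entry is the
first of its row. -/
theorem holds_rootCheck (hs : Setup G H k D pos s) (h0 : ρ 0 = n) (hM : ρ 14 = M) :
    rootCheck.Holds L ρ s ↔ ∀ v : Fin n, H.upper pos v = ∅ → s 17 (v * M) ≠ 0 := by
  have key : ∀ v : Fin n, (Expr.imp (Expr.ex 29 0 (isUpper (var 28) (var 29))).not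
    (read 17 (.sum 33 28 (var 14)))).Holds L (Env.set ρ 28 v) s ↔
      (H.upper pos v = ∅ → s 17 (v * M) ≠ 0) := by
    intro v
    rw [holds_imp, holds_not, holds_ex, holds_read _ (by decide)]
    refine imp_congr ?_ (by simp [hM])
    rw [Set.eq_empty_iff_forall_notMem, not_exists]
    simp only [Env.set_apply, OfNat.zero_ne_ofNat, if_false, h0]
    constructor
    · intro h w hw
      refine h w ⟨w.2, ?_⟩
      rw [holds_isUpper hs (by simp [h0]) (by simp) (by simp)]
      simpa using hw
    · rintro h w ⟨hw, h'⟩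
      rw [holds_isUpper hs (by simp [h0]) (by simp) (by simpa)] at h'
      exact h ⟨w, hw⟩ ((nupper_val v ⟨w, hw⟩).1 (by simpa using h'))
  rw [rootCheck, holds_all, h0]
  exact ⟨fun h v => (key v).1 (h v v.2), fun h v hv => (key ⟨v, hv⟩).2 (h ⟨v, hv⟩)⟩

/-- Follows the table entries from the first layer to the last. -/
def extract : Stmt :=
  .seq (.loop 24 0 (.write 16 (var 24) (lit 0))) <|
  .loop 24 0 (.loop 25 0 (.ite (Expr.eq (read 11 (var 25)) (add (var 24) (lit 1)))
    (.write 16 (var 25) (sub (read 17 (entryIx 25)) (lit 1))) .skip))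

/-- When v is reached, the values on its `upper` set are final, since they belong to earlier layers.
The final assignment hence satisfies the defining equation at all vertices at once. -/
theorem extract_spec (hs : Setup G H k D pos s) (hp : HasPowers s (n * g ^ g) k)
    (hv : Vars n D e c g ρ) (hM : ρ 14 = (n * g ^ g) ^ k) (hN : 1 ≤ n * g ^ g)
    (hT : ∀ x : Fin n, ∀ j < (n * g ^ g) ^ k, s 17 (x * (n * g ^ g) ^ k + j) ≤ n * g ^ g) :
    let s' := extract.run L ρ s
    (∀ A ≠ 16, s' A = s A) ∧ (∀ w < n, s' 16 w < n * g ^ g) ∧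
      ∀ v : Fin n, s' 16 v = entry H pos (n * g ^ g) ((n * g ^ g) ^ k) s v (s' 16) - 1 := by
  intro s'
  set N := n * g ^ g with hNdef
  have hl := hs.layers.layering
  set s₁ := (Stmt.loop 24 0 (.write 16 (var 24) (lit 0))).run L ρ s with hs₁
  have h16 : ∀ A ≠ 16, s₁ A = s A := fun A hA =>
    run_of_not_writes _ _ _ (by simp [writes, hA.symm])
  have hzero := (run_fill (L := L) (ρ := ρ) (A := 16) (by decide) (s := s) (D := ∅) (x := 24)
    (v := 0) (ie := var 24) (e := lit 0) (V := fun _ => 0) (fun i => i) (by simp) (by simp)).1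
  rw [← hs₁, hv.v0] at hzero
  have e1 : s' = iter (fun t s => iter (fun v s =>
      (Stmt.ite (Expr.eq (read 11 (var 25)) (add (var 24) (lit 1)))
        (.write 16 (var 25) (sub (read 17 (entryIx 25)) (lit 1))) .skip).run L
          (Env.set (Env.set ρ 24 t) 25 v) s) n s) n s₁ := by
    simp only [s', extract, run_seq, ← hs₁]
    simp [run_loop, hv.v0]
  have := iter_layers (n := n) (ℓ := pos) hs.layers.pos_lt (s := s₁)
    (F := fun t v s => (Stmt.ite (Expr.eq (read 11 (var 25)) (add (var 24) (lit 1)))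
        (.write 16 (var 25) (sub (read 17 (entryIx 25)) (lit 1))) .skip).run L
          (Env.set (Env.set ρ 24 t) 25 v) s)
    (fun s' => (∀ A ≠ 16, s' A = s A) ∧ ∀ w < n, s' 16 w < N)
    (fun v s' => s' 16 v = entry H pos N (N ^ k) s v (s' 16) - 1) ?_
    ⟨h16, fun w hw => by rw [hzero w hw]; exact hN⟩
  · rw [← e1] at this
    exact ⟨this.1.1, this.1.2, this.2⟩
  · rintro t v s₂ ⟨a1, a2⟩ ht
    have hs₂ : Setup G H k D pos s₂ := hs.congr fun A hA => a1 A (by rintro rfl; revert hA; decide)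
    have hp₂ : HasPowers s₂ N k := by
      unfold HasPowers; rw [a1 20 (by decide)]; exact hp
    have hcond : (Expr.eq (read 11 (var 25)) (add (var 24) (lit 1))).Holds L
        (Env.set (Env.set ρ 24 t) 25 v) s₂ ↔ pos v = t := by
      rw [holds_eq]
      simp [hs₂.layers.pos_eq v]
    refine ⟨fun h => ?_, fun h => ?_⟩
    · have hent : (sub (read 17 (entryIx 25)) (lit 1)).eval L (Env.set (Env.set ρ 24 t) 25 v) s₂ =
          entry H pos N (N ^ k) s v (s₂ 16) - 1 := by
        rw [eval_sub, eval_read, eval_entryIx hs₂ ((hv.set (x := 24) (by decide) t).set (x := 25)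
          (by decide) v) (M := N ^ k) (by simp [hM]) hp₂ (by decide) v (by simp) a2,
          if_neg (by simp), entry, if_pos fun w : Fin n => a2 w w.2, a1 17 (by decide), eval_lit]
      rw [run_ite, if_pos (hcond.2 h), run_write (by decide), hent]
      simp only [eval_var, Env.set_apply, if_true]
      set a := entry H pos N (N ^ k) s v (s₂ 16) - 1 with ha
      have haN : a < N := by
        have : entry H pos N (N ^ k) s v (s₂ 16) ≤ N := by
          rw [entry, if_pos fun w : Fin n => a2 w w.2]
          exact hT v _ (encode_lt hl v fun w => a2 w w.2)
        omega
      have hb : ∀ w < n, (s₂.put 16 v a) 16 w < N := by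
        intro w hw
        rw [Store.put_apply]
        split
        · exact haN
        · exact a2 w hw
      -- An `upper` set contains strictly earlier vertices only. Assigning v thus leaves the code,
      -- and the entry, of every vertex not later than v unchanged.
      have hsame : ∀ u : Fin n, pos u ≤ pos v →
          entry H pos N (N ^ k) s u ((s₂.put 16 v a) 16) = entry H pos N (N ^ k) s u (s₂ 16) := by
        intro u hu
        refine entry_congr hl (fun _ _ => rfl) (fun w => hb w w.2) (fun w => a2 w w.2)
          fun w hw => ?_
        have := IsLayering.lt_of_mem hw
        rw [Store.put_apply, if_neg]
        rintro ⟨-, e⟩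
        rw [Fin.ext e] at this
        omega
      refine ⟨⟨fun A hA => (Store.put_of_ne _ _ _ hA).trans (a1 A hA), hb⟩, ?_, fun u hu hut hQ => ?_⟩
      · rw [hsame v le_rfl]
        simp [ha]
      · rw [hsame u (by omega), Store.put_apply, if_neg (by simp [Fin.val_inj, hu])]
        exact hQ
    · rw [run_ite, if_neg (mt hcond.1 h), run_skip]

/-- Writes the inverse of the solution to the output. -/
def output : Stmt := .loop 24 0 (.write 0 (add (lit 1) (valExpr (var 24) (var 24))) (var 24))

/-- Writing x at the address of ψ x inverts ψ, and injectivity ensures that no cell is overwritten.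
The bound n < L keeps the writes inside array 0. -/
theorem output_spec (hv : Vars n D e c g ρ) (hw : HasViews G H e c g s) (hL : n < L)
    (hσ : ∀ w < n, s 16 w < n * g ^ g) {ψ : Fin n → Fin n} (hψ : Function.Injective ψ)
    (h : ∀ x, (ψ x : ℕ) = view G H e c g x (s 16 x) x) (x : Fin n) :
    output.run L ρ s 0 (1 + ψ x) = x := by
  rw [output, run_loop, hv.v0]
  refine (iter_induction (n := n) (s := s)
    (f := fun i s => (Stmt.write 0 (add (lit 1) (valExpr (var 24) (var 24))) (var 24)).run L
      (Env.set ρ 24 i) s)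
    (fun m s' => (∀ A ≠ 0, s' A = s A) ∧ ∀ x : Fin n, (x : ℕ) < m → s' 0 (1 + ψ x) = x)
    ⟨fun _ _ => rfl, by simp⟩ ?_).2 x x.2
  rintro i hi s₁ ⟨a1, a2⟩
  have hw₁ : HasViews G H e c g s₁ := by
    unfold HasViews; rw [a1 15 (by decide)]; exact hw
  have e1 : (add (lit 1) (valExpr (var 24) (var 24))).eval L (Env.set ρ 24 i) s₁ =
      1 + ψ ⟨i, hi⟩ := by
    rw [eval_add, eval_valExpr (hv.set (x := 24) (by decide) i) hw₁ (a := i) (b := i) (by simp)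
      (by simp) hi hi (by rwa [a1 16 (by decide)]), h ⟨i, hi⟩, a1 16 (by decide)]
    rfl
  have hlt := (ψ ⟨i, hi⟩).2
  have e2 : (Stmt.write 0 (add (lit 1) (valExpr (var 24) (var 24))) (var 24)).run L
      (Env.set ρ 24 i) s₁ = s₁.put 0 (1 + ψ ⟨i, hi⟩) i := by
    rw [run, e1, if_neg (by omega)]
    simp
  rw [e2]
  refine ⟨fun A hA => (Store.put_of_ne _ _ _ hA).trans (a1 A hA), fun y hy => ?_⟩
  rw [Store.put_apply]
  by_cases hyi : y = ⟨i, hi⟩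
  · subst hyi; simp
  · rw [if_neg, a2 y]
    · have : (y : ℕ) ≠ i := fun e => hyi (Fin.ext e)
      omega
    · rintro ⟨-, e⟩
      exact hyi (hψ (Fin.ext (by omega)))

/-! ### Search for an embedding with given expansion and contraction -/

/-- Decides whether the table has a solution, and outputs it. -/
def readTable : Stmt :=
  .ite rootCheck (.seq extract (.seq output (.write 18 (lit 0) (lit 1)))) .skip

theorem readTable_spec (hs : DPSetup G H k D e c g pos s) (hv : Vars n D e c g ρ)
    (hM : ρ 14 = (n * g ^ g) ^ k) (hN : 1 ≤ n * g ^ g) (hL : n < L) (hG : G.Connected)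
    (hH : H.Connected) (he : 1 ≤ e) (hc : 1 ≤ c) (hg : g = ballMax H (c * e * e))
    (hT : ∀ x, ∀ j < (n * g ^ g) ^ k,
      EntryOk G H e c g k pos s x j (s 17 (x * (n * g ^ g) ^ k + j))) :
    let s' := readTable.run L ρ s
    (s' 18 = s 18 ∧ ¬ ∃ ψ, IsLocalInverse G H e c ψ) ∨
      (s' 18 0 ≠ 0 ∧ ∃ ψ : Fin n → Fin n, IsLocalInverse G H e c ψ ∧
        ∀ x, s' 0 (1 + ψ x) = x) := by
  classical
  intro s'
  set N := n * g ^ g with hNdef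
  have hl := hs.setup.layers.layering
  have htab := fun x σ hσ => table_spec hl hN hT x (σ := σ) hσ
  have e1 : s' = if rootCheck.Holds L ρ s then
      (Stmt.write 18 (lit 0) (lit 1)).run L ρ (output.run L ρ (extract.run L ρ s)) else s := by
    simp only [s', readTable, run_ite, run_seq, run_skip]
  have hroot := holds_rootCheck (L := L) hs.setup hv.v0 hM
  by_cases hr : rootCheck.Holds L ρ s
  · right
    rw [if_pos hr] at e1
    obtain ⟨b1, b2, b3⟩ := extract_spec (L := L) hs.setup hs.pows hv hM hN (fun x j hj => by
      rcases hT x j hj with ⟨h, -⟩ | ⟨a, ha, -, h⟩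
      · rw [h]; exact Nat.zero_le _
      · rw [h]; exact ha)
    set s₁ := extract.run L ρ s with hs₁
    have hw₁ : HasViews G H e c g s₁ := by
      unfold HasViews; rw [b1 15 (by decide)]; exact hs.views
    have hall := IsLayering.table_ne_zero_of_extraction (N := N) (un := ViewOk G H e c g)
      (bin := ViewsAgree G H e c g) (T := entry H pos N (N ^ k) s) hl (fun v σ h => by
        have hσ : ∀ w : Fin n, σ w < N := by
          by_contra hcon
          exact h (if_neg hcon)
        rcases htab v σ hσ with ⟨h', -⟩ | h'
        · exact absurd h' h
        · exact h') (σ := s₁ 16) (fun v hv => by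
        have := hroot.1 hr v hv
        rw [entry, if_pos fun w : Fin n => b2 w w.2]
        have he : encode N (nupper H pos v) (s₁ 16) n = 0 := by
          classical
          refine Finset.sum_eq_zero fun w hw => if_neg ?_
          rintro ⟨hv', hw', h⟩
          rw [hv] at h
          exact h
        rwa [he, add_zero]) b3
    have hviews := isLocalInverse_of_views hH he (fun x => (hall x).2.2.1)
      (IsLayering.bin_of_admits hl (bin := ViewsAgree G H e c g)
        (fun v a w b h z h1 h2 => (h z h2 h1).symm) fun v => (hall v).2.2)
    obtain ⟨ψ, hψ, hψv⟩ := hviews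
    have hout := output_spec hv hw₁ hL b2 (hψ.bijective hG hH).1 hψv
    rw [e1, run_write (by decide)]
    refine ⟨by simp, ψ, hψ, fun x => ?_⟩
    rw [Store.put_of_ne _ _ _ (by decide)]
    exact hout x
  · left
    rw [if_neg hr] at e1
    refine ⟨by rw [e1], ?_⟩
    rintro ⟨ψ, hψ⟩
    -- A local inverse would supply a solution of the constraint problem, and a solution makes all
    -- root entries nonzero, contrary to the failed check.
    obtain ⟨σ, hσ, h1, h2⟩ := exists_views hG hH he hc hψ hg
    refine hr (hroot.2 fun v hv0 => ?_)
    have := IsLayering.table_ne_zero_of_solution (N := N) (un := ViewOk G H e c g) (pos := pos)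
      (bin := ViewsAgree G H e c g) (T := entry H pos N (N ^ k) s) (fun v σ hσ h0 => by
        rcases htab v σ hσ with ⟨-, h'⟩ | ⟨a, -, -, h'⟩
        · exact h'
        · exact absurd (h0.symm.trans h') (Nat.succ_ne_zero a).symm) hσ h1 h2 v
    rw [entry, if_pos hσ] at this
    have he : encode N (nupper H pos v) σ n = 0 := by
      classical
      refine Finset.sum_eq_zero fun w hw => if_neg ?_
      rintro ⟨hv', hw', h⟩
      rw [hv0] at h
      exact h
    rwa [he, add_zero] at this

/-- Builds the table and reads it, with `N` in variable `13`. -/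
def solveTable : Stmt :=
  .seq (powers 20 13 2) <| .letv 14 (read 20 (var 2)) <| .seq (digits 13 2 14) <|
  .seq fillTable readTable

/-- Computes the views and solves the resulting problem, with `g` in variable `11`. -/
def solveViews : Stmt :=
  .seq (powers 20 11 11) <| .letv 12 (read 20 (var 11)) <| .letv 13 (mul 0 (var 12)) <|
  .seq (digits 11 11 12) <| .seq fillViews solveTable

/-- Looks for an embedding with expansion variable `7` and contraction variable `8`. -/
def solve : Stmt :=
  .letv 9 (mul 8 (var 7)) <| .letv 10 (mul 9 (var 7)) <| .letv 11 ballSize solveViews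

theorem solve_spec (hs : Setup G H k D pos s) (h0 : ρ 0 = n) (h2 : ρ 2 = k) (h7 : ρ 7 = e)
    (h8 : ρ 8 = c) (hL : n < L) (hG : G.Connected) (hH : H.Connected) (he : 1 ≤ e) (hc : 1 ≤ c)
    (hD : c * e * e ≤ D) :
    let s' := solve.run L ρ s
    Setup G H k D pos s' ∧ ((s' 18 = s 18 ∧ ¬ ∃ ψ, IsLocalInverse G H e c ψ) ∨
      (s' 18 0 ≠ 0 ∧ ∃ ψ : Fin n → Fin n, IsLocalInverse G H e c ψ ∧
        ∀ x, s' 0 (1 + ψ x) = x)) := by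
  intro s'
  refine ⟨hs.congr fun A hA => ?_, ?_⟩
  · rcases hA with rfl | rfl | rfl | rfl | rfl | rfl <;> exact run_of_not_writes _ _ _ rfl
  have hce : 1 ≤ c * e := Nat.mul_pos hc he
  set g := ballMax H (c * e * e) with hg
  have hg1 : 1 ≤ g := by
    classical
    obtain ⟨x⟩ := hH.nonempty
    refine le_trans ?_ (count_le_ballMax H (Nat.zero_le _ : 0 ≤ c * e * e) x)
    rw [count_eq_card, Nat.one_le_iff_ne_zero, Nat.card_ne_zero]
    exact ⟨⟨⟨x, by simp⟩⟩, inferInstance⟩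
  have hn : 1 ≤ n := by
    obtain ⟨x⟩ := hH.nonempty
    exact Nat.one_le_of_lt x.2
  have hN : 1 ≤ n * g ^ g := Nat.mul_pos hn (Nat.pow_pos hg1)
  set ρ₁ := Env.set (Env.set ρ 9 (c * e)) 10 (c * e * e) with hρ₁
  set ρ₂ := Env.set ρ₁ 11 g with hρ₂
  set s₁ := (powers 20 11 11).run L ρ₂ s with hs₁
  set ρ₃ := Env.set (Env.set ρ₂ 12 (g ^ g)) 13 (n * g ^ g) with hρ₃
  set s₂ := (digits 11 11 12).run L ρ₃ s₁ with hs₂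
  set s₃ := fillViews.run L ρ₃ s₂ with hs₃
  set s₄ := (powers 20 13 2).run L ρ₃ s₃ with hs₄
  set ρ₄ := Env.set ρ₃ 14 ((n * g ^ g) ^ k) with hρ₄
  set s₅ := (digits 13 2 14).run L ρ₄ s₄ with hs₅
  set s₆ := fillTable.run L ρ₄ s₅ with hs₆
  have hpow₁ : s₁ 20 g = g ^ g := by
    have := powers_spec (L := L) (A := 20) (b := 11) (l := 11) (by decide) (by decide) ρ₂ s g
      (by simp [hρ₂])
    simpa [hρ₂] using this
  have hpow₄ : HasPowers s₄ (n * g ^ g) k := by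
    intro p hp
    have := powers_spec (L := L) (A := 20) (b := 13) (l := 2) (by decide) (by decide) ρ₃ s₃ p
      (by simpa [hρ₃, hρ₂, hρ₁, h2])
    simpa [hρ₃] using this
  have e1 : s' = readTable.run L ρ₄ s₆ := by
    have a1 : ballSize.eval L ρ₁ s = g := by
      rw [eval_ballSize hs (by simp [hρ₁, h0]) (by simpa [hρ₁]), hg]
      simp [hρ₁]
    have a2 : (read 20 (var 11)).eval L ρ₂ s₁ = g ^ g := by simp [hρ₂, hpow₁]
    have a3 : (mul 0 (var 12)).eval L (Env.set ρ₂ 12 (g ^ g)) s₁ = n * g ^ g := by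
      simp [hρ₂, hρ₁, h0]
    have a4 : (read 20 (var 2)).eval L ρ₃ s₄ = (n * g ^ g) ^ k := by
      simp [hρ₃, hρ₂, hρ₁, h2, hpow₄ k le_rfl]
    have a5 : (mul 8 (var 7)).eval L ρ s = c * e := by simp [h7, h8]
    have a6 : (mul 9 (var 7)).eval L (Env.set ρ 9 (c * e)) s = c * e * e := by simp [h7]
    simp only [s', solve, solveViews, solveTable, run_letv, run_seq]
    rw [a5, a6, ← hρ₁, a1, ← hρ₂, ← hs₁, a2, a3, ← hρ₃, ← hs₂, ← hs₃, ← hs₄, a4]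
  have hvars : Vars n D e c g ρ₃ := by
    refine ⟨?_, ?_, ?_, ?_, ?_, ?_, ?_, ?_, ?_⟩
    · simp [hρ₃, hρ₂, hρ₁, h0]
    · simp [hρ₃, hρ₂, hρ₁, h7]
    · simp [hρ₃, hρ₂, hρ₁, h8]
    · simp [hρ₃, hρ₂, hρ₁]
    · simp [hρ₃]
    · simp [hρ₃]
    · exact (Nat.le_mul_of_pos_left _ hce).trans hD
    · exact ((Nat.le_mul_of_pos_right _ he).trans (Nat.le_mul_of_pos_right _ he)).trans hD
    · exact (Nat.le_mul_of_pos_right _ he).trans hD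
  have hvars₄ : Vars n D e c g ρ₄ := by
    obtain ⟨v0, v7, v8, v9, v12, v13, l1, l2, l3⟩ := hvars
    exact ⟨by simpa [hρ₄], by simpa [hρ₄], by simpa [hρ₄], by simpa [hρ₄], by simpa [hρ₄],
      by simpa [hρ₄], l1, l2, l3⟩
  have hset : ∀ A : Fin 32, A = 1 ∨ A = 2 ∨ A = 11 ∨ A = 12 ∨ A = 13 ∨ A = 14 →
      s₂ A = s A ∧ s₅ A = s A := by
    intro A hA
    have b1 : s₁ A = s A := by
      rcases hA with rfl | rfl | rfl | rfl | rfl | rfl <;> exact run_of_not_writes _ _ _ rfl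
    have b2 : s₂ A = s₁ A := by
      rcases hA with rfl | rfl | rfl | rfl | rfl | rfl <;> exact run_of_not_writes _ _ _ rfl
    have b3 : s₃ A = s₂ A := by
      rcases hA with rfl | rfl | rfl | rfl | rfl | rfl <;> exact run_of_not_writes _ _ _ rfl
    have b4 : s₄ A = s₃ A := by
      rcases hA with rfl | rfl | rfl | rfl | rfl | rfl <;> exact run_of_not_writes _ _ _ rfl
    have b5 : s₅ A = s₄ A := by
      rcases hA with rfl | rfl | rfl | rfl | rfl | rfl <;> exact run_of_not_writes _ _ _ rfl
    exact ⟨b2.trans b1, b5.trans (b4.trans (b3.trans (b2.trans b1)))⟩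
  have hdig₂ : HasDigits s₂ g g (g ^ g) := by
    have := digits_spec (L := L) (b := 11) (l := 11) (m := 12) (by decide) (by decide) ρ₃
      (by simpa [hρ₃, hρ₂]) s₁
    simpa [hρ₃, hρ₂] using this
  have hviews₃ : HasViews G H e c g s₃ :=
    fillViews_spec (hs.congr fun A hA => (hset A hA).1) hvars hdig₂ hg hce
  have hdp : DPSetup G H k D e c g pos s₅ := by
    refine ⟨hs.congr fun A hA => (hset A hA).2, ?_, ?_, ?_⟩
    · unfold HasViews
      rw [hs₅, run_of_not_writes (A := 15) _ _ _ rfl, hs₄, run_of_not_writes (A := 15) _ _ _ rfl]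
      exact hviews₃
    · unfold HasPowers
      rw [hs₅, run_of_not_writes (A := 20) _ _ _ rfl]
      exact hpow₄
    · have := digits_spec (L := L) (b := 13) (l := 2) (m := 14) (by decide) (by decide) ρ₄
        (by simpa [hρ₄, hρ₃]) s₄
      simpa [hρ₄, hρ₃, hρ₂, hρ₁, h2] using this
  have hM : ρ₄ 14 = (n * g ^ g) ^ k := by simp [hρ₄]
  obtain ⟨f1, f2⟩ := fillTable_spec (L := L) hdp hvars₄ hM hN
  have h18 : s₆ 18 = s 18 := by
    rw [hs₆, run_of_not_writes (A := 18) _ _ _ rfl, hs₅, run_of_not_writes (A := 18) _ _ _ rfl,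
      hs₄, run_of_not_writes (A := 18) _ _ _ rfl, hs₃, run_of_not_writes (A := 18) _ _ _ rfl,
      hs₂, run_of_not_writes (A := 18) _ _ _ rfl, hs₁, run_of_not_writes (A := 18) _ _ _ rfl]
  rw [e1, ← h18]
  exact readTable_spec (hdp.congr f1) hvars₄ hM hN hL hG hH he hc hg f2

end LoopLang

namespace LoopLang

open LoopLang.Expr LoopLang.Stmt SimpleGraph

variable {n k d D L : ℕ} {G H : SimpleGraph (Fin n)} {pos : Fin n → ℕ} {s : Store} {ρ : Env}

/-! ### The main program -/

/-- Copies the matrix that starts at address `a` of the input to array `A`. -/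
def copy (A : Fin 32) (a : Expr) : Stmt :=
  .loop 20 0 (.loop 21 0 (.write A (ix (var 20) (var 21))
    (read 0 (add a (ix (var 20) (var 21))))))

theorem copy_spec {A : Fin 32} (hA : A ≠ 0) {a : Expr} (h0 : ρ 0 = n) {b : ℕ}
    (ha : ∀ i j s, a.eval L (Env.set (Env.set ρ 20 i) 21 j) s = b) (hL : b + n * n ≤ L)
    (x y : Fin n) : (copy A a).run L ρ s A (n * x + y) = s 0 (b + (n * x + y)) := by
  refine (run_fill₂ (L := L) (ρ := ρ) hA (s := s) (D := ∅) (x := 20) (v := 0) (y := 21) (w := 0)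
    (ie := ix (var 20) (var 21)) (e := read 0 (add a (ix (var 20) (var 21))))
    (V := fun k => s 0 (b + k)) (fun i j => n * i + j) (by decide) (by simp) ?_).1 x
      (by rw [h0]; exact x.2) y (by rw [h0]; exact y.2)
  intro s' h' _ i hi j hj
  rw [h0] at hi hj
  have h1 : n * i + j < n * n := ix_lt hi hj
  refine ⟨by simp [h0], ?_⟩
  rw [eval_read, eval_add, ha]
  simp only [eval_ix, eval_var, Env.set_apply, Nat.reduceEqDiff, if_true, if_false,
    OfNat.zero_ne_ofNat, h0]
  rw [if_neg (by omega), h' 0 hA.symm]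

/-- Copies the adjacency matrices and computes the powers of two. -/
def load : Stmt :=
  .seq (copy 1 (lit 2)) <| .seq (copy 2 (add (lit 2) (mul 0 (var 0)))) <|
  .letv 19 (lit 2) (powers 3 19 0)

theorem adjBit_ne_zero (K : SimpleGraph (Fin n)) (x y : Fin n) : adjBit K x y ≠ 0 ↔ K.Adj x y := by
  unfold adjBit
  simp

theorem load_spec (h0 : ρ 0 = n) (hL : L = 2 + 2 * (n * n)) :
    let s' := load.run L ρ (inputStore G H d)
    (∀ x y : Fin n, s' 1 (n * x + y) ≠ 0 ↔ G.Adj x y) ∧ Ctx H s' := by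
  intro s'
  set s := inputStore G H d with hs
  have hin : ∀ x y : Fin n, s 0 (2 + (n * x + y)) = adjBit G x y ∧
      s 0 (2 + n * n + (n * x + y)) = adjBit H x y := by
    intro x y
    have hlt : n * (x : ℕ) + y < n * n := ix_lt x.2 y.2
    have e1 : 2 + (n * (x : ℕ) + y) - 2 = n * x + y := by omega
    have e2 : 2 + n * n + (n * (x : ℕ) + y) - 2 - n * n = n * x + y := by omega
    simp only [hs, inputStore, if_true, inputMemory]
    constructor
    · rw [if_neg (by omega), if_neg (by omega), if_pos (by omega), e1, ix_div _ y.2, ix_mod _ y.2]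
    · rw [if_neg (by omega), if_neg (by omega), if_neg (by omega), if_pos (by omega), e2,
        ix_div _ y.2, ix_mod _ y.2]
  set s₁ := (copy 1 (lit 2)).run L ρ s with hs₁
  set s₂ := (copy 2 (add (lit 2) (mul 0 (var 0)))).run L ρ s₁ with hs₂
  have e : s' = (powers 3 19 0).run L (Env.set ρ 19 2) s₂ := rfl
  refine ⟨fun x y => ?_, fun x y => ?_, fun z hz => ?_⟩
  · rw [e, run_of_not_writes (A := 1) _ _ _ rfl, hs₂, run_of_not_writes (A := 1) _ _ _ rfl, hs₁,
      copy_spec (by decide) h0 (b := 2) (fun _ _ _ => rfl) (by omega), (hin x y).1, adjBit_ne_zero]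
  · rw [e, run_of_not_writes (A := 2) _ _ _ rfl, hs₂,
      copy_spec (by decide) h0 (b := 2 + n * n) (fun _ _ _ => by simp [h0]) (by omega), hs₁,
      run_of_not_writes (A := 0) _ _ _ rfl, (hin x y).2, adjBit_ne_zero]
  · rw [e, powers_spec (by decide) (by decide) _ _ z (by simp [h0]; omega)]
    simp

/-- The condition that `H` is connected. -/
def connCheck : Expr := Expr.all 20 0 (Expr.all 21 0 (read 5 (ix (ix (var 0) (var 20)) (var 21))))

theorem holds_connCheck (h0 : ρ 0 = n) (hn : 1 ≤ n) (hs : HasComps H s 5 Set.univ) :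
    connCheck.Holds L ρ s ↔ H.Connected := by
  have key : ∀ x y : Fin n, s 5 (n * (n * n + x) + y) ≠ 0 ↔ H.Reachable x y := by
    intro x y
    rw [hs x y]
    have : H.within Set.univ = H := by
      ext a b
      exact ⟨fun h => h.1, fun h => ⟨h, trivial, trivial⟩⟩
    show (H.within Set.univ).Reachable x y ↔ _
    rw [this]
  have e : connCheck.Holds L ρ s ↔ ∀ x : Fin n, ∀ y : Fin n, s 5 (n * (n * n + x) + y) ≠ 0 := by
    simp only [connCheck, holds_all, Env.set_apply, OfNat.zero_ne_ofNat, if_false, h0]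
    constructor
    · intro h x y
      have := h x x.2 y y.2
      simpa [h0] using this
    · intro h x hx y hy
      simpa [h0] using h ⟨x, hx⟩ ⟨y, hy⟩
  rw [e]
  constructor
  · intro h
    have : Nonempty (Fin n) := ⟨⟨0, hn⟩⟩
    exact ⟨fun x y => (key x y).1 (h x y)⟩
  · intro h x y
    exact (key x y).2 (h x y)

/-- Tries expansion variable `7` and contraction variable `8`. -/
def tryPair : Stmt :=
  .ite (Expr.and (read 18 (lit 0)).not (Expr.le (mul 7 (var 8)) (var 1))) solve .skip

/-- Tries all pairs. -/
def tryPairs : Stmt :=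
  .loop 15 5 (.loop 16 5 (.letv 7 (add (var 15) (lit 1)) (.letv 8 (add (var 16) (lit 1)) tryPair)))

/-- Either an embedding has been found, or there is none for the parameters in `P`. -/
def Progress (G H : SimpleGraph (Fin n)) (d : ℕ) (P : ℕ → ℕ → Prop) (s : Store) : Prop :=
  (s 18 0 = 0 ∧ ∀ e c, P e c → e * c ≤ d → ¬ ∃ ψ, IsLocalInverse G H e c ψ) ∨
    (s 18 0 ≠ 0 ∧ ∃ e c, e * c ≤ d ∧ ∃ ψ : Fin n → Fin n, IsLocalInverse G H e c ψ ∧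
      ∀ x, s 0 (1 + ψ x) = x)

theorem tryPair_spec {P : ℕ → ℕ → Prop} {e c : ℕ} (hs : Setup G H k (D * (D * D)) pos s)
    (hP : Progress G H d P s) (h0 : ρ 0 = n) (h1 : ρ 1 = min (n * n) d) (h2 : ρ 2 = k)
    (h7 : ρ 7 = e) (h8 : ρ 8 = c) (hL : n < L) (hG : G.Connected) (hH : H.Connected) (he : 1 ≤ e)
    (hc : 1 ≤ c) (heD : e ≤ D) (hcD : c ≤ D) (hD : D ≤ n) :
    let s' := tryPair.run L ρ s
    Setup G H k (D * (D * D)) pos s' ∧ Progress G H d (fun e' c' => P e' c' ∨ e' = e ∧ c' = c) s' := by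
  classical
  intro s'
  have hcond : (Expr.and (read 18 (lit 0)).not (Expr.le (mul 7 (var 8)) (var 1))).Holds L ρ s ↔
      s 18 0 = 0 ∧ e * c ≤ d := by
    -- Variable 1 holds only the minimum of n * n and d. As e and c are at most n, comparing their
    -- product with it is the same as comparing with d.
    have : e * c ≤ n * n := Nat.mul_le_mul (heD.trans hD) (hcD.trans hD)
    rw [holds_and, holds_not, holds_read _ (by decide), holds_le]
    simp [h1, h7, h8, this]
  have e1 : s' = if s 18 0 = 0 ∧ e * c ≤ d then solve.run L ρ s else s := by
    simp only [s', tryPair, run_ite, run_skip, hcond]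
  have hDD : c * e * e ≤ D * (D * D) := by
    rw [mul_assoc]
    exact Nat.mul_le_mul hcD (Nat.mul_le_mul heD heD)
  obtain ⟨b1, b2⟩ := solve_spec (L := L) hs h0 h2 h7 h8 hL hG hH he hc hDD
  rcases hP with ⟨a1, a2⟩ | ⟨a1, a2⟩
  · by_cases hec : e * c ≤ d
    · rw [if_pos ⟨a1, hec⟩] at e1
      rw [e1]
      refine ⟨b1, ?_⟩
      rcases b2 with ⟨c1, c2⟩ | ⟨c1, c2⟩
      · refine .inl ⟨by rw [c1, a1], ?_⟩
        rintro e' c' (h | ⟨rfl, rfl⟩) hd'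
        · exact a2 e' c' h hd'
        · exact c2
      · exact .inr ⟨c1, e, c, hec, c2⟩
    · rw [if_neg fun h => hec h.2] at e1
      rw [e1]
      refine ⟨hs, .inl ⟨a1, ?_⟩⟩
      rintro e' c' (h | ⟨rfl, rfl⟩) hd'
      · exact a2 e' c' h hd'
      · exact absurd hd' hec
  · rw [if_neg fun h => a1 h.1] at e1
    rw [e1]
    exact ⟨hs, .inr ⟨a1, a2⟩⟩

theorem Progress.mono {P Q : ℕ → ℕ → Prop} (h : Progress G H d P s) (hPQ : ∀ e c, Q e c → P e c) :
    Progress G H d Q s :=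
  h.imp_left fun ⟨h1, h2⟩ => ⟨h1, fun e c hq => h2 e c (hPQ e c hq)⟩

theorem tryPairs_spec (hs : Setup G H k (D * (D * D)) pos s) (h18 : s 18 0 = 0) (h0 : ρ 0 = n)
    (h1 : ρ 1 = min (n * n) d) (h2 : ρ 2 = k) (h5 : ρ 5 = D) (hL : n < L) (hG : G.Connected)
    (hH : H.Connected) (hD : D ≤ n) :
    Progress G H d (fun e c => 1 ≤ e ∧ e ≤ D ∧ 1 ≤ c ∧ c ≤ D) (tryPairs.run L ρ s) := by
  have e1 : tryPairs.run L ρ s = iter (fun i s => iter (fun j s =>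
      tryPair.run L (Env.set (Env.set (Env.set (Env.set ρ 15 i) 16 j) 7 (i + 1)) 8 (j + 1)) s) D s)
      D s := by
    simp [tryPairs, run_loop, h5]
  rw [e1]
  refine ((iter_induction (n := D) (fun i s' => Setup G H k (D * (D * D)) pos s' ∧
    Progress G H d (fun e c => 1 ≤ e ∧ e ≤ i ∧ 1 ≤ c ∧ c ≤ D) s') ⟨hs, .inl ⟨h18, ?_⟩⟩ ?_)).2
  · intro e c h
    omega
  · rintro i hi s₁ ⟨a1, a2⟩
    have := iter_induction (n := D) (s := s₁) (f := fun j s =>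
      tryPair.run L (Env.set (Env.set (Env.set (Env.set ρ 15 i) 16 j) 7 (i + 1)) 8 (j + 1)) s)
      (fun j s' => Setup G H k (D * (D * D)) pos s' ∧ Progress G H d (fun e c =>
        1 ≤ e ∧ 1 ≤ c ∧ (e ≤ i ∧ c ≤ D ∨ e = i + 1 ∧ c ≤ j)) s') ⟨a1, a2.mono ?_⟩ ?_
    · refine ⟨this.1, this.2.mono fun e c h => ?_⟩
      omega
    · intro e c h
      omega
    · rintro j hj s₂ ⟨b1, b2⟩
      obtain ⟨c1, c2⟩ := tryPair_spec (L := L) (e := i + 1) (c := j + 1)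
        (ρ := Env.set (Env.set (Env.set (Env.set ρ 15 i) 16 j) 7 (i + 1)) 8 (j + 1)) b1 b2
        (by simp [h0]) (by simp [h1]) (by simp [h2]) (by simp) (by simp) hL hG hH (by omega)
        (by omega) (by omega) (by omega) hD
      refine ⟨c1, c2.mono fun e c h => ?_⟩
      omega

/-- Finds the layers. -/
def findLayers : Stmt :=
  .seq (.letv 3 (add (var 0) (lit 1)) findWidth) (.loop 26 0 placeLayer)

/-- The search for an embedding into a connected graph. -/
def search : Stmt :=
  .seq findLayers <| .letv 2 (sub (read 10 (lit 0)) (lit 1)) <|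
  .letv 5 (sub (var 0) (sub (var 0) (var 1))) <| .letv 6 (mul 5 (mul 5 (var 5))) <|
  .seq (levels 1 13 6) <| .seq (levels 2 14 6) <| .seq tryPairs
  (.write 0 (lit 0) (read 18 (lit 0)).bit)

theorem findLayers_spec (h0 : ρ 0 = n) (hs : Ctx H s) (h9 : s 9 = 0) (h10 : s 10 = 0)
    (h11 : s 11 = 0) (hH : H.Connected) :
    let s' := findLayers.run L ρ s
    Ctx H s' ∧ ∃ k pos, k ≤ n ∧ s' 10 0 = k + 1 ∧ HasLayers H s' k pos ∧
      ∀ k' < k, ¬ ∃ pos, H.IsLayering k' pos := by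
  intro s'
  refine ⟨hs.run _ _ rfl rfl, ?_⟩
  obtain ⟨b1, k, hk, b2, b3, b4, b5⟩ := findWidth_spec (L := L) (ρ := Env.set ρ 3 (n + 1))
    (by simp [h0]) (by simp) hs h9 h10 hH
  set s₁ := findWidth.run L (Env.set ρ 3 (n + 1)) s with hs₁
  have e1 : s' = (Stmt.loop 26 0 placeLayer).run L ρ s₁ := by
    simp [s', findLayers, h0, hs₁]
  obtain ⟨pos, hpos⟩ := placeLayers_spec (L := L) h0 b1 b3 b4
    (by rw [hs₁, run_of_not_writes (A := 11) _ _ _ rfl, h11]) hH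
  rw [← e1] at hpos
  refine ⟨k, pos, hk, ?_, hpos, b5⟩
  rw [e1, run_of_not_writes (A := 10) _ _ _ rfl, b2]

theorem setup_of_levels (hG : G.Connected) (hH : H.Connected) (hs : Ctx H s)
    (hs1 : ∀ x y : Fin n, s 1 (n * x + y) ≠ 0 ↔ G.Adj x y) (hl : HasLayers H s k pos)
    (h0 : ρ 0 = n) (h6 : ρ 6 = D) :
    Setup G H k D pos ((levels 2 14 6).run L ρ ((levels 1 13 6).run L ρ s)) := by
  set s₂ := (levels 1 13 6).run L ρ s with hs₂
  set s₃ := (levels 2 14 6).run L ρ s₂ with hs₃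
  have h2 : ∀ A : Fin 32, A ≠ 13 → A ≠ 14 → s₃ A = s A := fun A h h' =>
    (levels_frame h' _ _ _).trans (levels_frame h _ _ _)
  refine ⟨?_, ?_, ?_, ?_, hl.layering, hl.pos_lt, ?_, ?_⟩
  · rw [h2 1 (by decide) (by decide)]; exact hs1
  · rw [h2 2 (by decide) (by decide)]; exact hs.adj
  · intro r hr x hx y hy
    rw [hs₃, levels_frame (by decide), hs₂]
    have := levels_spec (L := L) (A := 1) (B := 13) (r := 6) (ρ := ρ) (s := s) (by decide)
      (by decide) (by decide) r (by rwa [h6]) x (by rwa [h0]) y (by rwa [h0])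
    rw [h0] at this
    rw [this, within_iff_dist hG hs1 r ⟨x, hx⟩ ⟨y, hy⟩]
    exact (nball_val G r ⟨x, hx⟩ ⟨y, hy⟩).symm
  · intro r hr x hx y hy
    have := levels_spec (L := L) (A := 2) (B := 14) (r := 6) (ρ := ρ) (s := s₂) (by decide)
      (by decide) (by decide) r (by rwa [h6]) x (by rwa [h0]) y (by rwa [h0])
    rw [h0] at this
    rw [hs₃, this, within_iff_dist hH (by
      rw [hs₂, levels_frame (by decide)]; exact hs.adj) r ⟨x, hx⟩ ⟨y, hy⟩]
    exact (nball_val H r ⟨x, hx⟩ ⟨y, hy⟩).symm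
  · rw [h2 11 (by decide) (by decide)]; exact hl.pos_eq
  · rw [h2 12 (by decide) (by decide)]; exact hl.upper

theorem connected_of_distortionAtMost (hG : G.Connected) (hd : 1 ≤ d) {f : Fin n → Fin n}
    (hf : Function.Bijective f) (h : DistortionAtMost G H d f) : H.Connected :=
  (IsLocalInverse.exists_of_distortionAtMost hG hd hf h).1

theorem search_spec (hL : n < L) (hG : G.Connected) (hd : 1 ≤ d) (h0 : ρ 0 = n)
    (h1 : ρ 1 = min (n * n) d) (hs : Ctx H s)
    (hs1 : ∀ x y : Fin n, s 1 (n * x + y) ≠ 0 ↔ G.Adj x y)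
    (hz : ∀ A : Fin 32, A = 9 ∨ A = 10 ∨ A = 11 ∨ A = 18 → s A = 0) (hH : H.Connected) :
    IsCorrectAnswer G H d (search.run L ρ s 0) := by
  classical
  have hn : 1 ≤ n := by
    obtain ⟨x⟩ := hH.nonempty
    exact Nat.one_le_of_lt x.2
  obtain ⟨a1, k, pos, hk, a2, a3, -⟩ := findLayers_spec (L := L) h0 hs (hz 9 (by decide))
    (hz 10 (by decide)) (hz 11 (by decide)) hH
  set s₁ := findLayers.run L ρ s with hs₁
  set D := min n d with hD
  set ρ₁ := Env.set (Env.set (Env.set ρ 2 k) 5 D) 6 (D * (D * D)) with hρ₁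
  set s₂ := (levels 1 13 6).run L ρ₁ s₁ with hs₂
  set s₃ := (levels 2 14 6).run L ρ₁ s₂ with hs₃
  set s₄ := tryPairs.run L ρ₁ s₃ with hs₄
  have e1 : search.run L ρ s = s₄.put 0 0 (if s₄ 18 0 ≠ 0 then 1 else 0) := by
    have c1 : (sub (read 10 (lit 0)) (lit 1)).eval L ρ s₁ = k := by simp [a2]
    -- Truncated subtraction gives n - (n - a) = min n a. As n ≤ n * n, the earlier capping of d at
    -- n * n does not affect min n d.
    have c2 : (sub (var 0) (sub (var 0) (var 1))).eval L (Env.set ρ 2 k) s₁ = D := by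
      have : n ≤ n * n := Nat.le_mul_of_pos_left _ hn
      simp [h0, h1]
      omega
    simp only [search, run_seq, run_letv, ← hs₁]
    rw [c1, c2]
    have c3 : (mul 5 (mul 5 (var 5))).eval L (Env.set (Env.set ρ 2 k) 5 D) s₁ = D * (D * D) := by
      simp
    rw [c3, ← hρ₁, ← hs₂, ← hs₃, ← hs₄, run, eval_bit]
    simp only [eval_lit, true_and]
    rw [if_neg (by omega)]
    congr 1
    refine if_congr ?_ rfl rfl
    rw [holds_read _ (by decide)]
    simp
  have h18 : s₃ 18 = s 18 :=
    ((levels_frame (by decide) _ _ _).trans (levels_frame (by decide) _ _ _)).trans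
      (run_of_not_writes _ _ _ rfl)
  have hρ₁0 : ρ₁ 0 = n := by simp [hρ₁, h0]
  have hset : Setup G H k (D * (D * D)) pos s₃ := by
    refine setup_of_levels hG hH a1 ?_ a3 hρ₁0 (by simp [hρ₁])
    rw [hs₁, run_of_not_writes (A := 1) _ _ _ rfl]
    exact hs1
  have hprog := tryPairs_spec (L := L) (d := d) (ρ := ρ₁) (D := D) hset
    (by rw [h18, hz 18 (by decide)]; rfl)
    hρ₁0 (by simp [hρ₁, h1]) (by simp [hρ₁]) (by simp [hρ₁]) hL hG hH (Nat.min_le_left _ _)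
  rw [← hs₄] at hprog
  rw [e1]
  rcases hprog with ⟨b1, b2⟩ | ⟨b1, e, c, hec, ψ, hψ, hout⟩
  · right
    refine ⟨by simp [b1], ?_⟩
    rintro ⟨F, hF, hdist⟩
    obtain ⟨-, e, c, h1, h2, h3, h4, h5, h6⟩ := IsLocalInverse.exists_of_distortionAtMost hG hd hF
      hdist
    exact b2 e c ⟨h1, h2, h3, h4⟩ h5 h6
  · left
    refine ⟨by simp [b1], ?_⟩
    obtain ⟨F, hF1, hF2⟩ := Function.bijective_iff_has_inverse.1 (hψ.bijective hG hH)
    refine ⟨F, fun i => ?_, hψ.distortionAtMost hG hH hec hF1⟩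
    have := hout (F i)
    rw [hF2] at this
    rw [Store.put_apply, if_neg (by omega), this]

/-- Computes the components of `H`. -/
def conns : Stmt := comps 4 5 (lit 1) (lit 1)

/-- The program. -/
def main : Stmt :=
  .letv 0 (read 0 (lit 0)) <|
  .letv 1 (sub (mul 0 (var 0)) (sub (mul 0 (var 0)) (read 0 (lit 1)))) <|
  .seq load <| .seq conns (.ite connCheck search (.write 0 (lit 0) (lit 0)))

/-- The environment after the input has been read. -/
def mainEnv (n d : ℕ) : Env := Env.set (Env.set (fun _ => 0) 0 n) 1 (min (n * n) d)

theorem main_run (s : Store) (h0 : s 0 0 = n) (h1 : s 0 1 = d) (hL : 1 < L) :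
    main.run L (fun _ => 0) s =
      (Stmt.ite connCheck search (.write 0 (lit 0) (lit 0))).run L (mainEnv n d)
        (conns.run L (mainEnv n d) (load.run L (mainEnv n d) s)) := by
  have e1 : (read 0 (lit 0)).eval L (fun _ => 0) s = n := by
    rw [eval_read, eval_lit, if_neg (by omega), h0]
  have e2 : (sub (mul 0 (var 0)) (sub (mul 0 (var 0)) (read 0 (lit 1)))).eval L
      (Env.set (fun _ => 0) 0 n) s = min (n * n) d := by
    rw [eval_sub, eval_sub, eval_read, eval_lit, if_neg (by omega), h1]
    simp
    omega
  simp only [main, run_letv, run_seq, e1, e2, mainEnv]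

theorem conns_spec (hs : Ctx H s) (h0 : ρ 0 = n) :
    let s' := conns.run L ρ s
    (∀ A : Fin 32, A ≠ 4 → A ≠ 5 → s' A = s A) ∧ HasComps H s' 5 Set.univ :=
  ⟨fun _ h4 h5 => comps_frame h4 h5 _ _ _ _,
    comps_spec (by decide) (by decide) (by decide) (by decide) h0 hs _ (by simp [Holds])⟩

theorem main_spec (hG : G.Connected) (hd : 1 ≤ d) :
    IsCorrectAnswer G H d
      (main.run (2 + 2 * (n * n)) (fun _ => 0) (inputStore G H d) 0) := by
  classical
  have hn : 1 ≤ n := by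
    obtain ⟨x⟩ := hG.nonempty
    exact Nat.one_le_of_lt x.2
  set L := 2 + 2 * (n * n) with hL
  have hnn : n ≤ n * n := Nat.le_mul_of_pos_left _ hn
  rw [main_run (n := n) (d := d) _ (by simp [inputStore, inputMemory])
    (by simp [inputStore, inputMemory]) (by omega)]
  have h0 : mainEnv n d 0 = n := by simp [mainEnv]
  set ρ := mainEnv n d with hρ
  obtain ⟨a1, a2⟩ := load_spec (G := G) (H := H) (d := d) h0 hL
  set s₁ := load.run L ρ (inputStore G H d) with hs₁
  obtain ⟨b1, b2⟩ := conns_spec (L := L) a2 h0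
  set s₂ := conns.run L ρ s₁ with hs₂
  have hc := holds_connCheck (L := L) h0 hn b2
  rw [run_ite]
  split
  case isTrue h =>
    refine search_spec (by omega) hG hd h0 (by simp [hρ, mainEnv])
      (a2.congr (b1 2 (by decide) (by decide)) (b1 3 (by decide) (by decide)))
      (by rw [b1 1 (by decide) (by decide)]; exact a1) (fun A hA => ?_) (hc.1 h)
    have h4 : A ≠ 4 ∧ A ≠ 5 := by rcases hA with rfl | rfl | rfl | rfl <;> decide
    rw [b1 A h4.1 h4.2, hs₁]
    rcases hA with rfl | rfl | rfl | rfl <;> rw [run_of_not_writes _ _ _ rfl] <;> rfl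
  -- A disconnected `H` receives no bijection of finite expansion, so the answer 0 is correct
  -- without a search.
  case isFalse h =>
    refine .inr ⟨?_, ?_⟩
    · rw [run]
      simp [hL]
    · rintro ⟨F, hF, hdist⟩
      exact h (hc.2 (connected_of_distortionAtMost hG hd hF hdist))

end LoopLang

namespace LoopLang

open LoopLang.Expr LoopLang.Stmt SimpleGraph

variable {n k d D e c f m γ L : ℕ} {G H : SimpleGraph (Fin n)} {pos : Fin n → ℕ} {s : Store}
  {ρ : Env}

/-! ### Running time -/

/-- Weights of the variables of the program. -/
def weights : Wt
  | 1 => ⟨1, 2, 0, 0⟩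
  | 3 => ⟨2, 1, 0, 0⟩
  | 4 => ⟨1, 0, 0, 1⟩
  | 5 => ⟨1, 0, 1, 0⟩
  | 6 => ⟨1, 0, 1, 0⟩
  | 7 => ⟨1, 0, 1, 0⟩
  | 8 => ⟨1, 0, 1, 0⟩
  | 9 => ⟨1, 0, 1, 0⟩
  | 10 => ⟨1, 0, 1, 0⟩
  | 11 => ⟨1, 0, 1, 0⟩
  | 12 => ⟨1, 0, 1, 0⟩
  | 13 => ⟨1, 1, 1, 0⟩
  | 14 => ⟨1, 0, 0, 1⟩
  | 19 => ⟨2, 0, 0, 0⟩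
  | _ => ⟨1, 1, 0, 0⟩

theorem ballMax_mono (K : SimpleGraph (Fin n)) {r r' : ℕ} (h : r ≤ r') :
    ballMax K r ≤ ballMax K r' :=
  Finset.sup_le fun x _ => count_le_ballMax K h x

theorem one_le_ballMax (hn : 1 ≤ n) (K : SimpleGraph (Fin n)) (r : ℕ) : 1 ≤ ballMax K r := by
  classical
  refine le_trans ?_ (count_le_ballMax K (Nat.zero_le r) ⟨0, hn⟩)
  rw [count_eq_card, Nat.one_le_iff_ne_zero, Nat.card_ne_zero]
  exact ⟨⟨⟨⟨0, hn⟩, ⟨hn, hn, by simp⟩⟩⟩, inferInstance⟩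

theorem self_le_pow_self {g : ℕ} (hg : 1 ≤ g) : g ≤ g ^ g :=
  Nat.le_self_pow (by omega) g

/-- The values bound for one pair are dominated by parameters common to all pairs: radii by D, the
actual g and g ^ g by γ ^ γ, and the table size by (n * γ ^ γ) ^ k. -/
theorem solve_bounded (hs : Setup G H k D pos s) (h0 : ρ 0 = n) (h2 : ρ 2 = k) (h7 : ρ 7 = e)
    (h8 : ρ 8 = c) (hn : 1 ≤ n) (he : 1 ≤ e) (hD : c * e * e ≤ D)
    {w : Wt} (hw : ∀ x ∈ [9, 10, 11, 12, 13, 14], w x = weights x) (hDf : D ≤ f)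
    (hγ : ballMax H (c * e * e) ≤ γ) (hγf : γ ^ γ ≤ f) (hk : (n * γ ^ γ) ^ k ≤ m) :
    solve.Bounded L n f m w ρ s := by
  set g := ballMax H (c * e * e) with hg
  have hg1 : 1 ≤ g := one_le_ballMax hn H _
  have hgγ : g ^ g ≤ γ ^ γ := Nat.pow_le_pow_left hγ g |>.trans (Nat.pow_le_pow_right (by omega) hγ)
  have hec : c * e ≤ c * e * e := Nat.le_mul_of_pos_right _ he
  set ρ₁ := Env.set (Env.set ρ 9 (c * e)) 10 (c * e * e) with hρ₁
  set ρ₂ := Env.set ρ₁ 11 g with hρ₂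
  set s₁ := (powers 20 11 11).run L ρ₂ s with hs₁
  set ρ₃ := Env.set (Env.set ρ₂ 12 (g ^ g)) 13 (n * g ^ g) with hρ₃
  have a1 : ballSize.eval L ρ₁ s = g := by
    rw [eval_ballSize hs (by simp [hρ₁, h0]) (by simpa [hρ₁]), hg]
    simp [hρ₁]
  have a2 : (read 20 (var 11)).eval L ρ₂ s₁ = g ^ g := by
    have := powers_spec (L := L) (A := 20) (b := 11) (l := 11) (by decide) (by decide) ρ₂ s g
      (by simp [hρ₂])
    simpa [hρ₂] using this
  have a3 : (mul 0 (var 12)).eval L (Env.set ρ₂ 12 (g ^ g)) s₁ = n * g ^ g := by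
    simp [hρ₂, hρ₁, h0]
  have a4 : ∀ s, (read 20 (var 2)).eval L ρ₃ ((powers 20 13 2).run L ρ₃ s) = (n * g ^ g) ^ k := by
    intro s
    have := powers_spec (L := L) (A := 20) (b := 13) (l := 2) (by decide) (by decide) ρ₃ s k
      (by simp [hρ₃, hρ₂, hρ₁, h2])
    simpa [hρ₃, hρ₂, hρ₁, h2] using this
  have a5 : (mul 8 (var 7)).eval L ρ s = c * e := by simp [h7, h8]
  have a6 : (mul 9 (var 7)).eval L (Env.set ρ 9 (c * e)) s = c * e * e := by simp [h7]
  simp only [solve, solveViews, solveTable, Stmt.Bounded]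
  rw [a5, a6, ← hρ₁, a1, ← hρ₂, ← hs₁, a2, a3, ← hρ₃, a4]
  rw [hw 9 (by decide), hw 10 (by decide), hw 11 (by decide), hw 12 (by decide), hw 13 (by decide),
    hw 14 (by decide)]
  simp only [weights, Bd.val, pow_zero, pow_one, one_mul, mul_one]
  refine ⟨hec.trans (hD.trans hDf), hD.trans hDf, ?_, bounded_of_letFree _ _ _ _ rfl,
    hgγ.trans hγf, Nat.mul_le_mul_left _ (hgγ.trans hγf), bounded_of_letFree _ _ _ _ rfl,
    bounded_of_letFree _ _ _ _ rfl, bounded_of_letFree _ _ _ _ rfl, ?_,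
    bounded_of_letFree _ _ _ _ rfl, bounded_of_letFree _ _ _ _ rfl, bounded_of_letFree _ _ _ _ rfl⟩
  · exact (self_le_pow_self hg1).trans (hgγ.trans hγf)
  · exact (Nat.pow_le_pow_left (Nat.mul_le_mul_left _ hgγ) _).trans hk

/-- The search runs only if e * c ≤ d. With e ≤ d the radius c * e * e is then at most d * d,
instead of the d ^ 3 that the ranges of e and c would allow. -/
theorem tryPair_bounded (hs : Setup G H k (D * (D * D)) pos s) (h0 : ρ 0 = n)
    (h1 : ρ 1 = min (n * n) d) (h2 : ρ 2 = k) (h7 : ρ 7 = e) (h8 : ρ 8 = c) (hn : 1 ≤ n)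
    (he : 1 ≤ e) (heD : e ≤ D) (hcD : c ≤ D) (hD : D ≤ d)
    {w : Wt} (hw : ∀ x ∈ [9, 10, 11, 12, 13, 14], w x = weights x) (hDf : D * (D * D) ≤ f)
    (hγ : ballMax H (d * d) ≤ γ) (hγf : γ ^ γ ≤ f) (hk : (n * γ ^ γ) ^ k ≤ m) :
    tryPair.Bounded L n f m w ρ s := by
  have hcond : (Expr.and (read 18 (lit 0)).not (Expr.le (mul 7 (var 8)) (var 1))).Holds L ρ s →
      e * c ≤ d := by
    rw [holds_and, holds_not, holds_read _ (by decide), holds_le]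
    simp only [eval_mul, h7, eval_var, h8, h1]
    exact fun h => h.2.trans (Nat.min_le_right _ _)
  unfold tryPair
  rw [Stmt.Bounded]
  split
  · trivial
  · next hne =>
    have hec := hcond hne
    refine solve_bounded hs h0 h2 h7 h8 hn he ?_ hw hDf ((ballMax_mono H ?_).trans hγ) hγf hk
    · rw [mul_assoc]
      exact Nat.mul_le_mul hcD (Nat.mul_le_mul heD heD)
    · rw [mul_comm c e]
      exact Nat.mul_le_mul hec (heD.trans hD)

theorem iter_of_not_writes {A : Fin 32} {p : ℕ → Stmt} {ρ : ℕ → Env} {n : ℕ}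
    (h : ∀ i, (p i).writes A = false) :
    iter (fun i s => (p i).run L (ρ i) s) n s A = s A :=
  iter_induction (fun _ (s' : Store) => s' A = s A) rfl fun i _ _ h' =>
    (run_of_not_writes _ _ _ (h i)).trans h'

theorem tryPairs_bounded (hs : Setup G H k (D * (D * D)) pos s) (h0 : ρ 0 = n)
    (h1 : ρ 1 = min (n * n) d) (h2 : ρ 2 = k) (h5 : ρ 5 = D) (hn : 1 ≤ n) (hD : D ≤ d)
    (hDD : D ≤ f) (hDf : D * (D * D) ≤ f) (hγ : ballMax H (d * d) ≤ γ) (hγf : γ ^ γ ≤ f)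
    (hk : (n * γ ^ γ) ^ k ≤ m) : tryPairs.Bounded L n f m weights ρ s := by
  intro i hi j hj
  simp only [Env.set_apply, Nat.reduceEqDiff, if_false, h5] at hi hj
  rw [Stmt.Bounded, Stmt.Bounded]
  simp only [eval_add, eval_var, eval_lit, Env.set_apply, Nat.reduceEqDiff, if_false, if_true]
  refine ⟨?_, ?_, tryPair_bounded (e := i + 1) (c := j + 1) (D := D) (k := k) (pos := pos)
    (hs.congr fun A hA => ?_) (by simp [h0]) (by simp [h1])
    (by simp [h2]) (by simp) (by simp) hn (by omega) (by omega) (by omega) hD ?_ hDf hγ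
    hγf hk⟩
  · have : i + 1 ≤ f := by omega
    simpa [Wt.set, weights, Bd.val] using this
  · have : j + 1 ≤ f := by omega
    simpa [Wt.set, weights, Bd.val] using this
  · have hw : tryPair.writes A = false := by
      rcases hA with rfl | rfl | rfl | rfl | rfl | rfl <;> rfl
    refine (iter_of_not_writes (p := fun _ => .letv 7 (add (var 15) (lit 1))
      (.letv 8 (add (var 16) (lit 1)) tryPair)) fun _ => hw).trans ?_
    exact iter_of_not_writes (p := fun _ => .loop 16 5 (.letv 7 (add (var 15) (lit 1))
      (.letv 8 (add (var 16) (lit 1)) tryPair))) fun _ => hw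
  · intro x hx
    fin_cases hx <;> rfl

/-- Size i is tried only while no layering of smaller width exists, so the number (n + 1) ^ i of
tuples is covered by the hypothesis on m. -/
theorem findLayers_bounded (h0 : ρ 0 = n) (hs : Ctx H s) (h9 : s 9 = 0) (h10 : s 10 = 0)
    (hH : H.Connected) (hn : 1 ≤ n)
    (hm : ∀ k, (∀ k' < k, ¬ ∃ pos, H.IsLayering k' pos) → (n + 1) ^ k ≤ m) :
    findLayers.Bounded L n f m weights ρ s := by
  refine ⟨⟨?_, ?_⟩, bounded_of_letFree _ _ _ _ rfl⟩
  · simp [weights, Bd.val, h0]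
    omega
  have e1 : (add (var 0) (lit 1)).eval L ρ s = n + 1 := by simp [h0]
  rw [e1]
  intro i hi
  have hinv := findWidth_inv (L := L) (ρ := Env.set ρ 3 (n + 1)) (by simp [h0]) (by simp) hs h9 h10
    hH i
  set s' := iter (fun i s => (Stmt.ite (read 10 (lit 0)) .skip tryWidth).run L
    (Env.set (Env.set ρ 3 (n + 1)) 2 i) s) i s
  rw [Stmt.Bounded]
  have e2 : (read 10 (lit 0)).eval L (Env.set (Env.set ρ 3 (n + 1)) 2 i) s' = s' 10 0 := by simp
  rw [e2]
  split
  case isFalse h => trivial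
  case isTrue h =>
    obtain ⟨-, ⟨-, -, hlay⟩ | ⟨k, -, hk, -⟩⟩ := hinv
    · refine ⟨bounded_of_letFree _ _ _ _ rfl, ?_, bounded_of_letFree _ _ _ _ rfl⟩
      have := powers_spec (L := L) (A := 20) (b := 3) (l := 2) (by decide) (by decide)
        (Env.set (Env.set ρ 3 (n + 1)) 2 i) s' i (by simp)
      simp only [Env.set_apply, Nat.reduceEqDiff, if_true, if_false] at this
      have hle := hm i hlay
      simp only [eval_read, eval_var, Env.set_apply, if_true]
      rw [if_neg (by simp), this]
      simpa [Wt.set, weights, Bd.val] using hle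
    · omega

/-- The parameters of the bound on the running time are large enough. -/
def Fits (H : SimpleGraph (Fin n)) (d f m : ℕ) : Prop :=
  min n d ≤ f ∧ min n d * (min n d * min n d) ≤ f ∧ ∃ γ, 1 ≤ γ ∧ ballMax H (d * d) ≤ γ ∧
    γ ^ γ ≤ f ∧ ∀ k, (∀ k' < k, ¬ ∃ pos, H.IsLayering k' pos) → ((n + 1) * γ ^ γ) ^ k ≤ m

theorem search_bounded (hn : 1 ≤ n) (hG : G.Connected) (h0 : ρ 0 = n)
    (h1 : ρ 1 = min (n * n) d) (hs : Ctx H s)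
    (hs1 : ∀ x y : Fin n, s 1 (n * x + y) ≠ 0 ↔ G.Adj x y)
    (hz : ∀ A : Fin 32, A = 9 ∨ A = 10 ∨ A = 11 ∨ A = 18 → s A = 0) (hH : H.Connected)
    (h : Fits H d f m) : search.Bounded L n f m weights ρ s := by
  obtain ⟨hDD, hDf, γ, hγ1, hγ, hγf, hm⟩ := h
  have hpos : 0 < γ ^ γ := Nat.pow_pos hγ1
  refine ⟨findLayers_bounded h0 hs (hz 9 (by decide)) (hz 10 (by decide)) hH hn fun k hk =>
    (Nat.pow_le_pow_left (Nat.le_mul_of_pos_right _ hpos) k).trans (hm k hk), ?_⟩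
  obtain ⟨a1, k, pos, hk, a2, a3, a4⟩ := findLayers_spec (L := L) h0 hs (hz 9 (by decide))
    (hz 10 (by decide)) (hz 11 (by decide)) hH
  set s₁ := findLayers.run L ρ s with hs₁
  set D := min n d with hD
  set ρ₁ := Env.set (Env.set (Env.set ρ 2 k) 5 D) 6 (D * (D * D)) with hρ₁
  have c1 : (sub (read 10 (lit 0)) (lit 1)).eval L ρ s₁ = k := by simp [a2]
  have c2 : (sub (var 0) (sub (var 0) (var 1))).eval L (Env.set ρ 2 k) s₁ = D := by
    have : n ≤ n * n := Nat.le_mul_of_pos_left _ hn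
    simp [h0, h1]
    omega
  have c3 : (mul 5 (mul 5 (var 5))).eval L (Env.set (Env.set ρ 2 k) 5 D) s₁ = D * (D * D) := by
    simp
  simp only [Stmt.Bounded]
  rw [c1, c2, c3, ← hρ₁]
  refine ⟨by simpa [weights, Bd.val] using hk, by simpa [weights, Bd.val] using hDD,
    by simpa [weights, Bd.val] using hDf, bounded_of_letFree _ _ _ _ rfl,
    bounded_of_letFree _ _ _ _ rfl, ?_, trivial⟩
  have hρ₁0 : ρ₁ 0 = n := by simp [hρ₁, h0]
  have hρ₁6 : ρ₁ 6 = D * (D * D) := by simp [hρ₁]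
  refine tryPairs_bounded (k := k) (pos := pos) (setup_of_levels hG hH a1 ?_ a3 hρ₁0 hρ₁6) hρ₁0
    (by simp [hρ₁, h1]) (by simp [hρ₁]) (by simp [hρ₁]) hn (Nat.min_le_right _ _) hDD hDf hγ hγf ?_
  · rw [hs₁, run_of_not_writes (A := 1) _ _ _ rfl]
    exact hs1
  · exact (Nat.pow_le_pow_left (Nat.mul_le_mul_right _ (Nat.le_succ n)) k).trans (hm k a4)

theorem main_bounded (hG : G.Connected) (h : H.Connected → Fits H d f m) :
    main.Bounded (2 + 2 * (n * n)) n f m weights (fun _ => 0) (inputStore G H d) := by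
  have hn : 1 ≤ n := by
    obtain ⟨x⟩ := hG.nonempty
    exact Nat.one_le_of_lt x.2
  set L := 2 + 2 * (n * n) with hL
  set s := inputStore G H d with hs
  have e1 : (read 0 (lit 0)).eval L (fun _ => 0) s = n := by
    rw [eval_read, eval_lit, if_neg (by omega)]; simp [hs, inputStore, inputMemory]
  have e2 : (sub (mul 0 (var 0)) (sub (mul 0 (var 0)) (read 0 (lit 1)))).eval L
      (Env.set (fun _ => 0) 0 n) s = min (n * n) d := by
    have : s 0 1 = d := by simp [hs, inputStore, inputMemory]
    rw [eval_sub, eval_sub, eval_read, eval_lit, if_neg (by omega), this]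
    simp
    omega
  simp only [main, Stmt.Bounded, e1, e2]
  have e3 : Env.set (Env.set (fun _ => 0) 0 n) 1 (min (n * n) d) = mainEnv n d := rfl
  rw [e3]
  have h0 : mainEnv n d 0 = n := by simp [mainEnv]
  set ρ := mainEnv n d with hρ
  obtain ⟨a1, a2⟩ := load_spec (G := G) (H := H) (d := d) h0 hL
  set s₁ := load.run L ρ s with hs₁
  obtain ⟨b1, b2⟩ := conns_spec (L := L) a2 h0
  set s₂ := conns.run L ρ s₁ with hs₂
  have hc := holds_connCheck (L := L) h0 hn b2
  refine ⟨by simp [weights, Bd.val], by simp [weights, Bd.val, sq],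
    ⟨bounded_of_letFree _ _ _ _ rfl, bounded_of_letFree _ _ _ _ rfl, by simp [weights, Bd.val],
      bounded_of_letFree _ _ _ _ rfl⟩, bounded_of_letFree _ _ _ _ rfl, ?_⟩
  split
  · trivial
  · next hconn =>
    have hH := hc.1 hconn
    refine search_bounded hn hG h0 (by simp [hρ, mainEnv])
      (a2.congr (b1 2 (by decide) (by decide)) (b1 3 (by decide) (by decide)))
      (by rw [b1 1 (by decide) (by decide)]; exact a1) (fun A hA => ?_) hH (h hH)
    have h4 : A ≠ 4 ∧ A ≠ 5 := by rcases hA with rfl | rfl | rfl | rfl <;> decide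
    rw [b1 A h4.1 h4.2, hs₁]
    rcases hA with rfl | rfl | rfl | rfl <;> rw [run_of_not_writes _ _ _ rfl] <;> rfl

theorem Bd.val_le {n f m : ℕ} (hn : 1 ≤ n) (hf : 1 ≤ f) (hm : 1 ≤ m) {b : Bd} {c i j l : ℕ}
    (hc : b.c ≤ c) (hi : b.i ≤ i) (hj : b.j ≤ j) (hl : b.l ≤ l) :
    b.val n f m ≤ c * (n ^ i * (f ^ j * m ^ l)) := by
  unfold Bd.val
  gcongr

/-- The coefficient and the exponents bound the static estimate of the whole program, which the
kernel evaluates. Initially all variables are 0, so the weights hold trivially. -/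
theorem main_cost (hG : G.Connected) (hf : 1 ≤ f) (hm : 1 ≤ m) (h : H.Connected → Fits H d f m) :
    main.cost (2 + 2 * (n * n)) (fun _ => 0) (inputStore G H d) ≤
      8944 * (n ^ 9 * (f ^ 5 * m ^ 1)) := by
  have hn : 1 ≤ n := by
    obtain ⟨x⟩ := hG.nonempty
    exact Nat.one_le_of_lt x.2
  refine (main.cost_le hn hf hm weights _ _ (main_bounded hG h)
    fun x => Nat.zero_le _).trans ?_
  exact Bd.val_le hn hf hm (by decide +kernel) (by decide +kernel) (by decide +kernel) (by decide +kernel)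

end LoopLang

namespace LoopLang

open SimpleGraph

variable {n d α Δ : ℕ} {G H : SimpleGraph (Fin n)}

/-! ### Bounds on the parameters -/

/-- The ball of radius r + 1 is covered by the closed neighbourhoods of the points of the ball of
radius r, each of size at most Δ + 1. -/
theorem ballMax_le_pow [DecidableRel H.Adj] (hH : H.Connected) (hΔ : H.maxDegree ≤ Δ) (r : ℕ) :
    ballMax H r ≤ (Δ + 1) ^ r := by
  classical
  refine Finset.sup_le fun x _ => ?_
  rw [count_eq_card, Nat.card_eq_fintype_card, Fintype.card_subtype]
  simp only [nball_val]
  induction r with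
  | zero =>
    rw [pow_zero, Finset.card_le_one]
    intro a ha b hb
    simp only [Finset.mem_filter, Finset.mem_univ, true_and, Nat.le_zero, hH.dist_eq_zero_iff]
      at ha hb
    rw [← ha, ← hb]
  | succ r ih =>
    refine (Finset.card_le_card (t := (Finset.univ.filter fun z => H.dist x z ≤ r).biUnion
      fun z => insert z (H.neighborFinset z)) fun y hy => ?_).trans ?_
    · simp only [Finset.mem_filter, Finset.mem_univ, true_and] at hy
      simp only [Finset.mem_biUnion, Finset.mem_filter, Finset.mem_univ, true_and,
        Finset.mem_insert, mem_neighborFinset]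
      obtain ⟨p, hp⟩ := hH.exists_walk_length_eq_dist x y
      rcases Nat.lt_or_ge r p.length with hlt | hle
      · cases p with
        | nil => simp at hlt
        | cons h' p =>
          obtain ⟨z, q, hzy, e⟩ := Walk.exists_cons_eq_concat h' p
          rw [e, Walk.length_concat] at hp
          exact ⟨z, (dist_le q).trans (by omega), .inr hzy⟩
      · exact ⟨y, by omega, .inl rfl⟩
    · rw [pow_succ]
      refine (Finset.card_biUnion_le_card_mul _ _ (Δ + 1) fun z _ => ?_).trans
        (Nat.mul_le_mul_right _ ih)
      refine (Finset.card_insert_le _ _).trans (Nat.succ_le_succ ?_)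
      rw [card_neighborFinset_eq_degree]
      exact (H.degree_le_maxDegree z).trans hΔ

/-- A connected graph has at least n - 1 edges, so 2 * (n - 1) ≤ n * Δ, which excludes Δ ≤ 1 when n
≥ 3. -/
theorem two_le_of_connected [DecidableRel H.Adj] (hH : H.Connected) (hΔ : H.maxDegree ≤ Δ)
    (hn : 3 ≤ n) : 2 ≤ Δ := by
  classical
  have h1 := hH.card_vert_le_card_edgeSet_add_one
  have h2 := H.sum_degrees_eq_twice_card_edges
  have h3 : ∑ v, H.degree v ≤ n * Δ := by
    refine (Finset.sum_le_card_nsmul _ _ Δ fun v _ => (H.degree_le_maxDegree v).trans hΔ).trans ?_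
    simp
  rw [Nat.card_eq_fintype_card, Nat.card_eq_fintype_card, Fintype.card_fin, ← edgeFinset_card] at h1
  by_contra hlt
  have : n * Δ ≤ n * 1 := Nat.mul_le_mul_left _ (by omega)
  omega

/-- Taking γ = n, the cube of min n d is at most 8 and γ ^ γ at most 4, both below 12. The table
bound is at most (3 * 4) ^ 2 = 144. -/
theorem fits_of_le_two (hn1 : 1 ≤ n) (hn : n ≤ 2) : Fits H d 12 144 := by
  have hD : min n d ≤ 2 := (Nat.min_le_left _ _).trans hn
  refine ⟨by omega, ?_, n, hn1, ballMax_le H _, ?_, fun k hk => ?_⟩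
  · exact (Nat.mul_le_mul hD (Nat.mul_le_mul hD hD)).trans (by norm_num)
  · interval_cases n <;> norm_num
  · have : k ≤ n := by
      by_contra hlt
      exact hk n (by omega) ⟨_, isLayering_val H⟩
    interval_cases n <;> interval_cases k <;> norm_num

theorem le_pow_of_two_le {a b : ℕ} (ha : 2 ≤ a) : b ≤ a ^ b :=
  Nat.lt_two_pow_self.le.trans (Nat.pow_le_pow_left ha b)

/-- With γ the actual largest ball of radius d * d and X = Δ ^ (4 * d ^ 2), both γ ^ γ and the cube
of min n d are at most Δ ^ X. So f contributes 10 * X and m contributes 2 * X * α to the exponent of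
Δ. Since Δ ≥ 2, all numerical factors are absorbed into powers of Δ. -/
theorem fits_of_treewidth [DecidableRel H.Adj] (hn : 1 ≤ n) (hH : H.Connected) (hΔ : 2 ≤ Δ)
    (hdeg : H.maxDegree ≤ Δ) (hα : 1 ≤ α) (hw : treewidth H ≤ α) (hd : 1 ≤ d) :
    ∃ f m, 1 ≤ f ∧ 1 ≤ m ∧ Fits H d f m ∧
      f ^ 5 * m ≤ n ^ α * Δ ^ (Δ ^ (9 * (α * d ^ 2))) := by
  set γ := ballMax H (d * d) with hγ
  set D := min n d with hD
  set X := Δ ^ (4 * d ^ 2) with hX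
  have hΔ1 : 1 ≤ Δ := by omega
  have hX1 : 1 ≤ X := Nat.pow_pos hΔ1
  have hγ1 : 1 ≤ γ := one_le_ballMax hn H _
  have hE1 : 1 ≤ γ ^ γ := Nat.pow_pos hγ1
  have hγle : γ ≤ Δ ^ (2 * d ^ 2) := by
    refine (ballMax_le_pow hH hdeg _).trans ?_
    rw [← sq d, pow_mul]
    exact Nat.pow_le_pow_left (by nlinarith) _
  have hE : γ ^ γ ≤ Δ ^ X := by
    calc γ ^ γ ≤ (Δ ^ (2 * d ^ 2)) ^ Δ ^ (2 * d ^ 2) :=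
          (Nat.pow_le_pow_left hγle _).trans (Nat.pow_le_pow_right (Nat.pow_pos hΔ1) hγle)
      _ = Δ ^ (2 * d ^ 2 * Δ ^ (2 * d ^ 2)) := (pow_mul _ _ _).symm
      _ ≤ Δ ^ X := by
        refine Nat.pow_le_pow_right hΔ1 ?_
        calc _ ≤ Δ ^ (2 * d ^ 2) * Δ ^ (2 * d ^ 2) := Nat.mul_le_mul_right _ (le_pow_of_two_le hΔ)
          _ = X := by rw [← pow_add, hX]; congr 1; ring
  have hDD : D * (D * D) ≤ Δ ^ X := by
    have hDd : D ≤ Δ ^ d := (Nat.min_le_right _ _).trans (le_pow_of_two_le hΔ)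
    calc D * (D * D) ≤ Δ ^ d * (Δ ^ d * Δ ^ d) := Nat.mul_le_mul hDd (Nat.mul_le_mul hDd hDd)
      _ = Δ ^ (3 * d) := by rw [← pow_add, ← pow_add]; congr 1; ring
      _ ≤ Δ ^ X := by
        refine Nat.pow_le_pow_right hΔ1 ((le_pow_of_two_le hΔ).trans ?_)
        refine Nat.pow_le_pow_right hΔ1 ?_
        nlinarith
  have hD1 : D ≤ D * (D * D) := by
    rcases Nat.eq_zero_or_pos D with h | h
    · omega
    · exact Nat.le_mul_of_pos_right _ (Nat.mul_pos h h)
  refine ⟨D * (D * D) + γ ^ γ, ((n + 1) * γ ^ γ) ^ α, by omega,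
    Nat.pow_pos (Nat.mul_pos (by omega) hE1), ⟨hD1.trans (Nat.le_add_right _ _), Nat.le_add_right _ _, γ, hγ1, le_rfl,
      Nat.le_add_left _ _,
      fun k hk => ?_⟩, ?_⟩
  · refine Nat.pow_le_pow_right (Nat.mul_pos (by omega) hE1) ?_
    -- No layering of width below k exists, whereas the treewidth bound provides one of width α.
    -- Hence k ≤ α.
    by_contra hlt
    exact hk α (by omega) (exists_isLayering_of_treewidth hw)
  · have hf : D * (D * D) + γ ^ γ ≤ Δ ^ (2 * X) := by
      calc D * (D * D) + γ ^ γ ≤ 2 * Δ ^ X := by omega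
        _ ≤ Δ ^ X * Δ ^ X := Nat.mul_le_mul_right _
          (hΔ.trans (Nat.le_self_pow (by omega) Δ))
        _ = Δ ^ (2 * X) := by rw [← pow_add]; congr 1; ring
    have hm : ((n + 1) * γ ^ γ) ^ α ≤ n ^ α * Δ ^ (2 * X * α) := by
      rw [pow_mul, ← mul_pow]
      refine Nat.pow_le_pow_left ?_ α
      calc (n + 1) * γ ^ γ ≤ (n * Δ) * Δ ^ X := Nat.mul_le_mul (by nlinarith) hE
        _ ≤ (n * Δ ^ X) * Δ ^ X := by
          gcongr
          exact Nat.le_self_pow (by omega) Δ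
        _ = n * Δ ^ (2 * X) := by rw [mul_assoc, ← pow_add]; congr 2; ring
    calc _ ≤ (Δ ^ (2 * X)) ^ 5 * (n ^ α * Δ ^ (2 * X * α)) :=
          Nat.mul_le_mul (Nat.pow_le_pow_left hf 5) hm
      _ = n ^ α * Δ ^ (10 * X + 2 * X * α) := by
        rw [← pow_mul, mul_left_comm, ← pow_add]; congr 3; ring
      _ ≤ n ^ α * Δ ^ (Δ ^ (9 * (α * d ^ 2))) := by
        refine Nat.mul_le_mul_left _ (Nat.pow_le_pow_right hΔ1 ?_)
        -- As α ≥ 1, the sum is at most 12 * α * X, hence at most 2 ^ 4 * α * X. Then 2 ^ 4 ≤ Δ ^ 4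
        -- and α ≤ Δ ^ α, and the exponent 4 + α + 4 * d ^ 2 is at most 9 * (α * d ^ 2) because α
        -- and d ^ 2 are at least 1.
        calc 10 * X + 2 * X * α ≤ 2 ^ 4 * α * X := by nlinarith
          _ ≤ Δ ^ 4 * Δ ^ α * Δ ^ (4 * d ^ 2) := by
            gcongr
            exact le_pow_of_two_le hΔ
          _ = Δ ^ (4 + α + 4 * d ^ 2) := by rw [pow_add, pow_add]
          _ ≤ Δ ^ (9 * (α * d ^ 2)) := by
            refine Nat.pow_le_pow_right hΔ1 ?_
            have hd2 : 1 ≤ d ^ 2 := Nat.pow_pos hd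
            have h1 : α ≤ α * d ^ 2 := Nat.le_mul_of_pos_right _ hd2
            have h2 : d ^ 2 ≤ α * d ^ 2 := Nat.le_mul_of_pos_left _ hα
            omega

end LoopLang

/-! ### The theorem -/

open LoopLang in
theorem mainTheorem7 :
    ∃ (P : RAM.Prog) (C K : ℕ),
      ∀ (n α Δ d : ℕ) (G H : SimpleGraph (Fin n)) [DecidableRel H.Adj],
        1 ≤ α → 1 ≤ Δ → 1 ≤ d → G.Connected → H.maxDegree ≤ Δ → treewidth H ≤ α →
        ∃ (s : RAM.State) (t : ℕ),
          RAM.Exec P (initialState G H d) s t ∧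
          IsCorrectAnswer G H d s.mem ∧
          t ≤ C * (α ^ 2 * n ^ (α + 11)) * Δ ^ (d + 1) *
            (α * Δ ^ (d + 1)) ^ (Δ ^ (K * (α * d ^ 2))) := by
  -- The factor 9000 covers 8944 for the program and the 7 + 4 * n steps of the prologue. The second
  -- factor is the value of n ^ 9 * f ^ 5 * m for n = 2, f = 12, m = 144.
  refine ⟨.seq prologue (main.compile 0), 9000 * (2 ^ 9 * (12 ^ 5 * 144)), 9, ?_⟩
  intro n α Δ d G H _ hα hΔ hd hG hdeg hw
  have hn : 1 ≤ n := by
    obtain ⟨x⟩ := hG.nonempty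
    exact Nat.one_le_of_lt x.2
  obtain ⟨s, t, hexec, ht, hmem⟩ := runs_program G H d main
  refine ⟨s, t, hexec, ?_, ?_⟩
  · have hnn : n ≤ n * n := Nat.le_mul_of_pos_left _ hn
    have hans := main_spec (H := H) hG hd
    rw [IsCorrectAnswer, hmem 0 (by omega)]
    refine hans.imp_left fun ⟨h1, F, h2, h3⟩ => ⟨h1, F, fun i => ?_, h3⟩
    rw [← h2 i, hmem]
    have := i.2
    omega
  · have key : ∃ f m, 1 ≤ f ∧ 1 ≤ m ∧ (H.Connected → Fits H d f m) ∧
        n ^ 9 * (f ^ 5 * m ^ 1) ≤ 2 ^ 9 * (12 ^ 5 * 144) *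
          (n ^ (α + 11) * Δ ^ (Δ ^ (9 * (α * d ^ 2)))) := by
      have hX : 1 ≤ Δ ^ (Δ ^ (9 * (α * d ^ 2))) := Nat.pow_pos hΔ
      have hN : 1 ≤ n ^ (α + 11) := Nat.pow_pos hn
      have h9 : n ^ 9 ≤ n ^ (α + 11) := Nat.pow_le_pow_right hn (by omega)
      rcases Nat.lt_or_ge n 3 with hn3 | hn3
      · refine ⟨12, 144, by norm_num, by norm_num, fun _ => fits_of_le_two hn (by omega), ?_⟩
        have : n ^ 9 ≤ 2 ^ 9 := Nat.pow_le_pow_left (by omega) 9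
        calc n ^ 9 * (12 ^ 5 * 144 ^ 1) ≤ 2 ^ 9 * (12 ^ 5 * 144) := by gcongr; norm_num
          _ ≤ _ := Nat.le_mul_of_pos_right _ (Nat.mul_pos hN hX)
      -- With three or more vertices, connectedness gives Δ ≥ 2, as `fits_of_treewidth` requires. If
      -- `H` is disconnected the search is skipped, so f = m = 1 is enough.
      by_cases hH : H.Connected
      · obtain ⟨f, m, h1, h2, h3, h4⟩ := fits_of_treewidth hn hH
          (two_le_of_connected hH hdeg hn3) hdeg hα hw hd
        refine ⟨f, m, h1, h2, fun _ => h3, ?_⟩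
        calc n ^ 9 * (f ^ 5 * m ^ 1) ≤ n ^ 9 * (n ^ α * Δ ^ (Δ ^ (9 * (α * d ^ 2)))) := by
              rw [pow_one]; exact Nat.mul_le_mul_left _ h4
          _ = n ^ (α + 9) * Δ ^ (Δ ^ (9 * (α * d ^ 2))) := by rw [pow_add]; ring
          _ ≤ n ^ (α + 11) * Δ ^ (Δ ^ (9 * (α * d ^ 2))) :=
            Nat.mul_le_mul_right _ (Nat.pow_le_pow_right hn (by omega))
          _ ≤ _ := Nat.le_mul_of_pos_left _ (by norm_num)
      · refine ⟨1, 1, le_rfl, le_rfl, fun h => absurd h hH, ?_⟩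
        calc n ^ 9 * (1 ^ 5 * 1 ^ 1) ≤ n ^ (α + 11) * Δ ^ (Δ ^ (9 * (α * d ^ 2))) := by
              rw [one_pow, one_pow, mul_one, mul_one]
              exact h9.trans (Nat.le_mul_of_pos_right _ hX)
          _ ≤ _ := Nat.le_mul_of_pos_left _ (by norm_num)
    obtain ⟨f, m, hf, hm, hfits, hle⟩ := key
    have hcost := main_cost hG hf hm hfits
    have hn9 : n ≤ n ^ 9 * (f ^ 5 * m ^ 1) :=
      (Nat.le_self_pow (by norm_num) n).trans
        (Nat.le_mul_of_pos_right _ (Nat.mul_pos (Nat.pow_pos hf) (Nat.pow_pos hm)))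
    have hΔd : 1 ≤ Δ ^ (d + 1) := Nat.pow_pos hΔ
    -- The estimate so far has base Δ in the tower; it is weakened to the larger base of the claim.
    have hbase : Δ ≤ α * Δ ^ (d + 1) :=
      (Nat.le_self_pow (by omega) Δ).trans (Nat.le_mul_of_pos_left _ hα)
    calc t ≤ 9000 * (n ^ 9 * (f ^ 5 * m ^ 1)) := by omega
      _ ≤ 9000 * (2 ^ 9 * (12 ^ 5 * 144) * (n ^ (α + 11) * Δ ^ (Δ ^ (9 * (α * d ^ 2))))) :=
        Nat.mul_le_mul_left _ hle
      _ = 9000 * (2 ^ 9 * (12 ^ 5 * 144)) * (1 * n ^ (α + 11)) * 1 *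
          Δ ^ (Δ ^ (9 * (α * d ^ 2))) := by ring
      _ ≤ _ := by
        gcongr
        exact Nat.pow_pos hα
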